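/- **Setting.** Let $\Lambda=\bigcup_i\Lambda_i=\Lambda^+\cup\Lambda^0\cup\Lambda^-$ be an oriented Legendrian link in $(\mathbb R^3,\ \alpha_{std}=dz-y\,dx)$ with finitely many components, with coefficients $c_i\in\{1,0,-1\}$ according to the sublink containing $\Lambda_i$. Every component has length $1$ in the metric on the contact planes for which $\partial_x+y\partial_z,\ \partial_y$ are orthonormal, and is parametrised by unit speed over $S^1=\mathbb R/\mathbb Z$. Assume that $\Lambda$ is chord generic (all chords of $\partial_z$ are non-degenerate and distinct chords are disjoint) and in good position (near each double point of the $xy$-projection the over-strand is straight in direction $\pm(1,-1)$, the under-strand in direction $\pm(1,1)$). For a chord $r$ from $\Lambda_{l^-}$ up to $\Lambda_{l^+}$ write $q_r^-,q_r^+$ for the parameters of its tail and tip, and $c_r^\pm=c_{l^\pm}$. Fix $\varepsilon_0>0$ and standard neighbourhoods: disjoint smooth embeddings $\Phi_i:\{|z|,|p|<\varepsilon_0\}\times S^1\to\mathbb R^3$ with $\Phi_i^*\alpha_{std}=dz+p\,dq$, $\Phi_i(0,0,q)=\Lambda_i(q)$, taking the rotation $J_0$ ($\partial_x+y\partial_z\mapsto\partial_y$)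 to $\partial_p\mapsto\partial_q-p\partial_z$ along $p=0$, and equal near the tip (tail) of each chord, up to replacing $(p,q-q_r^\pm)$ by its negative, to the model whose $xy$-projection is $(x_0+\tfrac{q-p}{\sqrt2},\,y_0-\tfrac{p+q}{\sqrt2})$ (respectively $(x_0+\tfrac{p+q}{\sqrt2},\,y_0+\tfrac{q-p}{\sqrt2})$) and whose $z$-component is that for which $\alpha_{std}$ pulls back to $dz+p\,dq$. **Surgery.** For $0<\varepsilon<\varepsilon_0$ let $f:\mathbb R\to[0,1]$ be smooth, $f=0$ on $(-\infty,-1]$, $f=1$ on $[1,\infty)$, with $f'$ even, $0\le f'\le1$, $f'$ supported in a compact subset of $(-1,1)$; set $f_\varepsilon(p)=f(p/\varepsilon)$, $H_\varepsilon(p)=\int_{-\infty}^pPf_\varepsilon'(P)\,dP$. Assume there is $\rho$ with $f'=1$ on $[-\rho,\rho]$ such that, for chords $r,r'$ with $l_r^+=l_{r'}^-=i$, $c_i\ne0$: if $|p|\le\varepsilon$, $|q-q_r^+|\le\varepsilon$ and $|q+c_if_\varepsilon(p)-q_{r'}^-|\le\varepsilon$ modulo $1$, then $|p|\le\rho\varepsilon$.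 The surgered manifold is obtained by removing the closed tubes $N_{\varepsilon,i}=\Phi_i(\{|z|,|p|\le\varepsilon\})$, $c_i\neq0$, and gluing in the handles $\{|p|\le\varepsilon,\ -\varepsilon\le z\le\varepsilon+c_iH_\varepsilon(p)\}\times S^1$ by $(z,p,q)\mapsto(z-c_iH_\varepsilon(p),\,p,\,q+c_if_\varepsilon(p))$ along the top and by the identity along the bottom and sides. The forms $\alpha_{std}$ outside and $dz+p\,dq$ in the handles define a contact form $\alpha_\varepsilon$; $R_\varepsilon$ is its Reeb vector field. The entry square of a chord $r$ is $\{z=-\varepsilon,\,|p|\le\varepsilon,\,|q-q_r^+|\le\varepsilon\}$ at the bottom of the handle about $\Lambda_{l_r^+}$; its exit square is $\{z=\varepsilon,\,|p|\le\varepsilon,\,|q-q_r^-|\le\varepsilon\}$, in coordinates of the removed tube, at the top of the handle about $\Lambda_{l_r^-}$. **Framing.** $(X,Y)=(\partial_x+y\partial_z,\partial_y)$ outside the handles. In the handle about $\Lambda_i$, with $c=c_i$, for $cp<\varepsilon-\delta$, the coordinates of $X,Y$ in the basis $(\partial_p,\partial_q-p\partial_z)$ are the columns of $$\begin{pmatrix}1&0\\-cf_\varepsilon'(\zeta)&1\end{pmatrix}B_i(p,\eta)^{-1},\qquad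 \zeta=p\,\nu(z)-c\varepsilon(1-\nu(z)),\quad \eta=q+cf_\varepsilon(\zeta),$$ where $B_i(p,q)$ is the change of basis from $(\partial_p,\partial_q-p\partial_z)$ to $(\partial_x+y\partial_z,\partial_y)$ at $\Phi_i(0,p,q)$, $\nu:\mathbb R\to[0,1]$ is smooth, $0$ for $z\le-\varepsilon$ and $1$ for $z\ge\varepsilon+H_\varepsilon(0)$, and $\delta>0$ is such that $f_\varepsilon'(p)=0$ for $|p|\ge\varepsilon-\delta$. On the remaining strips $X,Y$ are arbitrary sections of the contact structure. **Words and angles.** For a path $\zeta$ in $\Lambda$, $\theta(\zeta)\in\mathbb R$ is the total variation of the angle of the oriented unit tangent vector of $\Lambda$, in the $xy$-plane, along $\zeta$. For chords $r,r'$ with $l_r^+=l_{r'}^-$, $\mathrm{rot}_{r,r'}=\lfloor\theta(\eta_{r,r'})/\pi\rfloor$, where $\eta_{r,r'}$ is the embedded path in $\Lambda$ from the tip of $r$ to the tail of $r'$ following the orientation. A word of chords with boundary on $\Lambda^0$ is $r_1\cdots r_n$, $n\ge1$, with $l_{r_j}^+=l_{r_{j+1}}^-$ a component of $\Lambda^+\cup\Lambda^-$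 for $j<n$, $r_1$ beginning and $r_n$ ending on $\Lambda^0$. A chord $\kappa$ of $R_\varepsilon$ with end points on $\Lambda^0$ has word $r_1\cdots r_n$ if it passes through exactly $n-1$ handles, entering the $j$-th through the entry square of $r_j$ and leaving it through the exit square of $r_{j+1}$; if $n=1$, if it meets no handle and has the end points of $r_1$. For a chord with this word put $$m_{X,Y}(\kappa)=\sum_{j=1}^{n-1}\bigl(\mathrm{rot}_{r_j,r_{j+1}}+\delta_{1,c^+_{r_j}}\bigr).$$ **Maslov index.** A broken closed string on $\Lambda^0$ is a closed loop $b=(a_1\kappa_1)*\zeta_1*\cdots*(a_n\kappa_n)*\zeta_n$ with $n\ge1$, $a_k\in\{\pm1\}$, $\kappa_k$ chords of $R_\varepsilon$ with end points on $\Lambda^0$ ($-\kappa_k$ being $\kappa_k$ reversed) and $\zeta_k$ paths in $\Lambda^0$. Its Maslov index $\mathrm{Maslov}_{X,Y}(b)\in\mathbb Z$ is the degree of the following loop in the circle $\mathbb R/\pi\mathbb Z$ of unoriented lines in the contact planes, identified with $\mathbb R^2$ by $(X,Y)$ (angles increasing from $X$ to $Y$): along $a_k\kappa_k$ it is the image of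 $T\Lambda^0$ at the initial point of $a_k\kappa_k$ under the linearised flow of $R_\varepsilon$ (of $-R_\varepsilon$ if $a_k=-1$); then it makes the smallest clockwise rotation to $T\Lambda^0$ at the final point of $a_k\kappa_k$; along $\zeta_k$ it is $T\Lambda^0$. **Theorem.** There is $\varepsilon_1\in(0,\varepsilon_0]$, depending only on $\Lambda$ and the $\Phi_i$, such that for all $0<\varepsilon<\varepsilon_1$, all $f$ and $(X,Y)$ as above and every broken closed string $b=(a_1\kappa_1)*\zeta_1*\cdots*(a_n\kappa_n)*\zeta_n$ on $\Lambda^0$ in the surgered manifold: each $\kappa_k$ has exactly one word of chords with boundary on $\Lambda^0$, the Maslov index of $b$ is well defined, and $$\mathrm{Maslov}_{X,Y}(b)=\sum_{k=1}^n\Bigl(\frac{\theta(\zeta_k)}{\pi}-\frac12+a_k\,m_{X,Y}(\kappa_k)\Bigr).$$ -/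

import Mathlib

open Set Filter Topology
open scoped ContDiff

noncomputable section

namespace LegendrianSurgery

/-- Three-space. Points of `ℝ³` are written `(x, y, z)`; points of a tubular neighbourhood
`I × I × S¹` of a knot are written `(z, p, q)`, the circle coordinate `q ∈ ℝ/ℤ` being lifted
to `ℝ`. -/
abbrev R3 : Type := ℝ × ℝ × ℝ

/-- Projection of `(x, y, z)` to the `xy`-plane. -/
def xy (v : R3) : ℝ × ℝ := (v.1, v.2.1)

/-- `α_std = dz - y dx` at `u`, applied to `v`, in coordinates `(x, y, z)`. -/
def alphaStd (u : R3) : R3 →L[ℝ] ℝ :=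
  ContinuousLinearMap.snd ℝ ℝ ℝ ∘L ContinuousLinearMap.snd ℝ ℝ (ℝ × ℝ)
    - u.2.1 • ContinuousLinearMap.fst ℝ ℝ (ℝ × ℝ)

/-- `dz + p dq` at `u`, applied to `v`, in coordinates `(z, p, q)`. -/
def alphaTube (u : R3) : R3 →L[ℝ] ℝ :=
  ContinuousLinearMap.fst ℝ ℝ (ℝ × ℝ)
    + u.2.1 • (ContinuousLinearMap.snd ℝ ℝ ℝ ∘L ContinuousLinearMap.snd ℝ ℝ (ℝ × ℝ))

/-- `v` is the value at `u` of the Reeb vector field of the 1-form `α`: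
`α(v) = 1` and `dα(v, ·) = 0`. -/
def IsReebAt (α : R3 → R3 →L[ℝ] ℝ) (u v : R3) : Prop :=
  α u v = 1 ∧ ∀ w : R3, fderiv ℝ α u v w - fderiv ℝ α u w v = 0

/-- Variation of the angle of a path of unit vectors `e` in the plane over `[a, b]`:
`Θ(b) - Θ(a)` for a continuous lift `Θ` of `e` to `ℝ`. -/
def angleVariation (e : ℝ → ℝ × ℝ) (a b : ℝ) : ℝ :=
  open Classical in
  if h : ∃ Θ : ℝ → ℝ, ContinuousOn Θ (Icc a b) ∧
      ∀ t ∈ Icc a b, e t = (Real.cos (Θ t), Real.sin (Θ t))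
  then h.choose b - h.choose a else 0

/-! ### Legendrian links, chords, words -/

/-- An oriented Legendrian link `Λ = ⋃ Λ_i` in `(ℝ³, dz - y dx)` all of whose components have
length one with respect to the metric for which `∂x + y ∂z, ∂y` are orthonormal, each parametrised
by unit speed over `ℝ/ℤ` in the direction of its orientation. The coefficient says to which of
`Λ⁺`, `Λ⁰`, `Λ⁻` a component belongs. -/
structure SurgeryLink (ι : Type*) where
  curve : ι → ℝ → R3
  coeff : ι → SignType
  smooth : ∀ i, ContDiff ℝ ∞ (curve i)
  periodic : ∀ i s, curve i (s + 1) = curve i s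
  legendrian : ∀ i s, alphaStd (curve i s) (deriv (curve i) s) = 0
  unit_speed : ∀ i s, (deriv (curve i) s).1 ^ 2 + (deriv (curve i) s).2.1 ^ 2 = 1
  embedded : ∀ i j s t, curve i s = curve j t → i = j ∧ ∃ k : ℤ, t = s + k

namespace SurgeryLink

variable {ι : Type*} (L : SurgeryLink ι)

/-- Unit tangent vector of the Lagrangian projection of `Λ_i`, which is also the coordinate vector
of `T Λ_i` in the basis `∂x + y ∂z, ∂y` of the contact plane. -/
def tangent (i : ι) (s : ℝ) : ℝ × ℝ := xy (deriv (L.curve i) s)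

/-- A chord of `∂z` with boundary on `Λ`: it runs upwards from the tail, on component `tailIdx` at
parameter `tailPar`, to the tip, on component `tipIdx` at parameter `tipPar`. -/
@[ext] structure Chord where
  tailIdx : ι
  tipIdx : ι
  tailPar : ℝ
  tipPar : ℝ
  tailPar_mem : tailPar ∈ Ico (0 : ℝ) 1
  tipPar_mem : tipPar ∈ Ico (0 : ℝ) 1
  vertical : xy (L.curve tailIdx tailPar) = xy (L.curve tipIdx tipPar)
  upward : (L.curve tailIdx tailPar).2.2 < (L.curve tipIdx tipPar).2.2

variable {L} in
/-- The starting point of a chord. -/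
def Chord.tail (r : L.Chord) : R3 := L.curve r.tailIdx r.tailPar

variable {L} in
/-- The end point of a chord. -/
def Chord.tip (r : L.Chord) : R3 := L.curve r.tipIdx r.tipPar

variable {L} in
/-- A chord as a subset of `ℝ³`. -/
def Chord.segment (r : L.Chord) : Set R3 :=
  {u | xy u = xy r.tail ∧ r.tail.2.2 ≤ u.2.2 ∧ u.2.2 ≤ r.tip.2.2}

/-- All chords are non-degenerate and distinct chords are disjoint. -/
def ChordGeneric : Prop :=
  (∀ r : L.Chord,
    (L.tangent r.tailIdx r.tailPar).1 * (L.tangent r.tipIdx r.tipPar).2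
      - (L.tangent r.tailIdx r.tailPar).2 * (L.tangent r.tipIdx r.tipPar).1 ≠ 0) ∧
  ∀ r r' : L.Chord, (r.segment ∩ r'.segment).Nonempty → r = r'

/-- Near every double point of the Lagrangian projection the over-crossing strand is a straight
segment in direction `±(1, -1)` and the under-crossing strand one in direction `±(1, 1)`. -/
def GoodPosition : Prop :=
  ∀ r : L.Chord,
    (∃ σ : ℝ, (σ = 1 ∨ σ = -1) ∧ ∀ᶠ t in 𝓝 (0 : ℝ),
      xy (L.curve r.tipIdx (r.tipPar + t)) = xy r.tip + (σ * t / √2) • ((1, -1) : ℝ × ℝ)) ∧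
    (∃ σ : ℝ, (σ = 1 ∨ σ = -1) ∧ ∀ᶠ t in 𝓝 (0 : ℝ),
      xy (L.curve r.tailIdx (r.tailPar + t)) = xy r.tail + (σ * t / √2) • ((1, 1) : ℝ × ℝ))

/-- A word of chords with boundary on `Λ⁰`: consecutive chords are composable at a component of
`Λ⁺ ∪ Λ⁻`, the first chord begins on `Λ⁰` and the last one ends on `Λ⁰`. -/
def IsWord (w : List L.Chord) : Prop :=
  (∀ l (hl : l + 1 < w.length),
    w[l].tipIdx = w[l + 1].tailIdx ∧ L.coeff w[l].tipIdx ≠ 0) ∧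
  ∃ h : w ≠ [], L.coeff (w.head h).tailIdx = 0 ∧ L.coeff (w.getLast h).tipIdx = 0

/-- Rotation angle `θ` of the capping path of a composable pair of chords: the path follows the
orientation of the link from the tip of `r` to the tail of `r'` and is embedded. -/
def cappingAngle (r r' : L.Chord) : ℝ :=
  angleVariation (L.tangent r.tipIdx) r.tipPar
    (r.tipPar + Int.fract (r'.tailPar - r.tipPar))

/-- Rotation number of a composable pair of chords. -/
def rot (r r' : L.Chord) : ℤ := ⌊L.cappingAngle r r' / Real.pi⌋

/-- `m_{X,Y}` of a word `r_1 ⋯ r_n`: the sum over `l < n` of `rot(r_l, r_{l+1})` plus one if the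
component on which `r_l` ends has coefficient `+1`. -/
def wordIndex (w : List L.Chord) : ℤ :=
  ((w.zip w.tail).map fun p =>
    L.rot p.1 p.2 + if L.coeff p.1.tipIdx = 1 then 1 else 0).sum

end SurgeryLink

/-! ### Standard neighbourhoods -/

/-- Model tube around the over-crossing strand at the point `c`. -/
def modelOver (c u : R3) : R3 :=
  (c.1 + (u.2.2 - u.2.1) / √2, c.2.1 - (u.2.1 + u.2.2) / √2,
    c.2.2 + u.1 + c.2.1 * ((u.2.2 - u.2.1) / √2)
      + u.2.1 ^ 2 / 4 + u.2.1 * u.2.2 / 2 - u.2.2 ^ 2 / 4)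

/-- Model tube around the under-crossing strand at the point `c`. -/
def modelUnder (c u : R3) : R3 :=
  (c.1 + (u.2.1 + u.2.2) / √2, c.2.1 + (u.2.2 - u.2.1) / √2,
    c.2.2 + u.1 + c.2.1 * ((u.2.1 + u.2.2) / √2)
      - u.2.1 ^ 2 / 4 + u.2.1 * u.2.2 / 2 + u.2.2 ^ 2 / 4)

/-- The open tube `|z| < ε`, `|p| < ε`. -/
def openTube (ε : ℝ) : Set R3 := {u | |u.1| < ε ∧ |u.2.1| < ε}

/-- The closed tube `|z| ≤ ε`, `|p| ≤ ε`. -/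
def closedTube (ε : ℝ) : Set R3 := {u | |u.1| ≤ ε ∧ |u.2.1| ≤ ε}

/-- Standard neighbourhoods of the components of a link: disjoint embedded tubes with coordinates
`(z, p, q)` in which `α_std = dz + p dq`, in which `Λ_i = {z = p = 0}`, in which the complex
structure rotating `∂x + y ∂z` to `∂y` takes `∂p` to `∂q - p ∂z` along `p = 0`, and which agree
with the models near the end points of chords, up to the sign of `(p, q)`. -/
structure StandardNeighborhood {ι : Type*} (L : SurgeryLink ι) (ε₀ : ℝ) where
  toFun : ι → R3 → R3
  smooth : ∀ i, ContDiffOn ℝ ∞ (toFun i) (openTube ε₀)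
  periodic : ∀ i, ∀ u ∈ openTube ε₀, toFun i (u + (0, 0, 1)) = toFun i u
  embedded : ∀ i j, ∀ u ∈ openTube ε₀, ∀ v ∈ openTube ε₀,
    toFun i u = toFun j v → i = j ∧ ∃ k : ℤ, v = u + (0, 0, (k : ℝ))
  contact : ∀ i, ∀ u ∈ openTube ε₀, ∀ v : R3,
    alphaStd (toFun i u) (fderiv ℝ (toFun i) u v) = alphaTube u v
  core : ∀ i q, toFun i (0, 0, q) = L.curve i q
  complex : ∀ i, ∀ u ∈ openTube ε₀, u.2.1 = 0 →
    xy (fderiv ℝ (toFun i) u (0, 0, 1)) =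
      (-(fderiv ℝ (toFun i) u (0, 1, 0)).2.1, (fderiv ℝ (toFun i) u (0, 1, 0)).1)
  model_tip : ∀ r : L.Chord, ∃ σ : ℝ, (σ = 1 ∨ σ = -1) ∧ ∀ᶠ u in 𝓝 ((0, 0, r.tipPar) : R3),
    toFun r.tipIdx u = modelOver r.tip (u.1, σ * u.2.1, σ * (u.2.2 - r.tipPar))
  model_tail : ∀ r : L.Chord, ∃ σ : ℝ, (σ = 1 ∨ σ = -1) ∧
    ∀ᶠ u in 𝓝 ((0, 0, r.tailPar) : R3),
      toFun r.tailIdx u = modelUnder r.tail (u.1, σ * u.2.1, σ * (u.2.2 - r.tailPar))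

/-! ### The Dehn twist -/

/-- Profile functions of the Dehn twist: `f` rises smoothly from `0` to `1`, and its derivative is
even, has values in `[0, 1]`, and vanishes outside a compact subset of `(-1, 1)`. -/
structure IsTwistProfile (f : ℝ → ℝ) : Prop where
  smooth : ContDiff ℝ ∞ f
  left : ∀ p ≤ -1, f p = 0
  right : ∀ p, 1 ≤ p → f p = 1
  deriv_nonneg : ∀ p, 0 ≤ deriv f p
  deriv_le_one : ∀ p, deriv f p ≤ 1
  deriv_even : ∀ p, deriv f (-p) = deriv f p
  deriv_support : ∃ r < 1, ∀ p, r ≤ |p| → deriv f p = 0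

/-- `f_ε(p) = f(p / ε)`. -/
def fScaled (f : ℝ → ℝ) (ε p : ℝ) : ℝ := f (p / ε)

/-- `H_ε(p)`, the integral of `P f_ε'(P)` over `P ≤ p`. -/
def HFun (f : ℝ → ℝ) (ε p : ℝ) : ℝ := ∫ P in Iic p, P * deriv (fScaled f ε) P

/-- `f` is affine of slope one on an interval `[-ρ, ρ]` so large that every point
`|p| ≤ ε`, `|q - q_r⁺| ≤ ε` of a tube, at the tip of a chord `r`, which the twist
`q ↦ q + c f_ε(p)` takes to a point with `|q - q_{r'}⁻| ≤ ε`, at the tail of a chord `r'`, has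
`|p| ≤ ρ ε`. -/
def IsAdapted {ι : Type*} (L : SurgeryLink ι) (ε : ℝ) (f : ℝ → ℝ) : Prop :=
  ∃ ρ : ℝ, (∀ u, |u| ≤ ρ → deriv f u = 1) ∧
    ∀ r r' : L.Chord, r.tipIdx = r'.tailIdx → L.coeff r.tipIdx ≠ 0 →
      ∀ p q : ℝ, |p| ≤ ε → |q - r.tipPar| ≤ ε →
        (∃ k : ℤ, |q + (L.coeff r.tipIdx : ℝ) * fScaled f ε p - r'.tailPar - k| ≤ ε) →
        |p| ≤ ρ * ε

/-! ### The surgered contact manifold -/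

namespace StandardNeighborhood

variable {ι : Type*} {L : SurgeryLink ι} {ε₀ : ℝ} (N : StandardNeighborhood L ε₀)
  (ε : ℝ) (f : ℝ → ℝ)

/-- The union of the closed tubes of size `ε` about the components of `Λ⁺ ∪ Λ⁻`. -/
def removed : Set R3 := {u | ∃ i, L.coeff i ≠ 0 ∧ u ∈ N.toFun i '' closedTube ε}

end StandardNeighborhood

section Surgery

variable {ι : Type*} (L : SurgeryLink ι) (ε₀ ε : ℝ) (f : ℝ → ℝ)

/-- The handle about `Λ_i` in its own (inside) coordinates: `|p| ≤ ε`, `-ε ≤ z ≤ ε + c H_ε(p)`.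
Its top `z = ε + c H_ε(p)` is glued to the top `z = ε` of the tube that was removed. -/
def handle (i : ι) : Set R3 :=
  {u | |u.2.1| ≤ ε ∧ -ε ≤ u.1 ∧ u.1 ≤ ε + (L.coeff i : ℝ) * HFun f ε u.2.1}

/-- An open neighbourhood of the handle in inside coordinates. -/
def handleNhd (i : ι) : Set R3 :=
  {u | |u.2.1| < ε₀ ∧ -ε₀ < u.1 ∧ u.1 - (L.coeff i : ℝ) * HFun f ε u.2.1 < ε₀}

/-- The gluing map from inside to outside coordinates: `(z - c H_ε(p), p, q + c f_ε(p))` above the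
handle, the identity below it and beside it (where both formulas agree, as `q` is taken
modulo one). -/
def gluing (i : ι) (u : R3) : R3 :=
  open Classical in
  if 0 < u.1 then
    (u.1 - (L.coeff i : ℝ) * HFun f ε u.2.1, u.2.1,
      u.2.2 + (L.coeff i : ℝ) * fScaled f ε u.2.1)
  else u

end Surgery

namespace StandardNeighborhood

variable {ι : Type*} {L : SurgeryLink ι} {ε₀ : ℝ} (N : StandardNeighborhood L ε₀)
  (ε : ℝ) (f : ℝ → ℝ)

/-- The gluing map with values in `ℝ³`. -/
def toOutside (i : ι) (u : R3) : R3 := N.toFun i (gluing L ε f i u)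

/-- The open pieces from which the surgered manifold is glued: the complement of the removed tubes
in `ℝ³` (index `none`, coordinates `(x, y, z)`) and, for every component of `Λ⁺ ∪ Λ⁻`, a
neighbourhood of its handle (index `some i`, inside coordinates `(z, p, q)`). -/
def piece : Option ι → Set R3
  | none => (N.removed ε)ᶜ
  | some i => {u | L.coeff i ≠ 0 ∧ u ∈ handleNhd L ε₀ ε f i}

/-- The identifications: `q ~ q + 1` in the handles, and the gluing map off the handles. -/
inductive Rel : (Σ a : Option ι, N.piece ε f a) → (Σ a : Option ι, N.piece ε f a) → Prop
  | period (i : ι) (u : R3) (h : u ∈ N.piece ε f (some i))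
      (h' : u + (0, 0, 1) ∈ N.piece ε f (some i)) :
      Rel ⟨some i, u, h⟩ ⟨some i, u + (0, 0, 1), h'⟩
  | glue (i : ι) (u : R3) (h : u ∈ N.piece ε f (some i)) (hu : u ∉ handle L ε f i)
      (h' : N.toOutside ε f i u ∈ N.piece ε f none) :
      Rel ⟨some i, u, h⟩ ⟨none, N.toOutside ε f i u, h'⟩

/-- The surgered manifold, the result of contact `±1`-surgery on `Λ^±`. -/
def Surgered : Type _ := Quot (N.Rel ε f)

instance : TopologicalSpace (N.Surgered ε f) :=
  inferInstanceAs (TopologicalSpace (Quot (N.Rel ε f)))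

/-- The point with coordinates `u` in the piece `a`. -/
def pt (a : Option ι) (u : R3) (h : u ∈ N.piece ε f a) : N.Surgered ε f :=
  Quot.mk _ ⟨a, u, h⟩

end StandardNeighborhood

section ContactForm

variable {ι : Type*}

/-- The contact form `α_ε` in the coordinates of the pieces of the surgered manifold. -/
def contactForm : Option ι → R3 → R3 →L[ℝ] ℝ
  | none => alphaStd
  | some _ => alphaTube

/-- The Reeb vector field `R_ε` in the coordinates of the pieces. -/
def reebField : Option ι → R3 → R3
  | none => fun _ => (0, 0, 1)
  | some _ => fun _ => (1, 0, 0)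

theorem fderiv_alphaStd (u v w : R3) : fderiv ℝ alphaStd u v w = -(v.2.1 * w.1) := by
  have h : HasFDerivAt alphaStd
      (-((ContinuousLinearMap.fst ℝ ℝ ℝ ∘L ContinuousLinearMap.snd ℝ ℝ (ℝ × ℝ)).smulRight
        (ContinuousLinearMap.fst ℝ ℝ (ℝ × ℝ)))) u := by
    have h1 : HasFDerivAt (fun u : R3 => u.2.1)
        (ContinuousLinearMap.fst ℝ ℝ ℝ ∘L ContinuousLinearMap.snd ℝ ℝ (ℝ × ℝ)) u :=
      (ContinuousLinearMap.fst ℝ ℝ ℝ ∘L ContinuousLinearMap.snd ℝ ℝ (ℝ × ℝ)).hasFDerivAt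
    exact (h1.smul_const _).const_sub _
  rw [h.fderiv]
  simp

theorem fderiv_alphaTube (u v w : R3) : fderiv ℝ alphaTube u v w = v.2.1 * w.2.2 := by
  have h : HasFDerivAt alphaTube
      ((ContinuousLinearMap.fst ℝ ℝ ℝ ∘L ContinuousLinearMap.snd ℝ ℝ (ℝ × ℝ)).smulRight
        (ContinuousLinearMap.snd ℝ ℝ ℝ ∘L ContinuousLinearMap.snd ℝ ℝ (ℝ × ℝ))) u := by
    have h1 : HasFDerivAt (fun u : R3 => u.2.1)
        (ContinuousLinearMap.fst ℝ ℝ ℝ ∘L ContinuousLinearMap.snd ℝ ℝ (ℝ × ℝ)) u :=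
      (ContinuousLinearMap.fst ℝ ℝ ℝ ∘L ContinuousLinearMap.snd ℝ ℝ (ℝ × ℝ)).hasFDerivAt
    exact (h1.smul_const _).const_add _
  rw [h.fderiv]
  simp

/-- `reebField` is the Reeb vector field of `contactForm`. -/
theorem isReebAt_contactForm_iff (a : Option ι) (u v : R3) :
    IsReebAt (contactForm a) u v ↔ v = reebField a u := by
  obtain ⟨v1, v2, v3⟩ := v
  cases a with
  | none =>
    simp only [IsReebAt, contactForm, reebField, fderiv_alphaStd, Prod.mk.injEq]
    constructor
    · rintro ⟨h1, h2⟩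
      have e1 := h2 (1, 0, 0)
      have e2 := h2 (0, 1, 0)
      simp at e1 e2
      subst e1 e2
      simp [alphaStd] at h1
      simp [h1]
    · rintro ⟨rfl, rfl, rfl⟩
      simp [alphaStd]
  | some i =>
    simp only [IsReebAt, contactForm, reebField, fderiv_alphaTube, Prod.mk.injEq]
    constructor
    · rintro ⟨h1, h2⟩
      have e1 := h2 (0, 0, 1)
      have e2 := h2 (0, 1, 0)
      simp at e1 e2
      subst e1 e2
      simp [alphaTube] at h1
      simp [h1]
    · rintro ⟨rfl, rfl, rfl⟩
      simp [alphaTube]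

end ContactForm

/-! ### The framing `(X, Y)` -/

namespace StandardNeighborhood

variable {ι : Type*} {L : SurgeryLink ι} {ε₀ : ℝ} (N : StandardNeighborhood L ε₀)
  (ε : ℝ) (f : ℝ → ℝ)

/-- The change of basis from `(∂p, ∂q - p ∂z)` to `(∂x + y ∂z, ∂y)` at `(0, p, q)` in the tube
about `Λ_i`. -/
def basisChange (i : ι) (p q : ℝ) : Matrix (Fin 2) (Fin 2) ℝ :=
  let D := fderiv ℝ (N.toFun i) (0, p, q)
  !![(D (0, 1, 0)).1, (D (-p, 0, 1)).1; (D (0, 1, 0)).2.1, (D (-p, 0, 1)).2.1]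

/-- The coordinates, in the basis `(∂p, ∂q - p ∂z)` of inside coordinates, of the framing `(X, Y)`
at the point `u = (z, p, q)` of the handle about `Λ_i`, as the columns of a matrix. With
`ζ = p ν(z) - c ε (1 - ν(z))` and `η = q + c f_ε(ζ)`, it is the inverse of the change of basis at
`(p, η)` followed by a shear by `-c f_ε'(ζ)`. -/
def framingMatrix (ν : ℝ → ℝ) (i : ι) (u : R3) : Matrix (Fin 2) (Fin 2) ℝ :=
  let c : ℝ := (L.coeff i : ℝ)
  let ζ : ℝ := u.2.1 * ν u.1 - c * ε * (1 - ν u.1)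
  let η : ℝ := u.2.2 + c * fScaled f ε ζ
  !![1, 0; -c * deriv (fScaled f ε) ζ, 1] * (N.basisChange i u.2.1 η)⁻¹

/-- A framing `(X, Y)` of the contact structure of the surgered manifold. The sections are given in
the coordinates of the pieces. They are `∂x + y ∂z, ∂y` outside the handles. In the handle about
`Λ_i` they are given by `framingMatrix` on `c p < ε - δ`, where `ν` is a cutoff function which is
zero at the bottom and one at the top of the handle; on the remaining strip, where `f_ε` is
constant and where they have zeros in general, they may be any sections of the contact
structure. -/
structure Framing where
  X : Option ι → R3 → R3
  Y : Option ι → R3 → R3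
  ν : ℝ → ℝ
  δ : ℝ
  ν_smooth : ContDiff ℝ ∞ ν
  ν_mem : ∀ z, ν z ∈ Icc (0 : ℝ) 1
  ν_bottom : ∀ z ≤ -ε, ν z = 0
  ν_top : ∀ z, ε + HFun f ε 0 ≤ z → ν z = 1
  δ_pos : 0 < δ
  δ_strip : ∀ p, ε - δ ≤ |p| → deriv (fScaled f ε) p = 0
  X_mem : ∀ a, ∀ u ∈ N.piece ε f a, contactForm a u (X a u) = 0
  Y_mem : ∀ a, ∀ u ∈ N.piece ε f a, contactForm a u (Y a u) = 0
  X_periodic : ∀ i, ∀ u ∈ N.piece ε f (some i), X (some i) (u + (0, 0, 1)) = X (some i) u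
  Y_periodic : ∀ i, ∀ u ∈ N.piece ε f (some i), Y (some i) (u + (0, 0, 1)) = Y (some i) u
  X_glue : ∀ i, ∀ u ∈ N.piece ε f (some i), u ∉ handle L ε f i →
    fderiv ℝ (N.toOutside ε f i) u (X (some i) u) = X none (N.toOutside ε f i u)
  Y_glue : ∀ i, ∀ u ∈ N.piece ε f (some i), u ∉ handle L ε f i →
    fderiv ℝ (N.toOutside ε f i) u (Y (some i) u) = Y none (N.toOutside ε f i u)
  X_outside : ∀ u ∈ N.piece ε f none, X none u = (1, 0, u.2.1)
  Y_outside : ∀ u ∈ N.piece ε f none, Y none u = (0, 1, 0)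
  X_handle : ∀ i, L.coeff i ≠ 0 → ∀ u ∈ handle L ε f i,
    (L.coeff i : ℝ) * u.2.1 < ε - δ →
    X (some i) u = N.framingMatrix ε f ν i u 0 0 • ((0, 1, 0) : R3)
      + N.framingMatrix ε f ν i u 1 0 • ((-u.2.1, 0, 1) : R3)
  Y_handle : ∀ i, L.coeff i ≠ 0 → ∀ u ∈ handle L ε f i,
    (L.coeff i : ℝ) * u.2.1 < ε - δ →
    Y (some i) u = N.framingMatrix ε f ν i u 0 1 • ((0, 1, 0) : R3)
      + N.framingMatrix ε f ν i u 1 1 • ((-u.2.1, 0, 1) : R3)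

variable {N ε f} in
/-- The tangent vector with coordinates `w` at the point `u` of the piece `a` has coordinate vector
`v` with respect to `(X, Y)`. -/
def Framing.HasCoords (F : N.Framing ε f) (a : Option ι) (u w : R3) (v : ℝ × ℝ) : Prop :=
  w = v.1 • F.X a u + v.2 • F.Y a u

/-! ### Reeb chords of `Λ⁰` after surgery -/

/-- A Reeb chord of `Λ⁰` in the surgered manifold: an integral curve of the Reeb vector field over
`[0, T]`, `T > 0`, that starts and ends on `Λ⁰`. -/
structure ReebChord where
  T : ℝ
  T_pos : 0 < T
  path : ℝ → N.Surgered ε f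
  isIntegral : ∀ t ∈ Icc 0 T, ∃ (a : Option ι) (u : ℝ → R3), ∀ᶠ s in 𝓝[Icc 0 T] t,
    (∃ h : u s ∈ N.piece ε f a, path s = N.pt ε f a (u s) h) ∧
    HasDerivWithinAt u (reebField a (u s)) (Icc 0 T) s
  startIdx : ι
  startPar : ℝ
  endIdx : ι
  endPar : ℝ
  start_coeff : L.coeff startIdx = 0
  end_coeff : L.coeff endIdx = 0
  start_eq : ∃ h, path 0 = N.pt ε f none (L.curve startIdx startPar) h
  end_eq : ∃ h, path T = N.pt ε f none (L.curve endIdx endPar) h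

/-- The points of the handle about `Λ_i` in the surgered manifold. -/
def handleSet (i : ι) : Set (N.Surgered ε f) :=
  {m | ∃ u ∈ handle L ε f i, ∃ h, m = N.pt ε f (some i) u h}

/-- The entry square of a chord `r`, at the bottom of the handle in which `r` ends. -/
def entrySquare (r : L.Chord) : Set (N.Surgered ε f) :=
  {m | ∃ p q : ℝ, |p| ≤ ε ∧ |q - r.tipPar| ≤ ε ∧
    ∃ h, m = N.pt ε f (some r.tipIdx) (-ε, p, q) h}

/-- The exit square of a chord `r`, at the top of the handle from which `r` starts; in outside
coordinates it is `z = ε`, `|p| ≤ ε`, `|q - q_r⁻| ≤ ε`. -/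
def exitSquare (r : L.Chord) : Set (N.Surgered ε f) :=
  {m | ∃ p q : ℝ, |p| ≤ ε ∧
    |q + (L.coeff r.tailIdx : ℝ) * fScaled f ε p - r.tailPar| ≤ ε ∧
    ∃ h, m = N.pt ε f (some r.tailIdx)
      (ε + (L.coeff r.tailIdx : ℝ) * HFun f ε p, p, q) h}

variable {N ε f}

/-- The chord `κ` has word `r_1 ⋯ r_n`: it passes through exactly `n - 1` handles, entering the
`l`-th one through the entry square of `r_l` and leaving it through the exit square of `r_{l+1}`.
A chord that meets no handle has as its word the chord of `∂z` with the same end points. -/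
def ReebChord.HasWord (κ : N.ReebChord ε f) (w : List L.Chord) : Prop :=
  ∃ enter leave : ℕ → ℝ,
    (∀ l (hl : l + 1 < w.length),
      0 < enter l ∧ enter l < leave l ∧ leave l < κ.T ∧
      κ.path (enter l) ∈ N.entrySquare ε f w[l] ∧
      κ.path (leave l) ∈ N.exitSquare ε f w[l + 1]) ∧
    (∀ l, l + 2 < w.length → leave l < enter (l + 1)) ∧
    (∀ t ∈ Icc 0 κ.T, (∃ i, κ.path t ∈ N.handleSet ε f i) ↔
      ∃ l, l + 1 < w.length ∧ t ∈ Icc (enter l) (leave l)) ∧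
    ∀ r : L.Chord, w = [r] →
      L.curve κ.startIdx κ.startPar = r.tail ∧ L.curve κ.endIdx κ.endPar = r.tip

/-- `v` is the coordinate vector with respect to `(X, Y)` of a vector field along `κ` that is
tangent to the contact structure and invariant under the linearised Reeb flow. In the coordinates
of a piece the field `w` along the integral curve `u` solves the variational equation
`w' = DR(u) w`. -/
def ReebChord.IsFlowInvariant (κ : N.ReebChord ε f) (F : N.Framing ε f)
    (v : ℝ → ℝ × ℝ) : Prop :=
  ∀ t ∈ Icc 0 κ.T, ∃ (a : Option ι) (u w : ℝ → R3), ∀ᶠ s in 𝓝[Icc 0 κ.T] t,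
    (∃ h : u s ∈ N.piece ε f a, κ.path s = N.pt ε f a (u s) h) ∧
    HasDerivWithinAt u (reebField a (u s)) (Icc 0 κ.T) s ∧
    HasDerivWithinAt w (fderiv ℝ (reebField a) (u s) (w s)) (Icc 0 κ.T) s ∧
    contactForm a (u s) (w s) = 0 ∧
    F.HasCoords a (u s) (w s) (v s)

/-- The point at which `κ`, traversed in the direction `a`, begins. -/
def ReebChord.source (κ : N.ReebChord ε f) (a : ℤˣ) : R3 :=
  if a = 1 then L.curve κ.startIdx κ.startPar else L.curve κ.endIdx κ.endPar

/-- The point at which `κ`, traversed in the direction `a`, ends. -/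
def ReebChord.target (κ : N.ReebChord ε f) (a : ℤˣ) : R3 :=
  if a = 1 then L.curve κ.endIdx κ.endPar else L.curve κ.startIdx κ.startPar

/-- The tangent vector of `Λ⁰` at the point at which `κ`, traversed in the direction `a`,
begins. -/
def ReebChord.sourceTangent (κ : N.ReebChord ε f) (a : ℤˣ) : R3 :=
  if a = 1 then deriv (L.curve κ.startIdx) κ.startPar else deriv (L.curve κ.endIdx) κ.endPar

/-- The time parameter on `κ`, traversed in the direction `a`, at `t ∈ [0, 1]`. -/
def ReebChord.time (κ : N.ReebChord ε f) (a : ℤˣ) (t : ℝ) : ℝ :=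
  if a = 1 then t * κ.T else (1 - t) * κ.T

/-! ### Broken closed strings and their Maslov index -/

variable (N ε f) in
/-- A broken closed string `(a_1 κ_1) * ζ_1 * ⋯ * (a_n κ_n) * ζ_n` on `Λ⁰` in the surgered
manifold. The path `ζ_k` in `Λ⁰` is given by its component and its parameter on this component,
lifted from `ℝ/ℤ` to `ℝ`. -/
structure BrokenString (n : ℕ) [NeZero n] where
  chord : Fin n → N.ReebChord ε f
  sign : Fin n → ℤˣ
  arcIdx : Fin n → ι
  arcPar : Fin n → ℝ → ℝ
  arc_coeff : ∀ k, L.coeff (arcIdx k) = 0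
  arc_continuous : ∀ k, ContinuousOn (arcPar k) (Icc 0 1)
  arc_start : ∀ k, L.curve (arcIdx k) (arcPar k 0) = (chord k).target (sign k)
  arc_end : ∀ k, L.curve (arcIdx k) (arcPar k 1) = (chord (k + 1)).source (sign (k + 1))

variable {n : ℕ} [NeZero n]

/-- The rotation angle `θ(ζ_k)`. -/
def BrokenString.arcAngle (b : N.BrokenString ε f n) (k : Fin n) : ℝ :=
  angleVariation (fun t => L.tangent (b.arcIdx k) (b.arcPar k t)) 0 1

/-- The non-zero vector `v` spans the line of angle `θ`. -/
def SpansLine (v : ℝ × ℝ) (θ : ℝ) : Prop :=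
  ∃ r : ℝ, r ≠ 0 ∧ v = (r * Real.cos θ, r * Real.sin θ)

/-- `m` is the Maslov index of `b` with respect to `(X, Y)`, that is, the degree of the loop of
unoriented lines `ℝ / 3nℤ → ℝ / πℤ` associated with `b`; here `Θ` is a lift of this loop to `ℝ`.
On `[3k, 3k + 1]` the loop follows the image of `T Λ⁰` under the linearised Reeb flow along
`a_k κ_k` (the negative flow, from the end point, if `a_k = -1`). On `[3k + 1, 3k + 2]` it makes
the smallest clockwise rotation to the line `T Λ⁰` at the end of `a_k κ_k`. On
`[3k + 2, 3k + 3]` it follows `T Λ⁰` along `ζ_k`. -/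
def BrokenString.IsMaslovIndex (b : N.BrokenString ε f n) (F : N.Framing ε f) (m : ℤ) : Prop :=
  ∃ Θ : ℝ → ℝ, ContinuousOn Θ (Icc 0 (3 * n)) ∧
    (∀ k : Fin n,
      (∃ v : ℝ → ℝ × ℝ, (b.chord k).IsFlowInvariant F v ∧
        F.HasCoords none ((b.chord k).source (b.sign k)) ((b.chord k).sourceTangent (b.sign k))
          (v ((b.chord k).time (b.sign k) 0)) ∧
        ∀ t ∈ Icc (0 : ℝ) 1,
          SpansLine (v ((b.chord k).time (b.sign k) t)) (Θ (3 * (k : ℕ) + t))) ∧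
      (∃ β ∈ Ioo 0 Real.pi, ∀ t ∈ Icc (0 : ℝ) 1,
        Θ (3 * (k : ℕ) + 1 + t) = Θ (3 * (k : ℕ) + 1) - t * β) ∧
      ∀ t ∈ Icc (0 : ℝ) 1, ∃ v : ℝ × ℝ,
        F.HasCoords none (L.curve (b.arcIdx k) (b.arcPar k t))
          (deriv (L.curve (b.arcIdx k)) (b.arcPar k t)) v ∧
        SpansLine v (Θ (3 * (k : ℕ) + 2 + t))) ∧
    Θ (3 * n) - Θ 0 = m * Real.pi

end StandardNeighborhood

end LegendrianSurgery

end

open LegendrianSurgery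

/-! ### Linear algebra of the plane -/

namespace LegendrianSurgery

/-! For small ε a Reeb chord of Λ⁰ alternates between vertical segments in ℝ³ and passages through
handles. A vertical segment joins two tubes, and the explicit models at the crossings force its ends
to lie within ε of the tail and the tip of one chord of ∂z (`local_segments`, made uniform by
compactness in `Small.segments`). Collecting these chords gives a word (`exists_run`). Conversely
the times spent in handles and the squares hit on the way determine the word (`word_unique`).

In the framing the linearised flow is constant off the handles. In a handle an invariant vector W is
constant in tube coordinates, so only the frame moves: the vector is B(p, η) followed on the right
by the shear by c f_ε'(ζ), applied to W (`handleFrame`). During the passage η goes, modulo 1, from q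
to q + c f_ε(p), and the shear goes from 0 to c/ε, because adaptedness places p where f_ε' = 1/ε
(`adapted_pass`).

To find the angle by which a line turns, replace B(p, η) by the rotation B(0, η) along the core. The
actual line is never orthogonal to the comparison line and agrees with it at both ends, so both turn
equally (`SpansLine.variation_eq`). The rotation contributes the angle of the capping path, which is
π rot + π/2; the shear contributes arctan(x + c/ε) − arctan x, where x is the slope at entry
(`pass_angle`, `pass_over`).

These contributions telescope. The two strands at a crossing differ by a quarter turn (`act_under`),
so an exit slope S = x + c/ε becomes the entry slope −1/S at the next handle. If |x| ≤ 1, then 1/ε ≥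
2 gives S the sign of c and |S| ≥ 1; hence the next slope is again at most 1 in modulus, and arctan
S + arctan(1/S) = cπ/2. Each passage therefore adds π/2 + cπ/2 + π rot, which is π times its summand
in the index of the word (`Run.forward`; `Run.backward` for the reversed flow). What remains is the
arctangent of one slope at the end. The closing clockwise rotation is π/2 plus that arctangent, so
only −π/2 survives (`ReebChord.variation`).

A lift of the loop of lines consists of one block for each chord together with its arc; the
variation of each block is now known (`IsBlock.variation`). Blocks fit together up to multiples of
π, which gives existence of the degree, and summing their variations gives its value. -/

/-- Action of a `2 × 2` matrix on the plane. -/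
def act (A : Matrix (Fin 2) (Fin 2) ℝ) (v : ℝ × ℝ) : ℝ × ℝ :=
  (A 0 0 * v.1 + A 0 1 * v.2, A 1 0 * v.1 + A 1 1 * v.2)

@[simp] theorem act_one (v : ℝ × ℝ) : act 1 v = v := by
  simp [act]

theorem act_mul (A B : Matrix (Fin 2) (Fin 2) ℝ) (v : ℝ × ℝ) :
    act (A * B) v = act A (act B v) := by
  simp only [act, Matrix.mul_apply, Fin.sum_univ_two, Prod.mk.injEq]
  constructor <;> ring

theorem act_smul (A : Matrix (Fin 2) (Fin 2) ℝ) (r : ℝ) (v : ℝ × ℝ) :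
    act A (r • v) = r • act A v := by
  simp only [act, Prod.smul_fst, Prod.smul_snd, smul_eq_mul, Prod.smul_mk, Prod.mk.injEq]
  constructor <;> ring

theorem act_inv_act {A : Matrix (Fin 2) (Fin 2) ℝ} (h : A.det = 1) (v : ℝ × ℝ) :
    act A⁻¹ (act A v) = v := by
  rw [← act_mul, Matrix.nonsing_inv_mul _ (by simp [h]), act_one]

theorem act_act_inv {A : Matrix (Fin 2) (Fin 2) ℝ} (h : A.det = 1) (v : ℝ × ℝ) :
    act A (act A⁻¹ v) = v := by
  rw [← act_mul, Matrix.mul_nonsing_inv _ (by simp [h]), act_one]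

theorem isOpen_openTube (ε : ℝ) : IsOpen (openTube ε) := by
  have h1 : IsOpen {u : R3 | |u.1| < ε} := isOpen_lt (by fun_prop) continuous_const
  have h2 : IsOpen {u : R3 | |u.2.1| < ε} := isOpen_lt (by fun_prop) continuous_const
  exact h1.inter h2

theorem mem_openTube {ε z p q : ℝ} : (z, p, q) ∈ openTube ε ↔ |z| < ε ∧ |p| < ε := Iff.rfl

/-! ### The differential of a standard neighbourhood -/

namespace StandardNeighborhood

variable {ι : Type*} {L : SurgeryLink ι} {ε₀ : ℝ} (N : StandardNeighborhood L ε₀)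

theorem contDiffAt {i : ι} {u : R3} (hu : u ∈ openTube ε₀) : ContDiffAt ℝ ∞ (N.toFun i) u :=
  (N.smooth i).contDiffAt ((isOpen_openTube ε₀).mem_nhds hu)

theorem differentiableAt {i : ι} {u : R3} (hu : u ∈ openTube ε₀) :
    DifferentiableAt ℝ (N.toFun i) u :=
  (N.contDiffAt hu).differentiableAt (by simp)

/-- A tube is area preserving as a map from the `pq`-plane to the `xy`-plane. -/
theorem area {i : ι} {u : R3} (hu : u ∈ openTube ε₀) (w v : R3) :
    (fderiv ℝ (N.toFun i) u w).1 * (fderiv ℝ (N.toFun i) u v).2.1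
      - (fderiv ℝ (N.toFun i) u v).1 * (fderiv ℝ (N.toFun i) u w).2.1
      = w.2.1 * v.2.2 - v.2.1 * w.2.2 := by
  have hD : DifferentiableAt ℝ (fderiv ℝ (N.toFun i)) u :=
    ((N.contDiffAt hu).fderiv_right (m := ∞) (by simp)).differentiableAt (by simp)
  have hsymm : IsSymmSndFDerivAt ℝ (N.toFun i) u :=
    (N.contDiffAt hu).isSymmSndFDerivAt (by simp only [minSmoothness_of_isRCLikeNormedField]; exact WithTop.coe_le_coe.2 le_top)
  have hF := (N.differentiableAt (i := i) hu).hasFDerivAt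
  -- The contact identity for a fixed v, differentiated in the direction w. Antisymmetrising in v
  -- and w cancels the second derivatives and leaves the pullback of dx ∧ dy on one side and dp ∧ dq
  -- on the other.
  have key : ∀ v w : R3,
      (fderiv ℝ (fderiv ℝ (N.toFun i)) u w v).2.2
        - ((N.toFun i u).2.1 * (fderiv ℝ (fderiv ℝ (N.toFun i)) u w v).1
        + (fderiv ℝ (N.toFun i) u w).2.1 * (fderiv ℝ (N.toFun i) u v).1)
        = w.2.1 * v.2.2 := by
    intro v w
    have h0 : HasFDerivAt (fun x => fderiv ℝ (N.toFun i) x v)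
        ((fderiv ℝ (fderiv ℝ (N.toFun i)) u).flip v) u := by
      have := hD.hasFDerivAt.clm_apply (hasFDerivAt_const v u)
      simpa using this
    have h1 := ((h0.snd.snd).sub ((hF.snd.fst).mul h0.fst)).congr_of_eventuallyEq
      (f₁ := fun x => alphaStd (N.toFun i x) (fderiv ℝ (N.toFun i) x v))
      (Eventually.of_forall fun x => by simp [alphaStd])
    have h3 : HasFDerivAt (fun x : R3 => alphaTube x v)
        (v.2.2 • (ContinuousLinearMap.fst ℝ ℝ ℝ ∘L ContinuousLinearMap.snd ℝ ℝ (ℝ × ℝ))) u := by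
      have h4 : HasFDerivAt (fun x : R3 => x.2.1)
        (ContinuousLinearMap.fst ℝ ℝ ℝ ∘L ContinuousLinearMap.snd ℝ ℝ (ℝ × ℝ)) u :=
        (ContinuousLinearMap.fst ℝ ℝ ℝ ∘L ContinuousLinearMap.snd ℝ ℝ (ℝ × ℝ)).hasFDerivAt
      have := (h4.mul_const v.2.2).const_add v.1
      refine this.congr_of_eventuallyEq (Eventually.of_forall fun x => ?_)
      simp [alphaTube]
    have h5 := h1.congr_of_eventuallyEq (f₁ := fun x : R3 => alphaTube x v)
      (by
        filter_upwards [(isOpen_openTube ε₀).mem_nhds hu] with x hx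
        exact (N.contact i x hx v).symm)
    have h6 := congrArg (fun A : R3 →L[ℝ] ℝ => A w) (h5.unique h3)
    simp at h6
    linarith
  have e1 := key v w
  have e2 := key w v
  have e3 := hsymm v w
  rw [e3] at e2
  linarith

/-- By `area` the image of ∂z is annihilated by dx ∧ dy, and the images of ∂p and ∂q project to a
basis of the plane; so that image is vertical (Cramer's rule), and the contact identity fixes its
length. Tubes therefore respect the Reeb fields. -/
theorem fderiv_z {i : ι} {u : R3} (hu : u ∈ openTube ε₀) :
    fderiv ℝ (N.toFun i) u (1, 0, 0) = (0, 0, 1) := by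
  have h1 := N.area (i := i) hu (1, 0, 0) (0, 1, 0)
  have h2 := N.area (i := i) hu (1, 0, 0) (0, 0, 1)
  have h3 := N.area (i := i) hu (0, 1, 0) (0, 0, 1)
  have h4 := N.contact i u hu (1, 0, 0)
  generalize fderiv ℝ (N.toFun i) u (1, 0, 0) = a at *
  generalize fderiv ℝ (N.toFun i) u (0, 1, 0) = b at *
  generalize fderiv ℝ (N.toFun i) u (0, 0, 1) = c at *
  obtain ⟨a1, a2, a3⟩ := a
  obtain ⟨b1, b2, b3⟩ := b
  obtain ⟨c1, c2, c3⟩ := c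
  simp [alphaStd, alphaTube] at h1 h2 h3 h4
  have e1 : a1 = 0 := by linear_combination (-c1) * h1 + b1 * h2 - a1 * h3
  have e2 : a2 = 0 := by linear_combination (-c2) * h1 + b2 * h2 - a2 * h3
  subst e1 e2
  simp at h4
  simp [h4]

/-- The integrated form of `fderiv_z`. It reduces every question about a tube to its slice z = 0,
that is, to `plane` and `height`. -/
theorem toFun_eq {i : ι} {z p : ℝ} (q : ℝ) (hz : |z| < ε₀) (hp : |p| < ε₀) :
    N.toFun i (z, p, q) = N.toFun i (0, p, q) + (0, 0, z) := by
  have h0 : 0 < ε₀ := (abs_nonneg _).trans_lt hz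
  have hd : ∀ x ∈ Ioo (-ε₀) ε₀, HasDerivAt (fun x : ℝ => N.toFun i (x, p, q) - (0, 0, x))
      (0 : R3) x := by
    intro x hx
    have h1 : HasDerivAt (fun x : ℝ => ((x, p, q) : R3)) (1, 0, 0) x :=
      (hasDerivAt_id x).prodMk (hasDerivAt_const x (p, q))
    have h2 : HasDerivAt (fun x : ℝ => ((0, 0, x) : R3)) (0, 0, 1) x :=
      (hasDerivAt_const x _).prodMk ((hasDerivAt_const x _).prodMk (hasDerivAt_id x))
    have hm : ((x, p, q) : R3) ∈ openTube ε₀ := mem_openTube.2 ⟨abs_lt.2 hx, hp⟩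
    have h3 := ((N.differentiableAt (i := i) hm).hasFDerivAt.comp_hasDerivAt x h1).sub h2
    rw [N.fderiv_z hm, sub_self] at h3
    exact h3
  have := isOpen_Ioo.is_const_of_deriv_eq_zero isPreconnected_Ioo
    (fun x hx => (hd x hx).differentiableAt.differentiableWithinAt)
    (fun x hx => (hd x hx).deriv) (abs_lt.1 hz) (y := 0) (by simpa using h0)
  have h : N.toFun i (z, p, q) - (0, 0, z) = N.toFun i (0, p, q)   := by
    have e : ((0, 0, 0) : R3) = 0 := rfl
    rw [e, sub_zero] at this
    exact this
  rw [← h, sub_add_cancel]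

theorem toFun_add_int {i : ι} {u : R3} (hu : u ∈ openTube ε₀) (k : ℤ) :
    N.toFun i (u + (0, 0, (k : ℝ))) = N.toFun i u := by
  have hm : ∀ x : ℝ, u + (0, 0, x) ∈ openTube ε₀ := fun x => by
    simpa [openTube] using hu
  induction k with
  | zero =>
    have : ((0, 0, ((0 : ℤ) : ℝ)) : R3) = 0 := by simp
    rw [this, add_zero]
  | succ k ih =>
    rw [← ih, ← N.periodic i _ (hm ((k : ℤ) : ℝ))]
    simp [add_assoc]
  | pred k ih =>
    rw [← ih, ← N.periodic i _ (hm _)]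
    simp [add_assoc]

theorem toFun_add_int' {i : ι} {z p q : ℝ} (hz : |z| < ε₀) (hp : |p| < ε₀) (k : ℤ) :
    N.toFun i (z, p, q + k) = N.toFun i (z, p, q) := by
  have := N.toFun_add_int (i := i) (u := (z, p, q)) ⟨hz, hp⟩ k
  simpa using this

/-- The projection of a tube to the `xy`-plane, as a function of `(p, q)`. -/
def plane (i : ι) (v : ℝ × ℝ) : ℝ × ℝ := xy (N.toFun i (0, v))

/-- The `z`-coordinate of a tube along `z = 0`. -/
def height (i : ι) (v : ℝ × ℝ) : ℝ := (N.toFun i (0, v)).2.2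

/-- A translation symmetry passes to the differential. It is needed for translations in z and for
the period in q. -/
theorem fderiv_comp_eq {i : ι} {u : R3} (s : R3) (hu : u ∈ openTube ε₀)
    (hs : u + s ∈ openTube ε₀) (c : R3)
    (h : ∀ᶠ u' in 𝓝 u, N.toFun i (u' + s) = N.toFun i u' + c) :
    fderiv ℝ (N.toFun i) (u + s) = fderiv ℝ (N.toFun i) u := by
  have h1 : HasFDerivAt (fun u' => N.toFun i (u' + s)) (fderiv ℝ (N.toFun i) (u + s)) u := by
    have := HasFDerivAt.comp u (N.differentiableAt (i := i) hs).hasFDerivAt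
      ((hasFDerivAt_id u).add_const s)
    rw [ContinuousLinearMap.comp_id] at this
    exact this
  have h2 : HasFDerivAt (fun u' => N.toFun i u' + c) (fderiv ℝ (N.toFun i) u) u :=
    (N.differentiableAt (i := i) hu).hasFDerivAt.add_const c
  exact h1.unique (h2.congr_of_eventuallyEq h)

theorem fderiv_z_eq {i : ι} {z p : ℝ} (q : ℝ) (hz : |z| < ε₀) (hp : |p| < ε₀) :
    fderiv ℝ (N.toFun i) (z, p, q) = fderiv ℝ (N.toFun i) (0, p, q) := by
  have h0 : 0 < ε₀ := (abs_nonneg _).trans_lt hz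
  have hu : ((0, p, q) : R3) ∈ openTube ε₀ := ⟨by simpa using h0, hp⟩
  have := N.fderiv_comp_eq (i := i) (u := (0, p, q)) (z, 0, 0) hu
    (by simpa [openTube] using ⟨hz, hp⟩) (0, 0, z) ?_
  · simpa using this
  · have hc : ∀ᶠ u' : R3 in 𝓝 (0, p, q), |u'.1 + z| < ε₀ :=
      (isOpen_lt (by fun_prop) continuous_const).mem_nhds (by simpa using hz)
    filter_upwards [(isOpen_openTube ε₀).mem_nhds hu, hc] with u' hu' hc'
    obtain ⟨z', p', q'⟩ := u'
    have e1 := N.toFun_eq (i := i) q' hc' hu'.2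
    have e2 := N.toFun_eq (i := i) q' hu'.1 hu'.2
    simp only [Prod.mk_add_mk, add_zero] at e1 e2 ⊢
    rw [e1, e2, add_assoc]
    simp

theorem fderiv_add_int {i : ι} {z p q : ℝ} (hz : |z| < ε₀) (hp : |p| < ε₀) (k : ℤ) :
    fderiv ℝ (N.toFun i) (z, p, q + k) = fderiv ℝ (N.toFun i) (z, p, q) := by
  have hu : ((z, p, q) : R3) ∈ openTube ε₀ := ⟨hz, hp⟩
  have := N.fderiv_comp_eq (i := i) (u := (z, p, q)) (0, 0, k) hu
    (by simpa [openTube] using ⟨hz, hp⟩) 0 ?_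
  · simpa using this
  · filter_upwards [(isOpen_openTube ε₀).mem_nhds hu] with u' hu'
    simpa using N.toFun_add_int (i := i) hu' k

theorem basisChange_add_int {i : ι} {p q : ℝ} (hp : |p| < ε₀) (k : ℤ) :
    N.basisChange i p (q + k) = N.basisChange i p q := by
  have h0 : 0 < ε₀ := (abs_nonneg _).trans_lt hp
  simp only [basisChange]
  rw [N.fderiv_add_int (by simpa using h0) hp]

theorem decomp (w : R3) : w = w.1 • ((1, 0, 0) : R3) + w.2.1 • ((0, 1, 0) : R3)
    + w.2.2 • ((0, 0, 1) : R3) := by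
  simp

/-- The `xy`-projection of the differential of a tube is given by `basisChange`. -/
theorem xy_fderiv {i : ι} {z p : ℝ} (q : ℝ) (hz : |z| < ε₀) (hp : |p| < ε₀) (w : R3) :
    xy (fderiv ℝ (N.toFun i) (z, p, q) w) = act (N.basisChange i p q) w.2 := by
  have h0 : 0 < ε₀ := (abs_nonneg _).trans_lt hz
  have hu : ((0, p, q) : R3) ∈ openTube ε₀ := ⟨by simpa using h0, hp⟩
  have hB := N.fderiv_z (i := i) hu
  rw [N.fderiv_z_eq q hz hp]
  have hw : ∀ w : R3, fderiv ℝ (N.toFun i) (0, p, q) w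
      = w.1 • ((0, 0, 1) : R3) + w.2.1 • fderiv ℝ (N.toFun i) (0, p, q) (0, 1, 0)
        + w.2.2 • fderiv ℝ (N.toFun i) (0, p, q) (0, 0, 1) := by
    intro w
    conv_lhs => rw [decomp w, map_add, map_add, map_smul, map_smul, map_smul, hB]
  simp only [act, basisChange]
  rw [hw w, hw (-p, 0, 1)]
  simp [xy]
  constructor <;> ring

theorem det_basisChange {i : ι} {p : ℝ} (q : ℝ) (hp : |p| < ε₀) :
    (N.basisChange i p q).det = 1 := by
  have h0 : 0 < ε₀ := (abs_nonneg _).trans_lt hp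
  have hu : ((0, p, q) : R3) ∈ openTube ε₀ := ⟨by simpa using h0, hp⟩
  have := N.area (i := i) hu (0, 1, 0) (-p, 0, 1)
  simp only [basisChange, Matrix.det_fin_two_of]
  simpa using this

theorem hasFDerivAt_plane {i : ι} {p : ℝ} (q : ℝ) (hp : |p| < ε₀) :
    ∃ D : ℝ × ℝ →L[ℝ] ℝ × ℝ, HasStrictFDerivAt (N.plane i) D (p, q) ∧
      ∀ w, D w = act (N.basisChange i p q) w := by
  have h0 : 0 < ε₀ := (abs_nonneg _).trans_lt hp
  have hu : ((0, p, q) : R3) ∈ openTube ε₀ := ⟨by simpa using h0, hp⟩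
  have h1 := (N.contDiffAt (i := i) hu).hasStrictFDerivAt (by simp)
  have h2 : HasStrictFDerivAt (fun v : ℝ × ℝ => ((0, v) : R3))
      (ContinuousLinearMap.inr ℝ ℝ (ℝ × ℝ)) (p, q) :=
    (ContinuousLinearMap.inr ℝ ℝ (ℝ × ℝ)).hasStrictFDerivAt
  have h3 := HasStrictFDerivAt.comp (p, q) (g := N.toFun i) (by exact h1) h2
  refine ⟨_, (h3.fst).prodMk (h3.snd.fst), fun w => ?_⟩
  rw [← N.xy_fderiv (z := 0) q (by simpa using h0) hp (0, w)]
  simp [xy]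

theorem continuousAt_plane {i : ι} {v : ℝ × ℝ} (hp : |v.1| < ε₀) :
    ContinuousAt (N.plane i) v := by
  obtain ⟨D, hD, -⟩ := N.hasFDerivAt_plane (i := i) v.2 hp
  exact hD.hasFDerivAt.continuousAt

theorem continuousAt_height {i : ι} {v : ℝ × ℝ} (hp : |v.1| < ε₀) :
    ContinuousAt (N.height i) v := by
  have h0 : 0 < ε₀ := (abs_nonneg _).trans_lt hp
  have hu : ((0, v) : R3) ∈ openTube ε₀ := ⟨by simpa using h0, hp⟩
  have h1 := (N.contDiffAt (i := i) hu).continuousAt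
  have h2 : ContinuousAt (fun v : ℝ × ℝ => N.toFun i (0, v)) v :=
    ContinuousAt.comp (g := N.toFun i) h1 (by fun_prop)
  exact h2.snd.snd

theorem continuousAt_basisChange {i : ι} {v : ℝ × ℝ} (hp : |v.1| < ε₀) (a b : Fin 2) :
    ContinuousAt (fun v : ℝ × ℝ => N.basisChange i v.1 v.2 a b) v := by
  have h0 : 0 < ε₀ := (abs_nonneg _).trans_lt hp
  have hu : ((0, v) : R3) ∈ openTube ε₀ := ⟨by simpa using h0, hp⟩
  have h1 : ContinuousAt (fderiv ℝ (N.toFun i)) (0, v) :=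
    ((N.contDiffAt hu).fderiv_right (m := ∞) (by simp)).continuousAt
  have h2 : ContinuousAt (fun v : ℝ × ℝ => fderiv ℝ (N.toFun i) (0, v)) v :=
    ContinuousAt.comp (g := fderiv ℝ (N.toFun i)) h1 (by fun_prop)
  have h3 : ContinuousAt (fun v : ℝ × ℝ => fderiv ℝ (N.toFun i) (0, v) (0, 1, 0)) v :=
    h2.clm_apply continuousAt_const
  have h4 : ContinuousAt (fun v : ℝ × ℝ => fderiv ℝ (N.toFun i) (0, v) (-v.1, 0, 1)) v :=
    h2.clm_apply (by fun_prop)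
  fin_cases a <;> fin_cases b
  · exact h3.fst
  · exact h4.fst
  · exact h3.snd.fst
  · exact h4.snd.fst

theorem plane_add_int {i : ι} {p q : ℝ} (hp : |p| < ε₀) (k : ℤ) :
    N.plane i (p, q + k) = N.plane i (p, q) := by
  have h0 : 0 < ε₀ := (abs_nonneg _).trans_lt hp
  simp only [plane]
  rw [N.toFun_add_int' (by simpa using h0) hp]

theorem height_add_int {i : ι} {p q : ℝ} (hp : |p| < ε₀) (k : ℤ) :
    N.height i (p, q + k) = N.height i (p, q) := by
  have h0 : 0 < ε₀ := (abs_nonneg _).trans_lt hp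
  simp only [height]
  rw [N.toFun_add_int' (by simpa using h0) hp]

theorem toFun_eq_plane {i : ι} {z p : ℝ} (q : ℝ) (hz : |z| < ε₀) (hp : |p| < ε₀) :
    N.toFun i (z, p, q) = ((N.plane i (p, q)).1, (N.plane i (p, q)).2, N.height i (p, q) + z) := by
  rw [N.toFun_eq q hz hp]
  simp [plane, height, xy]
  ext <;> simp

theorem curve_eq_plane (i : ι) (q : ℝ) :
    L.curve i q = ((N.plane i (0, q)).1, (N.plane i (0, q)).2, N.height i (0, q)) := by
  rw [← N.core]
  rfl

theorem tangent_eq (h0 : 0 < ε₀) (i : ι) (q : ℝ) :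
    L.tangent i q = act (N.basisChange i 0 q) (0, 1) := by
  have h1 : HasDerivAt (fun q : ℝ => ((0, 0, q) : R3)) (0, 0, 1) q :=
    (hasDerivAt_const q _).prodMk ((hasDerivAt_const q _).prodMk (hasDerivAt_id q))
  have hm : ((0, 0, q) : R3) ∈ openTube ε₀ := mem_openTube.2 ⟨by simpa, by simpa⟩
  have h3 := (N.differentiableAt (i := i) hm).hasFDerivAt.comp_hasDerivAt q h1
  have h4 : (N.toFun i ∘ fun q : ℝ => ((0, 0, q) : R3)) = L.curve i := by
    ext1 q
    exact N.core i q
  rw [h4] at h3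
  rw [SurgeryLink.tangent, h3.deriv, N.xy_fderiv q (by simpa) (by simpa)]

/-- Along the core, the change of basis is a rotation determined by the tangent vector. -/
theorem basisChange_core (h0 : 0 < ε₀) (i : ι) (q : ℝ) :
    N.basisChange i 0 q = !![(L.tangent i q).2, (L.tangent i q).1;
      -(L.tangent i q).1, (L.tangent i q).2] := by
  have hm : ((0, 0, q) : R3) ∈ openTube ε₀ := mem_openTube.2 ⟨by simpa, by simpa⟩
  -- Compatibility with the complex structure makes the second column the quarter turn of the first;
  -- since the second column is the tangent vector, both are known.
  have h1 := N.complex i _ hm rfl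
  have h2 := N.tangent_eq h0 i q
  have h3 := N.xy_fderiv (i := i) (z := 0) (p := 0) q (by simpa) (by simpa) (0, 0, 1)
  have h4 := N.xy_fderiv (i := i) (z := 0) (p := 0) q (by simpa) (by simpa) (0, 1, 0)
  simp only at h3 h4
  rw [← h2] at h3
  rw [h3] at h1
  rw [h1] at h2
  simp only [act, mul_zero, mul_one, zero_add, add_zero, xy, Prod.mk.injEq] at h2 h4
  rw [h1]
  simp only [neg_neg]
  rw [h4.1, h4.2]
  rw [h4.1, h4.2] at h2
  ext a b
  fin_cases a <;> fin_cases b <;> simp [h2]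

end StandardNeighborhood

/-! ### Models at the crossings and vertical segments between tubes -/

/-- The change of basis in the model tube around an over-crossing strand. -/
noncomputable def overMatrix : Matrix (Fin 2) (Fin 2) ℝ :=
  !![-(1 / √2), 1 / √2; -(1 / √2), -(1 / √2)]

/-- The change of basis in the model tube around an under-crossing strand. -/
noncomputable def underMatrix : Matrix (Fin 2) (Fin 2) ℝ :=
  !![1 / √2, 1 / √2; -(1 / √2), 1 / √2]

theorem act_smul_left (r : ℝ) (A : Matrix (Fin 2) (Fin 2) ℝ) (v : ℝ × ℝ) :
    act (r • A) v = r • act A v := by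
  simp only [act, Matrix.smul_apply, smul_eq_mul, Prod.smul_mk, Prod.mk.injEq]
  constructor <;> ring

theorem act_injective {A B : Matrix (Fin 2) (Fin 2) ℝ} (h : ∀ v, act A v = act B v) :
    A = B := by
  have h1 := h (1, 0)
  have h2 := h (0, 1)
  simp [act] at h1 h2
  ext a b
  fin_cases a <;> fin_cases b <;> simp [h1, h2]

/-- A property that holds near the origin of the plane holds on all small squares. -/
theorem eventually_square {Q : ℝ × ℝ → Prop} (h : ∀ᶠ x in 𝓝 (0 : ℝ × ℝ), Q x) :
    ∀ᶠ ε in 𝓝[>] (0 : ℝ), ∀ a b, |a| ≤ ε → |b| ≤ ε → Q (a, b) := by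
  obtain ⟨δ, hδ, h⟩ := Metric.eventually_nhds_iff.1 h
  filter_upwards [Ioo_mem_nhdsGT hδ] with ε hε a b ha hb
  apply h
  rw [dist_zero_right, Prod.norm_def]
  exact (max_le ha hb).trans_lt hε.2

/-- The nearest integer controls all of them at once. The factor 2 allows for two points, each
within ε of an end of a chord. -/
theorem exists_pos_of_ne_int {a : ℝ} (h : ∀ k : ℤ, a ≠ k) :
    ∀ᶠ ε in 𝓝[>] (0 : ℝ), ∀ k : ℤ, 2 * ε < |a - k| := by
  have h0 : 0 < |a - round a| := abs_pos.2 (sub_ne_zero.2 (h _))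
  filter_upwards [Ioo_mem_nhdsGT (half_pos h0)] with ε hε k
  have := round_le a k
  have := hε.2
  linarith

theorem eq_of_sub_eq_int {a b : ℝ} (ha : a ∈ Ico (0 : ℝ) 1) (hb : b ∈ Ico (0 : ℝ) 1) {k : ℤ}
    (h : a - b = k) : a = b := by
  have h1 : (k : ℝ) < 1 := by linarith [ha.2, hb.1]
  have h2 : (-1 : ℝ) < k := by linarith [ha.1, hb.2]
  have h3 : k < 1 := by exact_mod_cast h1
  have h4 : -1 < k := by exact_mod_cast h2
  obtain rfl : k = 0 := by omega
  simpa [sub_eq_zero] using h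

namespace SurgeryLink

variable {ι : Type*} {L : SurgeryLink ι}

theorem curve_add_int (i : ι) (s : ℝ) (k : ℤ) : L.curve i (s + k) = L.curve i s := by
  have : Function.Periodic (L.curve i) 1 := L.periodic i
  simpa using this.int_mul k s

theorem tangent_add_int (i : ι) (s : ℝ) (k : ℤ) : L.tangent i (s + k) = L.tangent i s := by
  have : (fun s => L.curve i (s + k)) = L.curve i := funext fun s => curve_add_int i s k
  simp only [tangent]
  rw [← deriv_comp_add_const, this]

theorem continuous_tangent (i : ι) : Continuous (L.tangent i) := by
  have : Continuous (deriv (L.curve i)) := (L.smooth i).continuous_deriv (by simp)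
  exact this.fst.prodMk this.snd.fst

theorem Chord.tail_mem_segment (r : L.Chord) : r.tail ∈ r.segment :=
  ⟨rfl, le_rfl, r.upward.le⟩

theorem Chord.tip_mem_segment (r : L.Chord) : r.tip ∈ r.segment :=
  ⟨r.vertical.symm, r.upward.le, le_rfl⟩

theorem Chord.eq_of_tail (hgen : L.ChordGeneric) {r r' : L.Chord} (h : r.tail = r'.tail) :
    r = r' :=
  hgen.2 r r' ⟨r.tail, r.tail_mem_segment, h ▸ r'.tail_mem_segment⟩

theorem Chord.eq_of_tip (hgen : L.ChordGeneric) {r r' : L.Chord} (h : r.tip = r'.tip) :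
    r = r' :=
  hgen.2 r r' ⟨r.tip, r.tip_mem_segment, h ▸ r'.tip_mem_segment⟩

/-- Two such chords would meet, hence coincide, and a single chord would have ends of equal height.
-/
theorem Chord.tip_ne_tail (hgen : L.ChordGeneric) (r r' : L.Chord) : r.tip ≠ r'.tail := by
  intro h
  obtain rfl := hgen.2 r r' ⟨r.tip, r.tip_mem_segment, h ▸ r'.tail_mem_segment⟩
  have := r.upward
  exact this.ne (congrArg (fun u : R3 => u.2.2) h.symm)

end SurgeryLink

namespace StandardNeighborhood

variable {ι : Type*} {L : SurgeryLink ι} {ε₀ : ℝ} (N : StandardNeighborhood L ε₀)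

theorem basisChange_eq_of_plane {i : ι} {p q : ℝ} (hp : |p| < ε₀)
    (A : Matrix (Fin 2) (Fin 2) ℝ) (g : ℝ × ℝ → ℝ × ℝ)
    (hg : ∀ v, g v = g 0 + act A v) (q₀ : ℝ)
    (h : ∀ᶠ v in 𝓝 (p, q), N.plane i v = g (v.1, v.2 - q₀)) : N.basisChange i p q = A := by
  obtain ⟨D, hD, hDB⟩ := N.hasFDerivAt_plane (i := i) q hp
  let T : ℝ × ℝ →L[ℝ] ℝ × ℝ :=
    ((A 0 0 • ContinuousLinearMap.fst ℝ ℝ ℝ + A 0 1 • ContinuousLinearMap.snd ℝ ℝ ℝ).prod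
      (A 1 0 • ContinuousLinearMap.fst ℝ ℝ ℝ + A 1 1 • ContinuousLinearMap.snd ℝ ℝ ℝ))
  have hT : ∀ v, T v = act A v := fun v => by simp [T, act]
  have h1 : HasFDerivAt (fun v : ℝ × ℝ => g 0 + T (v - (0, q₀))) T (p, q) := by
    have := (T.hasFDerivAt.comp (p, q) ((hasFDerivAt_id (p, q)).sub_const (0, q₀))).const_add (g 0)
    rw [ContinuousLinearMap.comp_id] at this
    exact this
  have h2 := h1.congr_of_eventuallyEq (f₁ := N.plane i) (by
    filter_upwards [h] with v hv
    have e : v - (0, q₀) = (v.1, v.2 - q₀) := by simp [Prod.ext_iff]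
    rw [hv, hg, hT, e])
  apply act_injective
  intro v
  rw [← hDB, ← hT, hD.hasFDerivAt.unique h2]

/-- The models enter the argument only here and in `plane_near_tail`, through their affine
projections to the plane. -/
theorem plane_near_tip (r : L.Chord) : ∃ σ : ℝ, (σ = 1 ∨ σ = -1) ∧
    ∀ᶠ v in 𝓝 (0, r.tipPar), N.plane r.tipIdx v
      = xy r.tip + act (σ • overMatrix) (v.1, v.2 - r.tipPar) := by
  obtain ⟨σ, hσ, h⟩ := N.model_tip r
  refine ⟨σ, hσ, ?_⟩
  have hc : Tendsto (fun v : ℝ × ℝ => ((0, v) : R3)) (𝓝 (0, r.tipPar)) (𝓝 (0, 0, r.tipPar)) :=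
    Continuous.tendsto (by fun_prop) _
  filter_upwards [hc.eventually h] with v hv
  simp only [plane]
  rw [hv]
  simp [xy, modelOver, act, overMatrix]
  constructor <;> ring

theorem plane_near_tail (r : L.Chord) : ∃ σ : ℝ, (σ = 1 ∨ σ = -1) ∧
    ∀ᶠ v in 𝓝 (0, r.tailPar), N.plane r.tailIdx v
      = xy r.tail + act (σ • underMatrix) (v.1, v.2 - r.tailPar) := by
  obtain ⟨σ, hσ, h⟩ := N.model_tail r
  refine ⟨σ, hσ, ?_⟩
  have hc : Tendsto (fun v : ℝ × ℝ => ((0, v) : R3)) (𝓝 (0, r.tailPar)) (𝓝 (0, 0, r.tailPar)) :=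
    Continuous.tendsto (by fun_prop) _
  filter_upwards [hc.eventually h] with v hv
  simp only [plane]
  rw [hv]
  simp [xy, modelUnder, act, underMatrix]
  constructor <;> ring

theorem basisChange_near {i : ι} (h0 : 0 < ε₀) (A : Matrix (Fin 2) (Fin 2) ℝ) (c : ℝ × ℝ)
    (q₀ : ℝ) (h : ∀ᶠ v in 𝓝 (0, q₀), N.plane i v = c + act A (v.1, v.2 - q₀)) :
    ∀ᶠ ε in 𝓝[>] (0 : ℝ), ∀ p q, |p| ≤ ε → |q - q₀| ≤ ε → N.basisChange i p q = A := by
  have h1 : ∀ᶠ v : ℝ × ℝ in 𝓝 (0, q₀), |v.1| < ε₀ :=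
    (isOpen_lt (by fun_prop) continuous_const).mem_nhds (by simpa using h0)
  have h2 : ∀ᶠ v : ℝ × ℝ in 𝓝 (0, q₀), N.basisChange i v.1 v.2 = A := by
    filter_upwards [h1, eventually_eventually_nhds.2 h] with v hv1 hv2
    exact N.basisChange_eq_of_plane hv1 A (fun w => c + act A w)
      (fun w => by simp [act]) q₀ hv2
  have h3 : ∀ᶠ v : ℝ × ℝ in 𝓝 0, N.basisChange i v.1 (v.2 + q₀) = A := by
    have hc : Tendsto (fun v : ℝ × ℝ => (v.1, v.2 + q₀)) (𝓝 0) (𝓝 (0, q₀)) :=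
      Continuous.tendsto' (by fun_prop) _ _ (by simp)
    exact hc.eventually h2
  filter_upwards [eventually_square h3] with ε hε p q hp hq
  simpa using hε p (q - q₀) hp hq

/-- Pairs of points of the tubes on a common vertical line, near a pair of points of the link. -/
theorem local_segments (h0 : 0 < ε₀) (i j : ι) (y : ℝ × ℝ) :
    (∀ᶠ xy' in 𝓝 ((0 : ℝ × ℝ), y), N.plane i (xy'.1.1, xy'.2.1) = N.plane j (xy'.1.2, xy'.2.2) →
        ¬ N.height i (xy'.1.1, xy'.2.1) < N.height j (xy'.1.2, xy'.2.2)) ∨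
    ∃ r : L.Chord, r.tailIdx = i ∧ r.tipIdx = j ∧ ∃ k' k : ℤ,
      ∀ᶠ xy' in 𝓝 ((0 : ℝ × ℝ), y),
        N.plane i (xy'.1.1, xy'.2.1) = N.plane j (xy'.1.2, xy'.2.2) →
        |xy'.2.1 - k' - r.tailPar| = |xy'.1.2| ∧ |xy'.2.2 - k - r.tipPar| = |xy'.1.1| := by
  have c1 : ContinuousAt (fun x : (ℝ × ℝ) × (ℝ × ℝ) => N.plane i (x.1.1, x.2.1)) (0, y) :=
    ContinuousAt.comp (g := N.plane i) (N.continuousAt_plane (by simpa using h0)) (by fun_prop)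
  have c2 : ContinuousAt (fun x : (ℝ × ℝ) × (ℝ × ℝ) => N.plane j (x.1.2, x.2.2)) (0, y) :=
    ContinuousAt.comp (g := N.plane j) (N.continuousAt_plane (by simpa using h0)) (by fun_prop)
  have c3 : ContinuousAt (fun x : (ℝ × ℝ) × (ℝ × ℝ) => N.height i (x.1.1, x.2.1)) (0, y) :=
    ContinuousAt.comp (g := N.height i) (N.continuousAt_height (by simpa using h0)) (by fun_prop)
  have c4 : ContinuousAt (fun x : (ℝ × ℝ) × (ℝ × ℝ) => N.height j (x.1.2, x.2.2)) (0, y) :=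
    ContinuousAt.comp (g := N.height j) (N.continuousAt_height (by simpa using h0)) (by fun_prop)
  by_cases hxy : N.plane i (0, y.1) = N.plane j (0, y.2)
  swap
  · left
    filter_upwards [(c1.ne_iff_eventually_ne c2).1 hxy] with x hx hx'
    exact absurd hx' hx
  rcases lt_trichotomy (N.height i (0, y.1)) (N.height j (0, y.2)) with hlt | heq | hgt
  · right
    have e1 : L.curve i (Int.fract y.1) = L.curve i y.1 := by
      rw [← SurgeryLink.curve_add_int i _ ⌊y.1⌋, Int.fract_add_floor]
    have e2 : L.curve j (Int.fract y.2) = L.curve j y.2 := by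
      rw [← SurgeryLink.curve_add_int j _ ⌊y.2⌋, Int.fract_add_floor]
    let r : L.Chord :=
      { tailIdx := i, tipIdx := j, tailPar := Int.fract y.1, tipPar := Int.fract y.2
        tailPar_mem := ⟨Int.fract_nonneg _, Int.fract_lt_one _⟩
        tipPar_mem := ⟨Int.fract_nonneg _, Int.fract_lt_one _⟩
        vertical := by
          rw [e1, e2, N.curve_eq_plane, N.curve_eq_plane, hxy]
          rfl
        upward := by
          rw [e1, e2, N.curve_eq_plane, N.curve_eq_plane]
          exact hlt }
    refine ⟨r, rfl, rfl, ⌊y.1⌋, ⌊y.2⌋, ?_⟩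
    obtain ⟨σ', hσ', m1⟩ := N.plane_near_tail r
    obtain ⟨σ, hσ, m2⟩ := N.plane_near_tip r
    have t1 : Tendsto (fun x : (ℝ × ℝ) × (ℝ × ℝ) => (x.1.1, x.2.1 - ⌊y.1⌋)) (𝓝 (0, y))
        (𝓝 (0, r.tailPar)) :=
      Continuous.tendsto' (by fun_prop) _ _ (by simp [r])
    have t2 : Tendsto (fun x : (ℝ × ℝ) × (ℝ × ℝ) => (x.1.2, x.2.2 - ⌊y.2⌋)) (𝓝 (0, y))
        (𝓝 (0, r.tipPar)) :=
      Continuous.tendsto' (by fun_prop) _ _ (by simp [r])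
    have b1 : ∀ᶠ x : (ℝ × ℝ) × (ℝ × ℝ) in 𝓝 (0, y), |x.1.1| < ε₀ :=
      (isOpen_lt (by fun_prop) continuous_const).mem_nhds (by simpa using h0)
    have b2 : ∀ᶠ x : (ℝ × ℝ) × (ℝ × ℝ) in 𝓝 (0, y), |x.1.2| < ε₀ :=
      (isOpen_lt (by fun_prop) continuous_const).mem_nhds (by simpa using h0)
    filter_upwards [t1.eventually m1, t2.eventually m2, b1, b2] with x h1 h2 hb1 hb2 hx
    have f1 := N.plane_add_int (i := i) (q := x.2.1 - ⌊y.1⌋) hb1 ⌊y.1⌋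
    have f2 := N.plane_add_int (i := j) (q := x.2.2 - ⌊y.2⌋) hb2 ⌊y.2⌋
    rw [sub_add_cancel] at f1 f2
    have hv : xy r.tail = xy r.tip := r.vertical
    rw [f1, f2] at hx
    change N.plane i _ = _ at h1
    change N.plane j _ = _ at h2
    rw [h1, h2, hv] at hx
    have hx := add_left_cancel hx
    generalize x.2.1 - ⌊y.1⌋ - r.tailPar = Q' at hx ⊢
    generalize x.2.2 - ⌊y.2⌋ - r.tipPar = Q at hx ⊢
    have hs : (√2 : ℝ) ≠ 0 := by positivity
    simp only [act, overMatrix, underMatrix, Matrix.smul_apply, smul_eq_mul, Matrix.of_apply,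
      Matrix.cons_val', Matrix.cons_val_zero, Matrix.cons_val_one, Matrix.cons_val_fin_one,
      Prod.mk.injEq] at hx
    obtain ⟨g1, g2⟩ := hx
    field_simp at g1 g2
    -- Sum and difference of the two coordinate equations. Because the strands cross at a right
    -- angle, the displacement along each strand equals, up to sign, the offset p in the tube of the
    -- other.
    have k1 : σ' * Q' = -(σ * x.1.2) := by linarith
    have k2 : σ * Q = σ' * x.1.1 := by linarith
    have a1 : |σ| = 1 := by rcases hσ with rfl | rfl <;> simp
    have a2 : |σ'| = 1 := by rcases hσ' with rfl | rfl <;> simp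
    have k1 := congrArg abs k1
    have k2 := congrArg abs k2
    rw [abs_neg, abs_mul, abs_mul, a1, a2, one_mul, one_mul] at k1
    rw [abs_mul, abs_mul, a1, a2, one_mul, one_mul] at k2
    exact ⟨k1, k2⟩
  · left
    -- Equal heights mean that the base points coincide. A vertical segment close to them is shorter
    -- than ε₀, so it stays in the tube about `Λ_i`, and embeddedness makes its length zero.
    have c5 : ContinuousAt (fun x : (ℝ × ℝ) × (ℝ × ℝ) =>
        |N.height j (x.1.2, x.2.2) - N.height i (x.1.1, x.2.1)|) (0, y) := (c4.sub c3).abs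
    have hd := c5.eventually_lt (continuousAt_const (y := ε₀)) (by simpa [heq] using h0)
    have b1 : ∀ᶠ x : (ℝ × ℝ) × (ℝ × ℝ) in 𝓝 (0, y), |x.1.1| < ε₀ :=
      (isOpen_lt (by fun_prop) continuous_const).mem_nhds (by simpa using h0)
    have b2 : ∀ᶠ x : (ℝ × ℝ) × (ℝ × ℝ) in 𝓝 (0, y), |x.1.2| < ε₀ :=
      (isOpen_lt (by fun_prop) continuous_const).mem_nhds (by simpa using h0)
    filter_upwards [hd, b1, b2] with x hx hb1 hb2 hp hh
    have e1 := N.toFun_eq_plane (i := i) x.2.1 hx hb1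
    have e2 := N.toFun_eq_plane (i := j) (z := 0) x.2.2 (by simpa using h0) hb2
    have e3 : N.toFun i (N.height j (x.1.2, x.2.2) - N.height i (x.1.1, x.2.1), x.1.1, x.2.1)
        = N.toFun j (0, x.1.2, x.2.2) := by
      rw [e1, e2, hp]
      simp
    obtain ⟨-, k, hk⟩ := N.embedded i j _ ⟨hx, hb1⟩ _ ⟨by simpa using h0, hb2⟩ e3
    have := congrArg Prod.fst hk
    simp at this
    linarith
  · left
    filter_upwards [c4.eventually_lt c3 hgt] with x hx _
    exact not_lt.2 hx.le

end StandardNeighborhood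

/-! ### Compactness: finitely many chords, and admissible sizes of the surgery -/

namespace StandardNeighborhood

variable {ι : Type*} {L : SurgeryLink ι} {ε₀ : ℝ} (N : StandardNeighborhood L ε₀)

/-- On the cores, p = p' = 0, the equalities in `local_segments` fix both parameters, so chords are
isolated; a compact square of parameters contains only finitely many. -/
theorem finite_chord [Finite ι] (N : StandardNeighborhood L ε₀) (h0 : 0 < ε₀) : Finite L.Chord := by
  have hloc : ∀ i j (y : ℝ × ℝ), ∃ V ∈ 𝓝 y, {r : L.Chord | r.tailIdx = i ∧ r.tipIdx = j ∧
      (r.tailPar, r.tipPar) ∈ V}.Subsingleton := by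
    intro i j y
    have hc : Tendsto (fun y' : ℝ × ℝ => ((0 : ℝ × ℝ), y')) (𝓝 y) (𝓝 (0, y)) :=
      Continuous.tendsto (by fun_prop) _
    have hpl : ∀ r : L.Chord, N.plane r.tailIdx (0, r.tailPar) = N.plane r.tipIdx (0, r.tipPar) ∧
        N.height r.tailIdx (0, r.tailPar) < N.height r.tipIdx (0, r.tipPar) := by
      intro r
      have h1 := r.vertical
      have h2 := r.upward
      rw [N.curve_eq_plane, N.curve_eq_plane] at h1 h2
      exact ⟨h1, h2⟩
    rcases N.local_segments h0 i j y with h | ⟨r₀, -, -, k', k, h⟩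
    · refine ⟨_, hc.eventually h, ?_⟩
      rintro r ⟨rfl, rfl, hr⟩
      exact absurd (hpl r).2 (hr (hpl r).1)
    · refine ⟨_, hc.eventually h, ?_⟩
      rintro r ⟨h1, h2, hr⟩ r' ⟨h1', h2', hr'⟩
      have e := hr (by rw [← h1, ← h2]; exact (hpl r).1)
      have e' := hr' (by rw [← h1', ← h2']; exact (hpl r').1)
      simp only [Prod.fst_zero, Prod.snd_zero, abs_zero, abs_eq_zero] at e e'
      ext
      · rw [h1, h1']
      · rw [h2, h2']
      · linarith [e.1, e'.1]
      · linarith [e.2, e'.2]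
  choose V hV hsub using hloc
  have hcov : ∀ i j, {r : L.Chord | r.tailIdx = i ∧ r.tipIdx = j}.Finite := by
    intro i j
    have hK : IsCompact (Icc (0 : ℝ) 1 ×ˢ Icc (0 : ℝ) 1) := isCompact_Icc.prod isCompact_Icc
    obtain ⟨t, -, ht⟩ := hK.elim_nhds_subcover (V i j) (fun y _ => hV i j y)
    refine (t.finite_toSet.biUnion fun y _ => (hsub i j y).finite).subset ?_
    rintro r ⟨h1, h2⟩
    have hm : (r.tailPar, r.tipPar) ∈ Icc (0 : ℝ) 1 ×ˢ Icc (0 : ℝ) 1 :=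
      ⟨⟨r.tailPar_mem.1, r.tailPar_mem.2.le⟩, ⟨r.tipPar_mem.1, r.tipPar_mem.2.le⟩⟩
    obtain ⟨y, hy, hy'⟩ := mem_iUnion₂.1 (ht hm)
    exact mem_biUnion hy ⟨h1, h2, hy'⟩
  have : (⋃ i, ⋃ j, {r : L.Chord | r.tailIdx = i ∧ r.tipIdx = j}).Finite :=
    finite_iUnion fun i => finite_iUnion fun j => hcov i j
  rw [← finite_univ_iff]
  exact this.subset fun r _ => mem_iUnion₂.2 ⟨r.tailIdx, r.tipIdx, rfl, rfl⟩

/-- The conditions on the size `ε` of the surgery. -/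
structure Small (ε : ℝ) : Prop where
  pos : 0 < ε
  lt : ε < ε₀
  -- Gives 1/ε ≥ 2, so that the shear in a handle dominates every slope of modulus at most 1.
  le_half : ε ≤ 1 / 2
  segments : ∀ i j p' q' p q, |p'| ≤ ε → |p| ≤ ε →
    N.plane i (p', q') = N.plane j (p, q) → N.height i (p', q') < N.height j (p, q) →
    ∃ r : L.Chord, r.tailIdx = i ∧ r.tipIdx = j ∧ ∃ k' k : ℤ,
      |q' - k' - r.tailPar| = |p| ∧ |q - k - r.tipPar| = |p'|
  near_tip : ∀ r : L.Chord, ∃ σ : ℝ, (σ = 1 ∨ σ = -1) ∧ ∀ p q, |p| ≤ ε → |q - r.tipPar| ≤ ε →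
    N.basisChange r.tipIdx p q = σ • overMatrix
  near_tail : ∀ r : L.Chord, ∃ σ : ℝ, (σ = 1 ∨ σ = -1) ∧ ∀ p q, |p| ≤ ε →
    |q - r.tailPar| ≤ ε → N.basisChange r.tailIdx p q = σ • underMatrix
  tail_unique : ∀ r r' : L.Chord, r.tailIdx = r'.tailIdx → ∀ k : ℤ,
    |r.tailPar - r'.tailPar - k| ≤ 2 * ε → r = r'
  tip_unique : ∀ r r' : L.Chord, r.tipIdx = r'.tipIdx → ∀ k : ℤ,
    |r.tipPar - r'.tipPar - k| ≤ 2 * ε → r = r'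
  tip_tail : ∀ r r' : L.Chord, r.tipIdx = r'.tailIdx → ∀ k : ℤ,
    2 * ε < |r.tipPar - r'.tailPar - k|
  -- An acute angle between the images of v off the core and on it: this is what allows rotations to
  -- be computed along the core.
  close : ∀ i p q, |p| ≤ ε → ∀ v : ℝ × ℝ, v ≠ 0 →
    0 < (act (N.basisChange i p q) v).1 * (act (N.basisChange i 0 q) v).1
      + (act (N.basisChange i p q) v).2 * (act (N.basisChange i 0 q) v).2

/-- The local alternative of `local_segments` holds on one neighbourhood of p = p' = 0 for all
parameters in the compact unit square; periodicity extends this to all parameters. -/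
theorem eventually_segments (h0 : 0 < ε₀) (i j : ι) :
    ∀ᶠ ε in 𝓝[>] (0 : ℝ), ∀ p' q' p q, |p'| ≤ ε → |p| ≤ ε →
    N.plane i (p', q') = N.plane j (p, q) → N.height i (p', q') < N.height j (p, q) →
    ∃ r : L.Chord, r.tailIdx = i ∧ r.tipIdx = j ∧ ∃ k' k : ℤ,
      |q' - k' - r.tailPar| = |p| ∧ |q - k - r.tipPar| = |p'| := by
  have hK : IsCompact (Icc (0 : ℝ) 1 ×ˢ Icc (0 : ℝ) 1) := isCompact_Icc.prod isCompact_Icc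
  have h := hK.eventually_forall_of_forall_eventually (x₀ := (0 : ℝ × ℝ))
    (P := fun x y => N.plane i (x.1, y.1) = N.plane j (x.2, y.2) →
      N.height i (x.1, y.1) < N.height j (x.2, y.2) →
      ∃ r : L.Chord, r.tailIdx = i ∧ r.tipIdx = j ∧ ∃ k' k : ℤ,
      |y.1 - k' - r.tailPar| = |x.2| ∧ |y.2 - k - r.tipPar| = |x.1|) (by
    intro y _
    rcases N.local_segments h0 i j y with h | ⟨r, h1, h2, k', k, h⟩
    · filter_upwards [h] with x hx h1 h2
      exact absurd h2 (hx h1)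
    · filter_upwards [h] with x hx h1' _
      exact ⟨r, h1, h2, k', k, hx h1'⟩)
  filter_upwards [eventually_square h, Ioo_mem_nhdsGT h0] with ε hε hlt p' q' p q hp' hp h1 h2
  have hb' := hp'.trans_lt hlt.2
  have hb := hp.trans_lt hlt.2
  have e1 := N.plane_add_int (i := i) (q := Int.fract q') hb' ⌊q'⌋
  have e2 := N.plane_add_int (i := j) (q := Int.fract q) hb ⌊q⌋
  have e3 := N.height_add_int (i := i) (q := Int.fract q') hb' ⌊q'⌋
  have e4 := N.height_add_int (i := j) (q := Int.fract q) hb ⌊q⌋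
  rw [Int.fract_add_floor] at e1 e2 e3 e4
  obtain ⟨r, hr1, hr2, k', k, g1, g2⟩ := hε p' p hp' hp (Int.fract q', Int.fract q)
    ⟨⟨Int.fract_nonneg _, (Int.fract_lt_one _).le⟩, ⟨Int.fract_nonneg _, (Int.fract_lt_one _).le⟩⟩
    (by rw [← e1, ← e2]; exact h1) (by rw [← e3, ← e4]; exact h2)
  simp only [← Int.self_sub_floor] at g1 g2
  refine ⟨r, hr1, hr2, ⌊q'⌋ + k', ⌊q⌋ + k, ?_, ?_⟩
  · rw [← g1]
    push_cast
    congr 1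
    ring
  · rw [← g2]
    push_cast
    congr 1
    ring

/-- Along the core the change of basis is a rotation, by `basisChange_core` and unit speed. -/
theorem dot_core (h0 : 0 < ε₀) (i : ι) (q : ℝ) (v : ℝ × ℝ) :
    (act (N.basisChange i 0 q) v).1 * (act (N.basisChange i 0 q) v).1
      + (act (N.basisChange i 0 q) v).2 * (act (N.basisChange i 0 q) v).2
      = v.1 ^ 2 + v.2 ^ 2 := by
  rw [N.basisChange_core h0]
  have := L.unit_speed i q
  change (L.tangent i q).1 ^ 2 + (L.tangent i q).2 ^ 2 = 1 at this
  simp only [act, Matrix.of_apply, Matrix.cons_val', Matrix.cons_val_zero, Matrix.cons_val_one,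
    Matrix.cons_val_fin_one]
  linear_combination (v.1 ^ 2 + v.2 ^ 2) * this

/-- At p = 0 the expression is the squared length of v. Positivity persists for small p uniformly
over a period and the unit sphere, and rescaling gives all non-zero v. -/
theorem eventually_close (h0 : 0 < ε₀) (i : ι) :
    ∀ᶠ ε in 𝓝[>] (0 : ℝ), ∀ p q, |p| ≤ ε → ∀ v : ℝ × ℝ, v ≠ 0 →
    0 < (act (N.basisChange i p q) v).1 * (act (N.basisChange i 0 q) v).1
      + (act (N.basisChange i p q) v).2 * (act (N.basisChange i 0 q) v).2 := by
  have hK : IsCompact (Icc (0 : ℝ) 1 ×ˢ Metric.sphere (0 : ℝ × ℝ) 1) :=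
    isCompact_Icc.prod (isCompact_sphere _ _)
  have h := hK.eventually_forall_of_forall_eventually (x₀ := (0 : ℝ × ℝ))
    (P := fun x y => 0 < (act (N.basisChange i x.1 y.1) y.2).1
        * (act (N.basisChange i 0 y.1) y.2).1
      + (act (N.basisChange i x.1 y.1) y.2).2 * (act (N.basisChange i 0 y.1) y.2).2) (by
    intro y hy
    have c1 : ∀ a b, ContinuousAt (fun z : (ℝ × ℝ) × (ℝ × (ℝ × ℝ)) =>
        N.basisChange i z.1.1 z.2.1 a b) (0, y) := fun a b =>
      ContinuousAt.comp (g := fun v : ℝ × ℝ => N.basisChange i v.1 v.2 a b)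
        (f := fun z : (ℝ × ℝ) × (ℝ × (ℝ × ℝ)) => (z.1.1, z.2.1))
        (N.continuousAt_basisChange (by simpa using h0) a b) (by fun_prop)
    have c2 : ∀ a b, ContinuousAt (fun z : (ℝ × ℝ) × (ℝ × (ℝ × ℝ)) =>
        N.basisChange i 0 z.2.1 a b) (0, y) := fun a b =>
      ContinuousAt.comp (g := fun v : ℝ × ℝ => N.basisChange i v.1 v.2 a b)
        (f := fun z : (ℝ × ℝ) × (ℝ × (ℝ × ℝ)) => (0, z.2.1))
        (N.continuousAt_basisChange (by simpa using h0) a b) (by fun_prop)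
    simp only [act]
    refine ContinuousAt.eventually_lt (f := fun _ => (0 : ℝ)) continuousAt_const ?_ ?_
    · have e1 := c1 0 0
      have e2 := c1 0 1
      have e3 := c1 1 0
      have e4 := c1 1 1
      have f1 := c2 0 0
      have f2 := c2 0 1
      have f3 := c2 1 0
      have f4 := c2 1 1
      have g1 : ContinuousAt (fun z : (ℝ × ℝ) × (ℝ × (ℝ × ℝ)) => z.2.2.1) (0, y) := by fun_prop
      have g2 : ContinuousAt (fun z : (ℝ × ℝ) × (ℝ × (ℝ × ℝ)) => z.2.2.2) (0, y) := by fun_prop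
      exact (((e1.mul g1).add (e2.mul g2)).mul ((f1.mul g1).add (f2.mul g2))).add
        (((e3.mul g1).add (e4.mul g2)).mul ((f3.mul g1).add (f4.mul g2)))
    · have := N.dot_core h0 i y.1 y.2
      simp only [act] at this
      simp only [Prod.fst_zero]
      rw [this]
      have hne : y.2 ≠ 0 := by
        rintro h
        have := hy.2
        rw [h] at this
        simp at this
      rcases eq_or_ne y.2.1 0 with h1 | h1
      · have h2 : y.2.2 ≠ 0 := fun h2 => hne (Prod.ext h1 h2)
        positivity
      · positivity)
  filter_upwards [eventually_square h, Ioo_mem_nhdsGT h0] with ε hε hlt p q hp v hv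
  have hb := hp.trans_lt hlt.2
  have e1 := N.basisChange_add_int (i := i) (q := Int.fract q) hb ⌊q⌋
  have e2 := N.basisChange_add_int (i := i) (p := 0) (q := Int.fract q) (by simpa using h0) ⌊q⌋
  rw [Int.fract_add_floor] at e1 e2
  have hn : 0 < ‖v‖ := norm_pos_iff.2 hv
  have := hε p 0 hp (by simpa using hlt.1.le) (Int.fract q, ‖v‖⁻¹ • v)
    ⟨⟨Int.fract_nonneg _, (Int.fract_lt_one _).le⟩, by
      simp [norm_smul, hn.ne']⟩
  simp only [act_smul, Prod.smul_fst, Prod.smul_snd, smul_eq_mul] at this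
  rw [e1, e2]
  have hn' : 0 < ‖v‖⁻¹ * ‖v‖⁻¹ := by positivity
  refine pos_of_mul_pos_right (a := ‖v‖⁻¹ * ‖v‖⁻¹) ?_ hn'.le
  refine this.trans_eq ?_
  ring

/-- All small sizes are admissible. -/
theorem eventually_small [Finite ι] (hgen : L.ChordGeneric) (h0 : 0 < ε₀) :
    ∀ᶠ ε in 𝓝[>] (0 : ℝ), N.Small ε := by
  have hfin : Finite L.Chord := N.finite_chord h0
  have hseg := eventually_all.2 fun i => eventually_all.2 fun j => N.eventually_segments h0 i j
  have hclose := eventually_all.2 fun i => N.eventually_close h0 i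
  have htip : ∀ᶠ ε in 𝓝[>] (0 : ℝ), ∀ r : L.Chord, ∃ σ : ℝ, (σ = 1 ∨ σ = -1) ∧
      ∀ p q, |p| ≤ ε → |q - r.tipPar| ≤ ε → N.basisChange r.tipIdx p q = σ • overMatrix := by
    refine eventually_all.2 fun r => ?_
    obtain ⟨σ, hσ, h⟩ := N.plane_near_tip r
    filter_upwards [N.basisChange_near h0 _ _ _ h] with ε hε
    exact ⟨σ, hσ, hε⟩
  have htail : ∀ᶠ ε in 𝓝[>] (0 : ℝ), ∀ r : L.Chord, ∃ σ : ℝ, (σ = 1 ∨ σ = -1) ∧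
      ∀ p q, |p| ≤ ε → |q - r.tailPar| ≤ ε →
        N.basisChange r.tailIdx p q = σ • underMatrix := by
    refine eventually_all.2 fun r => ?_
    obtain ⟨σ, hσ, h⟩ := N.plane_near_tail r
    filter_upwards [N.basisChange_near h0 _ _ _ h] with ε hε
    exact ⟨σ, hσ, hε⟩
  -- For each of the finitely many pairs there is a dichotomy: parameters congruent modulo 1 are
  -- equal, and then genericity applies; otherwise their distance from congruence is bounded below.
  have hu1 : ∀ᶠ ε in 𝓝[>] (0 : ℝ), ∀ r r' : L.Chord, r.tailIdx = r'.tailIdx → ∀ k : ℤ,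
      |r.tailPar - r'.tailPar - k| ≤ 2 * ε → r = r' := by
    refine eventually_all.2 fun r => eventually_all.2 fun r' => ?_
    by_cases he : ∃ k : ℤ, r.tailPar - r'.tailPar = k
    · obtain ⟨k, hk⟩ := he
      refine Eventually.of_forall fun ε hi _ _ => SurgeryLink.Chord.eq_of_tail hgen ?_
      rw [SurgeryLink.Chord.tail, SurgeryLink.Chord.tail, hi,
        eq_of_sub_eq_int r.tailPar_mem r'.tailPar_mem hk]
    · push Not at he
      filter_upwards [exists_pos_of_ne_int he] with ε hε _ k hk
      exact absurd hk (not_le.2 (hε k))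
  have hu2 : ∀ᶠ ε in 𝓝[>] (0 : ℝ), ∀ r r' : L.Chord, r.tipIdx = r'.tipIdx → ∀ k : ℤ,
      |r.tipPar - r'.tipPar - k| ≤ 2 * ε → r = r' := by
    refine eventually_all.2 fun r => eventually_all.2 fun r' => ?_
    by_cases he : ∃ k : ℤ, r.tipPar - r'.tipPar = k
    · obtain ⟨k, hk⟩ := he
      refine Eventually.of_forall fun ε hi _ _ => SurgeryLink.Chord.eq_of_tip hgen ?_
      rw [SurgeryLink.Chord.tip, SurgeryLink.Chord.tip, hi,
        eq_of_sub_eq_int r.tipPar_mem r'.tipPar_mem hk]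
    · push Not at he
      filter_upwards [exists_pos_of_ne_int he] with ε hε _ k hk
      exact absurd hk (not_le.2 (hε k))
  have hu3 : ∀ᶠ ε in 𝓝[>] (0 : ℝ), ∀ r r' : L.Chord, r.tipIdx = r'.tailIdx → ∀ k : ℤ,
      2 * ε < |r.tipPar - r'.tailPar - k| := by
    refine eventually_all.2 fun r => eventually_all.2 fun r' => ?_
    by_cases he : ∃ k : ℤ, r.tipPar - r'.tailPar = k
    · obtain ⟨k, hk⟩ := he
      refine Eventually.of_forall fun ε hi _ => absurd ?_ (SurgeryLink.Chord.tip_ne_tail hgen r r')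
      rw [SurgeryLink.Chord.tail, SurgeryLink.Chord.tip, hi,
        eq_of_sub_eq_int r.tipPar_mem r'.tailPar_mem hk]
    · push Not at he
      filter_upwards [exists_pos_of_ne_int he] with ε hε _ k
      exact hε k
  filter_upwards [hseg, hclose, htip, htail, hu1, hu2, hu3, Ioo_mem_nhdsGT h0,
    Ioo_mem_nhdsGT (half_pos (one_pos (α := ℝ)))] with ε e1 e2 e3 e4 e5 e6 e7 e8 e9
  exact ⟨e8.1, e8.2, e9.2.le, e1, e3, e4, e5, e6, e7, e2⟩

end StandardNeighborhood

/-! ### The profile of the Dehn twist -/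

section Twist

variable {f : ℝ → ℝ} {ε : ℝ}

namespace IsTwistProfile

theorem hasDerivAt_fScaled (hf : IsTwistProfile f) (ε p : ℝ) :
    HasDerivAt (fScaled f ε) (deriv f (p / ε) / ε) p := by
  have h1 : HasDerivAt f (deriv f (p / ε)) (p / ε) :=
    ((hf.smooth.differentiable (by simp)) _).hasDerivAt
  have h2 := h1.comp p ((hasDerivAt_id p).div_const ε)
  rw [mul_one_div] at h2
  exact h2

theorem deriv_fScaled (hf : IsTwistProfile f) (ε p : ℝ) :
    deriv (fScaled f ε) p = deriv f (p / ε) / ε := (hf.hasDerivAt_fScaled ε p).deriv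

theorem continuous_deriv (hf : IsTwistProfile f) : Continuous (deriv f) :=
  hf.smooth.continuous_deriv (by simp)

theorem continuous_deriv_fScaled (hf : IsTwistProfile f) (ε : ℝ) :
    Continuous (deriv (fScaled f ε)) := by
  have : deriv (fScaled f ε) = fun p => deriv f (p / ε) / ε := funext (hf.deriv_fScaled ε)
  rw [this]
  have := hf.continuous_deriv
  fun_prop

theorem deriv_eq_zero (hf : IsTwistProfile f) {p : ℝ} (hp : 1 ≤ |p|) : deriv f p = 0 := by
  obtain ⟨r, hr, h⟩ := hf.deriv_support
  exact h p (hr.le.trans hp)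

theorem fScaled_left (hf : IsTwistProfile f) (hε : 0 < ε) {p : ℝ} (hp : p ≤ -ε) :
    fScaled f ε p = 0 := hf.left _ (by rw [div_le_iff₀ hε]; linarith)

theorem fScaled_right (hf : IsTwistProfile f) (hε : 0 < ε) {p : ℝ} (hp : ε ≤ p) :
    fScaled f ε p = 1 := hf.right _ (by rw [le_div_iff₀ hε]; linarith)

theorem deriv_fScaled_eq_zero (hf : IsTwistProfile f) (hε : 0 < ε) {p : ℝ} (hp : ε ≤ |p|) :
    deriv (fScaled f ε) p = 0 := by
  rw [hf.deriv_fScaled, hf.deriv_eq_zero, zero_div]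
  rw [abs_div, abs_of_pos hε, le_div_iff₀ hε]
  linarith

theorem deriv_fScaled_nonneg (hf : IsTwistProfile f) (hε : 0 < ε) (p : ℝ) :
    0 ≤ deriv (fScaled f ε) p := by
  rw [hf.deriv_fScaled]
  exact div_nonneg (hf.deriv_nonneg _) hε.le

theorem deriv_fScaled_le (hf : IsTwistProfile f) (hε : 0 < ε) (p : ℝ) :
    deriv (fScaled f ε) p ≤ 1 / ε := by
  rw [hf.deriv_fScaled]
  exact div_le_div_of_nonneg_right (hf.deriv_le_one _) hε.le

theorem monotone (hf : IsTwistProfile f) : Monotone f :=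
  monotone_of_deriv_nonneg (hf.smooth.differentiable (by simp)) hf.deriv_nonneg

theorem fScaled_mem (hf : IsTwistProfile f) (ε p : ℝ) : fScaled f ε p ∈ Icc (0 : ℝ) 1 := by
  constructor
  · rcases le_total (p / ε) (-1) with h | h
    · exact (hf.left _ h).ge
    · exact (hf.left _ le_rfl).symm.le.trans (hf.monotone h)
  · rcases le_total (p / ε) 1 with h | h
    · exact (hf.monotone h).trans (hf.right _ le_rfl).le
    · exact (hf.right _ h).le

theorem integrable (hf : IsTwistProfile f) (hε : 0 < ε) :
    MeasureTheory.Integrable (fun P => P * deriv (fScaled f ε) P) := by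
  have := hf.continuous_deriv_fScaled ε
  refine Continuous.integrable_of_hasCompactSupport (by fun_prop) ?_
  refine HasCompactSupport.intro (isCompact_Icc (a := -ε) (b := ε)) fun x hx => ?_
  rw [hf.deriv_fScaled_eq_zero hε, mul_zero]
  rw [mem_Icc, ← abs_le] at hx
  exact (not_le.1 hx).le

theorem HFun_left (hf : IsTwistProfile f) (hε : 0 < ε) {p : ℝ} (hp : p ≤ -ε) :
    HFun f ε p = 0 := by
  refine MeasureTheory.setIntegral_eq_zero_of_forall_eq_zero fun x hx => ?_
  rw [hf.deriv_fScaled_eq_zero hε, mul_zero]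
  exact le_abs.2 (Or.inr (by linarith [mem_Iic.1 hx]))

/-- The integral over the half-line is the interval integral from −ε, since the integrand vanishes
to the left of −ε. -/
theorem hasDerivAt_HFun (hf : IsTwistProfile f) (hε : 0 < ε) (p : ℝ) :
    HasDerivAt (HFun f ε) (p * deriv (fScaled f ε) p) p := by
  have hc := hf.continuous_deriv_fScaled ε
  have hi := hf.integrable hε
  have h1 : HFun f ε = fun p => ∫ P in (-ε)..p, P * deriv (fScaled f ε) P := by
    funext p
    rw [← intervalIntegral.integral_Iic_sub_Iic hi.integrableOn hi.integrableOn]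
    have := hf.HFun_left hε (le_refl (-ε))
    rw [HFun] at this
    rw [this, sub_zero, HFun]
  rw [h1]
  have hc' : Continuous fun P => P * deriv (fScaled f ε) P := by fun_prop
  exact intervalIntegral.integral_hasDerivAt_right (hc'.intervalIntegrable _ _)
    (hc'.stronglyMeasurableAtFilter _ _) hc'.continuousAt

/-- The integrand is odd because f' is even, so the difference of both sides has zero derivative; it
vanishes at 0. -/
theorem HFun_neg (hf : IsTwistProfile f) (hε : 0 < ε) (p : ℝ) :
    HFun f ε (-p) = HFun f ε p := by
  have hd : ∀ p, HasDerivAt (fun p => HFun f ε (-p) - HFun f ε p) 0 p := by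
    intro p
    have h1 := ((hf.hasDerivAt_HFun hε (-p)).comp p (hasDerivAt_neg p)).sub
      (hf.hasDerivAt_HFun hε p)
    have h2 : deriv (fScaled f ε) (-p) = deriv (fScaled f ε) p := by
      rw [hf.deriv_fScaled, hf.deriv_fScaled, neg_div, hf.deriv_even]
    rw [h2] at h1
    have e : -p * deriv (fScaled f ε) p * -1 - p * deriv (fScaled f ε) p = 0 := by ring
    rw [e] at h1
    exact h1
  have := is_const_of_deriv_eq_zero (fun p => (hd p).differentiableAt)
    (fun p => (hd p).deriv) p 0
  simp only [neg_zero, sub_self] at this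
  linarith

theorem HFun_right (hf : IsTwistProfile f) (hε : 0 < ε) {p : ℝ} (hp : ε ≤ |p|) :
    HFun f ε p = 0 := by
  rcases le_abs.1 hp with h | h
  · rw [← hf.HFun_neg hε, hf.HFun_left hε (by linarith)]
  · exact hf.HFun_left hε (by linarith)

theorem HFun_antitone (hf : IsTwistProfile f) (hε : 0 < ε) :
    AntitoneOn (HFun f ε) (Iic 0) := by
  refine antitoneOn_of_deriv_nonpos (convex_Iic 0)
    (fun x _ => (hf.hasDerivAt_HFun hε x).continuousAt.continuousWithinAt)
    (fun x _ => (hf.hasDerivAt_HFun hε x).differentiableAt.differentiableWithinAt) fun x hx => ?_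
  rw [interior_Iic] at hx
  rw [(hf.hasDerivAt_HFun hε x).deriv]
  exact mul_nonpos_of_nonpos_of_nonneg (mem_Iio.1 hx).le (hf.deriv_fScaled_nonneg hε x)

theorem HFun_neg_abs (hf : IsTwistProfile f) (hε : 0 < ε) (p : ℝ) :
    HFun f ε (-|p|) = HFun f ε p := by
  rcases abs_choice p with h | h <;> rw [h]
  · exact hf.HFun_neg hε p
  · rw [neg_neg]

theorem HFun_nonpos (hf : IsTwistProfile f) (hε : 0 < ε) (p : ℝ) : HFun f ε p ≤ 0 := by
  rw [← hf.HFun_neg_abs hε]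
  rcases le_total |p| ε with h | h
  · have := hf.HFun_antitone hε (mem_Iic.2 (by linarith : -ε ≤ 0))
      (mem_Iic.2 (by simp : -|p| ≤ 0)) (by linarith)
    rwa [hf.HFun_left hε le_rfl] at this
  · exact (hf.HFun_left hε (by linarith)).le

theorem HFun_zero_le (hf : IsTwistProfile f) (hε : 0 < ε) (p : ℝ) :
    HFun f ε 0 ≤ HFun f ε p := by
  rw [← hf.HFun_neg_abs hε p]
  exact hf.HFun_antitone hε (mem_Iic.2 (by simp)) (mem_Iic.2 le_rfl) (by simp)

/-- The minimum is at 0. As f_ε' ≤ 1/ε, subtracting x²/(2ε) leaves a monotone function on the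
negative half-line, whose value at −ε is −ε/2. -/
theorem HFun_ge (hf : IsTwistProfile f) (hε : 0 < ε) (p : ℝ) : -(ε / 2) ≤ HFun f ε p := by
  refine le_trans ?_ (hf.HFun_zero_le hε p)
  have hd : ∀ x, HasDerivAt (fun x => HFun f ε x - x ^ 2 / (2 * ε))
      (x * deriv (fScaled f ε) x - x / ε) x := by
    intro x
    have h1 := (hf.hasDerivAt_HFun hε x).sub ((hasDerivAt_pow 2 x).div_const (2 * ε))
    have e : x / ε = ((2 : ℕ) : ℝ) * x ^ (2 - 1) / (2 * ε) := by
      norm_num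
      field_simp
    rw [e]
    exact h1
  have hm : MonotoneOn (fun x => HFun f ε x - x ^ 2 / (2 * ε)) (Iic 0) := by
    refine monotoneOn_of_deriv_nonneg (convex_Iic 0)
      (fun x _ => (hd x).continuousAt.continuousWithinAt)
      (fun x _ => (hd x).differentiableAt.differentiableWithinAt) fun x hx => ?_
    rw [interior_Iic] at hx
    rw [(hd x).deriv]
    have h1 := hf.deriv_fScaled_le hε x
    have h2 : x * (1 / ε) ≤ x * deriv (fScaled f ε) x :=
      mul_le_mul_of_nonpos_left h1 (mem_Iio.1 hx).le
    rw [mul_one_div] at h2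
    linarith
  have := hm (mem_Iic.2 (by linarith : -ε ≤ 0)) (mem_Iic.2 le_rfl) (by linarith)
  simp only [hf.HFun_left hε le_rfl] at this
  have e : (-ε) ^ 2 / (2 * ε) = ε / 2 := by field_simp
  rw [e] at this
  norm_num at this
  linarith

/-- Keeps the top of a handle between ε/2 and 3ε/2. Hence the case distinction at z = 0 in `gluing`
separates bottom from top, and a passage lasts longer than ε. -/
theorem abs_coeff_HFun (hf : IsTwistProfile f) (hε : 0 < ε) (c : SignType) (p : ℝ) :
    |(c : ℝ) * HFun f ε p| ≤ ε / 2 := by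
  have h1 := hf.HFun_ge hε p
  have h2 := hf.HFun_nonpos hε p
  cases c <;> simp [abs_le] <;> first | linarith | (constructor <;> linarith)

end IsTwistProfile

end Twist

/-! ### Points of the surgered manifold -/

namespace StandardNeighborhood

variable {ι : Type*} {L : SurgeryLink ι} {ε₀ : ℝ} (N : StandardNeighborhood L ε₀)
  {ε : ℝ} {f : ℝ → ℝ}

theorem gluing_add_int (i : ι) (u : R3) (k : ℤ) :
    gluing L ε f i (u + (0, 0, (k : ℝ))) = gluing L ε f i u + (0, 0, (k : ℝ)) := by
  simp only [gluing]
  by_cases h : 0 < u.1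
  · simp [h]
    ring
  · simp [h]

theorem gluing_mem (hs : N.Small ε) (hf : IsTwistProfile f) {i : ι} {u : R3}
    (hu : u ∈ handleNhd L ε₀ ε f i) : gluing L ε f i u ∈ openTube ε₀ := by
  have h := abs_le.1 (hf.abs_coeff_HFun hs.pos (L.coeff i) u.2.1)
  have := hs.pos
  have := hs.lt
  obtain ⟨h1, h2, h3⟩ := hu
  simp only [gluing]
  split_ifs with h0
  · exact ⟨abs_lt.2 ⟨by linarith, h3⟩, h1⟩
  · exact ⟨abs_lt.2 ⟨h2, by linarith⟩, h1⟩

theorem handle_add_int (i : ι) (u : R3) (k : ℤ) :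
    u + (0, 0, (k : ℝ)) ∈ handle L ε f i ↔ u ∈ handle L ε f i := by
  simp [handle]

theorem piece_add_int (i : ι) (u : R3) (k : ℤ) :
    u + (0, 0, (k : ℝ)) ∈ N.piece ε f (some i) ↔ u ∈ N.piece ε f (some i) := by
  simp [piece, handleNhd]

theorem toOutside_add_int (hs : N.Small ε) (hf : IsTwistProfile f) {i : ι} {u : R3}
    (hu : u ∈ N.piece ε f (some i)) (k : ℤ) :
    N.toOutside ε f i (u + (0, 0, (k : ℝ))) = N.toOutside ε f i u := by
  rw [toOutside, gluing_add_int, N.toFun_add_int (N.gluing_mem hs hf hu.2)]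
  rfl

/-- If the image lay in a removed tube, embeddedness would bound the glued coordinates by ε, and
undoing the gluing would place u in the handle. -/
theorem toOutside_mem (hs : N.Small ε) (hf : IsTwistProfile f) {i : ι} {u : R3}
    (hu : u ∈ N.piece ε f (some i)) (hu' : u ∉ handle L ε f i) :
    N.toOutside ε f i u ∈ N.piece ε f none := by
  rintro ⟨j, -, v, ⟨hv1, hv2⟩, hv⟩
  have hlt := hs.lt
  have hpos := hs.pos
  obtain ⟨rfl, k, hk⟩ := N.embedded j i v ⟨by linarith, by linarith⟩ _ (N.gluing_mem hs hf hu.2) hv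
  apply hu'
  have h := abs_le.1 (hf.abs_coeff_HFun hs.pos (L.coeff j) u.2.1)
  have e1 := congrArg Prod.fst hk
  have e2 := congrArg (fun u : R3 => u.2.1) hk
  simp only [gluing] at e1 e2
  have hv1 := abs_le.1 hv1
  split_ifs at e1 e2 with h0
  · simp at e1 e2
    exact ⟨by rwa [e2], by linarith, by linarith⟩
  · simp at e1 e2
    exact ⟨by rwa [e2], by linarith, by linarith⟩

/-- Normal forms of the points of the pieces. -/
noncomputable def normalForm (x : Σ a : Option ι, N.piece ε f a) :
    R3 ⊕ (ι × ℝ × ℝ × AddCircle (1 : ℝ)) :=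
  open Classical in
  match x with
  | ⟨none, u⟩ => Sum.inl u
  | ⟨some i, u⟩ => if (u : R3) ∈ handle L ε f i then
      Sum.inr (i, (u : R3).1, (u : R3).2.1, ((u : R3).2.2 : AddCircle (1 : ℝ)))
    else Sum.inl (N.toOutside ε f i u)

/-- Constancy on the generating identifications suffices: the normal form descends to the quotient
and so decides when two charts describe the same point, without analysing the generated equivalence
relation. -/
theorem normalForm_rel (hs : N.Small ε) (hf : IsTwistProfile f)
    {x y : Σ a : Option ι, N.piece ε f a} (h : N.Rel ε f x y) :
    N.normalForm x = N.normalForm y := by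
  cases h with
  | period i u h h' =>
    have e1 := handle_add_int (L := L) (ε := ε) (f := f) i u 1
    have e2 := N.toOutside_add_int hs hf h 1
    simp only [Int.cast_one] at e1 e2
    simp only [normalForm]
    by_cases hu : u ∈ handle L ε f i
    · rw [if_pos hu, if_pos (e1.2 hu)]
      simp only [Prod.fst_add, Prod.snd_add, add_zero, Sum.inr.injEq, Prod.mk.injEq, true_and]
      rw [AddCircle.coe_add, AddCircle.coe_period, add_zero]
    · rw [if_neg hu, if_neg (mt e1.1 hu), e2]
  | glue i u h hu h' =>
    simp only [normalForm, hu, if_false]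

/-- `m` is the point with coordinates `u` in the piece `a`. -/
def At (a : Option ι) (u : R3) (m : N.Surgered ε f) : Prop :=
  ∃ h : u ∈ N.piece ε f a, m = N.pt ε f a u h

/-- `m` lies in a handle. -/
def InHandle (m : N.Surgered ε f) : Prop := ∃ i, m ∈ N.handleSet ε f i

variable {N}

theorem normalForm_eq (hs : N.Small ε) (hf : IsTwistProfile f) {a b : Option ι} {u v : R3}
    {h : u ∈ N.piece ε f a} {h' : v ∈ N.piece ε f b}
    (e : N.pt ε f a u h = N.pt ε f b v h') :
    N.normalForm (⟨a, u, h⟩ : Σ a : Option ι, N.piece ε f a)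
      = N.normalForm (⟨b, v, h'⟩ : Σ a : Option ι, N.piece ε f a) :=
  congrArg (Quot.lift (r := N.Rel ε f) N.normalForm fun _ _ => N.normalForm_rel hs hf) e

variable {m : N.Surgered ε f}

theorem At.none_unique (hs : N.Small ε) (hf : IsTwistProfile f) {u v : R3}
    (h : N.At none u m) (h' : N.At none v m) : u = v := by
  obtain ⟨h1, rfl⟩ := h
  obtain ⟨h2, e⟩ := h'
  simpa [normalForm] using normalForm_eq hs hf e

theorem At.handle_unique (hs : N.Small ε) (hf : IsTwistProfile f) {i j : ι} {u v : R3}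
    (h : N.At (some i) u m) (hu : u ∈ handle L ε f i) (h' : N.At (some j) v m) :
    i = j ∧ ∃ k : ℤ, v = u + (0, 0, (k : ℝ)) := by
  obtain ⟨h1, rfl⟩ := h
  obtain ⟨h2, e⟩ := h'
  have := normalForm_eq hs hf e
  simp only [normalForm, hu, if_true] at this
  split_ifs at this with hv
  simp only [Sum.inr.injEq, Prod.mk.injEq] at this
  obtain ⟨e1, e2, e3, e4⟩ := this
  refine ⟨e1, ?_⟩
  rw [eq_comm, ← sub_eq_zero, ← AddCircle.coe_sub, AddCircle.coe_eq_zero_iff] at e4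
  obtain ⟨k, hk⟩ := e4
  refine ⟨k, ?_⟩
  rw [zsmul_one] at hk
  ext
  · simp [e2]
  · simp [e3]
  · simp [hk]

theorem At.not_none (hs : N.Small ε) (hf : IsTwistProfile f) {i : ι} {u v : R3}
    (h : N.At (some i) u m) (hu : u ∈ handle L ε f i) : ¬ N.At none v m := by
  rintro ⟨h2, e⟩
  obtain ⟨h1, rfl⟩ := h
  have := normalForm_eq hs hf e
  simp [normalForm, hu] at this

theorem At.outside (hs : N.Small ε) (hf : IsTwistProfile f) {i : ι} {u : R3}
    (h : N.At (some i) u m) (hu : u ∉ handle L ε f i) : N.At none (N.toOutside ε f i u) m := by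
  obtain ⟨h1, rfl⟩ := h
  exact ⟨N.toOutside_mem hs hf h1 hu, Quot.sound (Rel.glue i u h1 hu _)⟩

theorem At.period {i : ι} {u : R3} (h : N.At (some i) u m) (k : ℤ) :
    N.At (some i) (u + (0, 0, (k : ℝ))) m := by
  induction k with
  | zero =>
    have : ((0, 0, ((0 : ℤ) : ℝ)) : R3) = 0 := by simp
    rwa [this, add_zero]
  | succ k ih =>
    obtain ⟨h1, e⟩ := ih
    have h2 := (N.piece_add_int i _ 1).2 h1
    rw [Int.cast_one] at h2
    have := Quot.sound (Rel.period i _ h1 h2)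
    have e2 : u + (0, 0, (((k : ℤ) + 1 : ℤ) : ℝ)) = u + (0, 0, ((k : ℤ) : ℝ)) + (0, 0, 1) := by
      simp [add_assoc]
    rw [e2]
    exact ⟨h2, e.trans this⟩
  | pred k ih =>
    obtain ⟨h1, e⟩ := ih
    have e2 : u + (0, 0, ((-(k : ℤ) : ℤ) : ℝ))
        = u + (0, 0, ((-(k : ℤ) - 1 : ℤ) : ℝ)) + (0, 0, 1) := by
      simp [add_assoc]
    have h2 := (N.piece_add_int i (u + (0, 0, ((-(k : ℤ) - 1 : ℤ) : ℝ))) 1).1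
      (by rw [Int.cast_one, ← e2]; exact h1)
    refine ⟨h2, e.trans ?_⟩
    have := Quot.sound (Rel.period i _ h2 (by rw [← e2]; exact h1))
    refine Eq.trans ?_ this.symm
    congr 1

theorem exists_at (m : N.Surgered ε f) : ∃ a u, N.At a u m := by
  induction m using Quot.ind with
  | mk x => exact ⟨x.1, x.2.1, x.2.2, rfl⟩

theorem not_inHandle_iff (hs : N.Small ε) (hf : IsTwistProfile f) :
    ¬ N.InHandle m ↔ ∃ u, N.At none u m := by
  constructor
  · intro h
    obtain ⟨a, u, hu⟩ := exists_at m
    cases a with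
    | none => exact ⟨u, hu⟩
    | some i =>
      refine ⟨_, hu.outside hs hf fun hm => h ⟨i, u, hm, hu⟩⟩
  · rintro ⟨u, hu⟩ ⟨i, v, hv, hv'⟩
    exact At.not_none hs hf (show N.At (some i) v m from hv') hv hu

end StandardNeighborhood

/-! ### The framing in and around a handle -/

/-- The shear by `s`. -/
def shear (s : ℝ) : Matrix (Fin 2) (Fin 2) ℝ := !![1, 0; s, 1]

theorem act_shear (s : ℝ) (v : ℝ × ℝ) : act (shear s) v = (v.1, v.2 + s * v.1) := by
  simp [act, shear, add_comm]

theorem det_shear (s : ℝ) : (shear s).det = 1 := by simp [shear]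

theorem shear_zero : shear 0 = 1 := by
  ext a b
  fin_cases a <;> fin_cases b <;> simp [shear]

theorem shear_mul_neg (s : ℝ) : shear (-s) * shear s = 1 := by
  ext a b
  fin_cases a <;> fin_cases b <;> simp [shear, Matrix.mul_apply]

/-- Coordinates with respect to a frame of the plane `dz + p dq = 0`. -/
theorem coords_iff_of_frame {u X Y : R3} {A : Matrix (Fin 2) (Fin 2) ℝ} (hA : A.det = 1)
    (hX : alphaTube u X = 0) (hY : alphaTube u Y = 0) (hX' : act A X.2 = (1, 0))
    (hY' : act A Y.2 = (0, 1)) (w : R3) (v : ℝ × ℝ) :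
    w = v.1 • X + v.2 • Y ↔ alphaTube u w = 0 ∧ v = act A w.2 := by
  have hlin : ∀ a b : ℝ, act A (a • X + b • Y).2 = (a, b) := by
    intro a b
    have h1 : act A (a • X + b • Y).2 = a • act A X.2 + b • act A Y.2 := by
      simp only [act, Prod.snd_add, Prod.smul_snd, Prod.fst_add, Prod.smul_fst, smul_eq_mul,
        Prod.smul_mk, Prod.mk_add_mk, Prod.mk.injEq]
      constructor <;> ring
    rw [h1, hX', hY']
    simp
  constructor
  · rintro rfl
    refine ⟨by rw [map_add, map_smul, map_smul, hX, hY]; simp, ?_⟩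
    rw [hlin]
  · rintro ⟨h1, rfl⟩
    set v := act A w.2 with hv
    have h2 : w.2 = (v.1 • X + v.2 • Y).2 := by
      rw [← act_inv_act hA w.2, ← act_inv_act hA (v.1 • X + v.2 • Y).2, hlin]
    have h3 : alphaTube u (v.1 • X + v.2 • Y) = 0 := by
      rw [map_add, map_smul, map_smul, hX, hY]; simp
    have h4 : ∀ w : R3, alphaTube u w = w.1 + u.2.1 * w.2.2 := fun w => by simp [alphaTube]
    rw [h4] at h1 h3
    refine Prod.ext ?_ h2
    rw [h2] at h1
    linarith

namespace StandardNeighborhood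

variable {ι : Type*} {L : SurgeryLink ι} {ε₀ : ℝ} (N : StandardNeighborhood L ε₀)
  {ε : ℝ} {f : ℝ → ℝ}

variable (ε f) in
/-- The coordinates of `∂p, ∂q - p ∂z` with respect to `(X, Y)` in the handle about `Λ_i`. -/
noncomputable def handleFrame (ν : ℝ → ℝ) (i : ι) (u : R3) : Matrix (Fin 2) (Fin 2) ℝ :=
  let c : ℝ := (L.coeff i : ℝ)
  let ζ : ℝ := u.2.1 * ν u.1 - c * ε * (1 - ν u.1)
  N.basisChange i u.2.1 (u.2.2 + c * fScaled f ε ζ) * shear (c * deriv (fScaled f ε) ζ)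

variable (ε f) in
/-- The coordinates of `∂p, ∂q - p ∂z` with respect to `(∂x + y ∂z, ∂y)` outside the handle
about `Λ_i`. -/
noncomputable def outFrame (i : ι) (u : R3) : Matrix (Fin 2) (Fin 2) ℝ :=
  open Classical in
  if 0 < u.1 ∧ |u.2.1| ≤ ε then
    N.basisChange i u.2.1 (u.2.2 + (L.coeff i : ℝ) * fScaled f ε u.2.1)
      * shear ((L.coeff i : ℝ) * deriv (fScaled f ε) u.2.1)
  else N.basisChange i u.2.1 u.2.2

variable {N}

theorem det_handleFrame {ν : ℝ → ℝ} {i : ι} {u : R3} (hp : |u.2.1| < ε₀) :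
    (N.handleFrame ε f ν i u).det = 1 := by
  rw [handleFrame, Matrix.det_mul, N.det_basisChange _ hp, det_shear, one_mul]

theorem det_outFrame {i : ι} {u : R3} (hp : |u.2.1| < ε₀) :
    (N.outFrame ε f i u).det = 1 := by
  rw [outFrame]
  split_ifs
  · rw [Matrix.det_mul, N.det_basisChange _ hp, det_shear, one_mul]
  · exact N.det_basisChange _ hp

theorem handleFrame_mul_framingMatrix {ν : ℝ → ℝ} {i : ι} {u : R3} (hp : |u.2.1| < ε₀) :
    N.handleFrame ε f ν i u * N.framingMatrix ε f ν i u = 1 := by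
  simp only [handleFrame, framingMatrix]
  set c : ℝ := (L.coeff i : ℝ)
  set ζ : ℝ := u.2.1 * ν u.1 - c * ε * (1 - ν u.1)
  have h1 := N.det_basisChange (i := i) (u.2.2 + c * fScaled f ε ζ) hp
  have h2 : shear (c * deriv (fScaled f ε) ζ) * !![1, 0; -c * deriv (fScaled f ε) ζ, 1] = 1 := by
    have := shear_mul_neg (-(c * deriv (fScaled f ε) ζ))
    rw [neg_neg] at this
    rw [← this]
    simp [shear]
  rw [Matrix.mul_assoc, ← Matrix.mul_assoc (shear _), h2, Matrix.one_mul,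
    Matrix.mul_nonsing_inv _ (by simp [h1])]

theorem coeff_cases {i : ι} (h : L.coeff i ≠ 0) :
    (L.coeff i = 1 ∧ (L.coeff i : ℝ) = 1) ∨ (L.coeff i = -1 ∧ (L.coeff i : ℝ) = -1) := by
  generalize L.coeff i = c at *
  cases c
  · exact absurd rfl h
  · right; exact ⟨rfl, by simp⟩
  · left; exact ⟨rfl, by simp⟩

theorem handleFrame_add_int {ν : ℝ → ℝ} {i : ι} {u : R3} (hp : |u.2.1| < ε₀) (k : ℤ) :
    N.handleFrame ε f ν i (u + (0, 0, (k : ℝ))) = N.handleFrame ε f ν i u := by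
  simp only [handleFrame, Prod.fst_add, Prod.snd_add, add_zero]
  rw [add_right_comm, N.basisChange_add_int hp]

/-- Here ν = 0 and ζ = −cε, where f_ε' vanishes. The twist is 0 for c = 1 and a full negative period
for c = −1, which the change of basis does not see. -/
theorem handleFrame_bottom (hs : N.Small ε) (hf : IsTwistProfile f) (F : N.Framing ε f) {i : ι}
    (hc : L.coeff i ≠ 0) {z p q : ℝ} (hp : |p| ≤ ε) (hz : z ≤ -ε) :
    N.handleFrame ε f F.ν i (z, p, q) = N.basisChange i p q := by
  have hp' : |p| < ε₀ := hp.trans_lt hs.lt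
  simp only [handleFrame]
  rw [F.ν_bottom z hz]
  have hd : ∀ x : ℝ, |x| = ε → deriv (fScaled f ε) x = 0 := fun x hx =>
    hf.deriv_fScaled_eq_zero hs.pos hx.ge
  have habs : |(ε : ℝ)| = ε := abs_of_pos hs.pos
  rcases coeff_cases hc with ⟨-, h⟩ | ⟨-, h⟩ <;> rw [h]
  · have e : p * 0 - 1 * ε * (1 - 0) = -ε := by ring
    rw [e, hd _ (by rw [abs_neg, habs]), hf.fScaled_left hs.pos le_rfl]
    simp [shear_zero]
  · have e : p * 0 - -1 * ε * (1 - 0) = ε := by ring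
    rw [e, hd _ habs, hf.fScaled_right hs.pos le_rfl]
    have := N.basisChange_add_int (i := i) (q := q) hp' (-1)
    simp only [Int.cast_neg, Int.cast_one] at this
    simp [shear_zero, this]

/-- For both signs of c the top lies at or above ε + H_ε(0), because H_ε(0) ≤ H_ε(p) ≤ 0; so ν = 1
and ζ = p. What results is the planar differential of the gluing map followed by that of the tube.
-/
theorem handleFrame_top (hf : IsTwistProfile f) (hε : 0 < ε) (F : N.Framing ε f) {i : ι}
    (hc : L.coeff i ≠ 0) {z p q : ℝ}
    (hz : ε + (L.coeff i : ℝ) * HFun f ε p ≤ z) :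
    N.handleFrame ε f F.ν i (z, p, q)
      = N.basisChange i p (q + (L.coeff i : ℝ) * fScaled f ε p)
        * shear ((L.coeff i : ℝ) * deriv (fScaled f ε) p) := by
  have h1 := hf.HFun_zero_le hε p
  have h2 := hf.HFun_nonpos hε p
  have h3 := hf.HFun_nonpos hε 0
  have hν : F.ν z = 1 := by
    apply F.ν_top
    rcases coeff_cases hc with ⟨-, h⟩ | ⟨-, h⟩ <;> rw [h] at hz <;> linarith
  simp only [handleFrame, hν]
  simp

theorem not_handle_cases {i : ι} {u : R3} (hu : u ∉ handle L ε f i) (hp : |u.2.1| ≤ ε) :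
    u.1 < -ε ∨ ε + (L.coeff i : ℝ) * HFun f ε u.2.1 < u.1 := by
  by_contra! h
  exact hu ⟨hp, h.1, h.2⟩

theorem top_pos (hf : IsTwistProfile f) (hε : 0 < ε) (c : SignType) (p : ℝ) :
    0 < ε + (c : ℝ) * HFun f ε p := by
  have := (abs_le.1 (hf.abs_coeff_HFun hε c p)).1
  linarith

/-- The formula for the framing inside continues past the bottom and the top. One formula thus
covers a full interval of times around an entry or an exit. -/
theorem outFrame_eq_handleFrame (hs : N.Small ε) (hf : IsTwistProfile f) (F : N.Framing ε f)
    {i : ι} {u : R3} (hc : L.coeff i ≠ 0) (hu' : u ∉ handle L ε f i) (hp : |u.2.1| ≤ ε) :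
    N.outFrame ε f i u = N.handleFrame ε f F.ν i u := by
  obtain ⟨z, p, q⟩ := u
  have := hs.pos
  rcases not_handle_cases hu' hp with h | h
  · rw [handleFrame_bottom hs hf F hc hp h.le, outFrame, if_neg]
    rintro ⟨h1, -⟩
    simp only at h1 h
    linarith
  · rw [handleFrame_top hf hs.pos F hc h.le, outFrame, if_pos]
    exact ⟨(top_pos hf hs.pos _ _).trans h, hp⟩

/-- Beside the handle H_ε vanishes and f_ε is 0 or 1, so the twist is a translation of q by an
integer. -/
theorem toOutside_eq_of_abs (hs : N.Small ε) (hf : IsTwistProfile f) {i : ι} {u : R3}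
    (hu : u ∈ N.piece ε f (some i)) (hp : ε ≤ |u.2.1|) :
    N.toOutside ε f i u = N.toFun i u := by
  obtain ⟨z, p, q⟩ := u
  have hm := N.gluing_mem hs hf hu.2
  simp only [toOutside]
  simp only [gluing] at hm ⊢
  split_ifs at hm ⊢ with h
  · simp only at hp
    simp only [hf.HFun_right hs.pos hp, mul_zero, sub_zero] at hm ⊢
    have hk : ∃ k : ℤ, (L.coeff i : ℝ) * fScaled f ε p = k := by
      rcases le_abs.1 hp with h | h
      · rw [hf.fScaled_right hs.pos h]
        rcases coeff_cases hu.1 with ⟨-, h⟩ | ⟨-, h⟩ <;> rw [h]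
        · exact ⟨1, by simp⟩
        · exact ⟨-1, by simp⟩
      · rw [hf.fScaled_left hs.pos (by linarith)]
        exact ⟨0, by simp⟩
    obtain ⟨k, hk⟩ := hk
    rw [hk] at hm ⊢
    exact N.toFun_add_int' hm.1 hm.2 k
  · rfl

theorem isOpen_piece_some (hf : IsTwistProfile f) (hε : 0 < ε) (i : ι) :
    IsOpen (N.piece ε f (some i)) := by
  have hH : Continuous (HFun f ε) :=
    continuous_iff_continuousAt.2 fun p => (hf.hasDerivAt_HFun hε p).continuousAt
  have h1 : IsOpen {u : R3 | |u.2.1| < ε₀} := isOpen_lt (by fun_prop) continuous_const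
  have h2 : IsOpen {u : R3 | -ε₀ < u.1} := isOpen_lt continuous_const (by fun_prop)
  have h3 : IsOpen {u : R3 | u.1 - (L.coeff i : ℝ) * HFun f ε u.2.1 < ε₀} :=
    isOpen_lt (by fun_prop) continuous_const
  exact isOpen_const.inter (h1.inter (h2.inter h3))

theorem isClosed_handle (hf : IsTwistProfile f) (hε : 0 < ε) (i : ι) :
    IsClosed (handle L ε f i) := by
  have hH : Continuous (HFun f ε) :=
    continuous_iff_continuousAt.2 fun p => (hf.hasDerivAt_HFun hε p).continuousAt
  have h1 : IsClosed {u : R3 | |u.2.1| ≤ ε} := isClosed_le (by fun_prop) continuous_const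
  have h2 : IsClosed {u : R3 | -ε ≤ u.1} := isClosed_le continuous_const (by fun_prop)
  have h3 : IsClosed {u : R3 | u.1 ≤ ε + (L.coeff i : ℝ) * HFun f ε u.2.1} :=
    isClosed_le (by fun_prop) (by fun_prop)
  exact h1.inter (h2.inter h3)

/-- Off the handle one is below, above or beside it, and each region has a single smooth formula.
Above, differentiating q + c f_ε(p) produces the shear; the z-component drops out of the projection.
-/
theorem hasFDerivAt_toOutside (hs : N.Small ε) (hf : IsTwistProfile f) {i : ι} {u : R3}
    (hu : u ∈ N.piece ε f (some i)) (hu' : u ∉ handle L ε f i) :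
    ∃ D : R3 →L[ℝ] R3, HasFDerivAt (N.toOutside ε f i) D u ∧
      ∀ w, xy (D w) = act (N.outFrame ε f i u) w.2 := by
  have hpos := hs.pos
  have htube : ∀ v ∈ N.piece ε f (some i), v.1 ≤ 0 → v ∈ openTube ε₀ := by
    rintro v ⟨-, h1, h2, -⟩ h
    exact ⟨abs_lt.2 ⟨h2, by linarith [hs.lt]⟩, h1⟩
  rcases le_or_gt |u.2.1| ε with hp | hp
  · rcases not_handle_cases hu' hp with h | h
    · have hm := htube u hu (by linarith)
      refine ⟨fderiv ℝ (N.toFun i) u, (N.differentiableAt hm).hasFDerivAt.congr_of_eventuallyEq ?_,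
        fun w => ?_⟩
      · have : ∀ᶠ u' : R3 in 𝓝 u, u'.1 < 0 :=
          (isOpen_lt (by fun_prop) continuous_const).mem_nhds (show u.1 < 0 by linarith)
        filter_upwards [this] with u' hu'
        simp [toOutside, gluing, not_lt.2 hu'.le]
      · obtain ⟨z, p, q⟩ := u
        rw [N.xy_fderiv q hm.1 hm.2, outFrame, if_neg]
        rintro ⟨h1, -⟩
        simp only at h1 h
        linarith
    · have hz : 0 < u.1 := (top_pos hf hs.pos _ _).trans h
      have hm := N.gluing_mem hs hf hu.2
      have hg : gluing L ε f i u = (u.1 - (L.coeff i : ℝ) * HFun f ε u.2.1, u.2.1,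
          u.2.2 + (L.coeff i : ℝ) * fScaled f ε u.2.1) := by simp [gluing, hz]
      have d1 : HasFDerivAt (fun u : R3 => u.1) (ContinuousLinearMap.fst ℝ ℝ (ℝ × ℝ)) u :=
        hasFDerivAt_fst
      have d2 : HasFDerivAt (fun u : R3 => u.2.1)
          (ContinuousLinearMap.fst ℝ ℝ ℝ ∘L ContinuousLinearMap.snd ℝ ℝ (ℝ × ℝ)) u :=
        (ContinuousLinearMap.fst ℝ ℝ ℝ ∘L ContinuousLinearMap.snd ℝ ℝ (ℝ × ℝ)).hasFDerivAt
      have d3 : HasFDerivAt (fun u : R3 => u.2.2)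
          (ContinuousLinearMap.snd ℝ ℝ ℝ ∘L ContinuousLinearMap.snd ℝ ℝ (ℝ × ℝ)) u :=
        (ContinuousLinearMap.snd ℝ ℝ ℝ ∘L ContinuousLinearMap.snd ℝ ℝ (ℝ × ℝ)).hasFDerivAt
      have d4 := (hf.hasDerivAt_HFun hs.pos u.2.1).comp_hasFDerivAt u d2
      have d5 := (hf.hasDerivAt_fScaled ε u.2.1).comp_hasFDerivAt u d2
      rw [← hf.deriv_fScaled] at d5
      have d6 := (d1.sub (d4.const_mul (L.coeff i : ℝ))).prodMk
        (d2.prodMk (d3.add (d5.const_mul (L.coeff i : ℝ))))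
      have d7 := d6.congr_of_eventuallyEq (f₁ := gluing L ε f i) (by
        have : ∀ᶠ u' : R3 in 𝓝 u, 0 < u'.1 :=
          (isOpen_lt continuous_const (by fun_prop)).mem_nhds hz
        filter_upwards [this] with u' hu'
        simp [gluing, hu'])
      refine ⟨_, (N.differentiableAt hm).hasFDerivAt.comp u d7, fun w => ?_⟩
      rw [outFrame, if_pos ⟨hz, hp⟩, act_mul, act_shear, ContinuousLinearMap.comp_apply]
      rw [hg] at hm ⊢
      rw [N.xy_fderiv _ hm.1 hm.2]
      simp [mul_assoc]
  · have hm : u ∈ openTube ε₀ := by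
      obtain ⟨hc, h1, h2, h3⟩ := hu
      rw [hf.HFun_right hs.pos hp.le, mul_zero, sub_zero] at h3
      exact ⟨abs_lt.2 ⟨h2, h3⟩, h1⟩
    refine ⟨fderiv ℝ (N.toFun i) u, (N.differentiableAt hm).hasFDerivAt.congr_of_eventuallyEq ?_,
        fun w => ?_⟩
    · have : ∀ᶠ u' : R3 in 𝓝 u, ε < |u'.2.1| :=
          (isOpen_lt continuous_const (by fun_prop)).mem_nhds hp
      filter_upwards [this, (isOpen_piece_some hf hs.pos i).mem_nhds hu] with u' hu' hu''
      exact toOutside_eq_of_abs hs hf hu'' hu'.le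
    · obtain ⟨z, p, q⟩ := u
      rw [N.xy_fderiv q hm.1 hm.2, outFrame, if_neg]
      rintro ⟨-, h1⟩
      exact absurd hp (not_lt.2 h1)

/-- For |p| ≤ ε the frame depends on z only through its sign, and a short flow off the handle does
not change that sign. -/
theorem outFrame_flow (hf : IsTwistProfile f) (hε : 0 < ε) {i : ι} {u : R3}
    (hu' : u ∉ handle L ε f i) :
    ∀ᶠ s in 𝓝 (0 : ℝ), N.outFrame ε f i (u + s • ((1, 0, 0) : R3)) = N.outFrame ε f i u := by
  have hcont : Continuous fun s : ℝ => (u + s • ((1, 0, 0) : R3)).1 := by fun_prop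
  have hp' : ∀ s : ℝ, (u + s • ((1, 0, 0) : R3)).2 = u.2 := fun s => by simp
  rcases le_or_gt |u.2.1| ε with hp | hp
  · rcases not_handle_cases hu' hp with h | h
    · have : ∀ᶠ s : ℝ in 𝓝 0, (u + s • ((1, 0, 0) : R3)).1 < 0 :=
        (isOpen_lt hcont continuous_const).mem_nhds (by simp; linarith)
      filter_upwards [this] with s hs
      simp only [outFrame, hp']
      rw [if_neg fun h => absurd h.1 (not_lt.2 hs.le),
        if_neg fun h' => by linarith [h'.1]]
    · have hz : 0 < u.1 := (top_pos hf hε _ _).trans h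
      have : ∀ᶠ s : ℝ in 𝓝 0, 0 < (u + s • ((1, 0, 0) : R3)).1 :=
        (isOpen_lt continuous_const hcont).mem_nhds (by simpa)
      filter_upwards [this] with s hs
      simp only [outFrame, hp']
      rw [if_pos ⟨hs, hp⟩, if_pos ⟨hz, hp⟩]
  · refine Eventually.of_forall fun s => ?_
    simp only [outFrame, hp']
    rw [if_neg fun h => absurd h.2 (not_le.2 hp), if_neg fun h => absurd h.2 (not_le.2 hp)]

theorem hasCoords_none_iff (F : N.Framing ε f) {u : R3} (hu : u ∈ N.piece ε f none) (w : R3)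
    (v : ℝ × ℝ) : F.HasCoords none u w v ↔ alphaStd u w = 0 ∧ v = xy w := by
  simp only [Framing.HasCoords, F.X_outside u hu, F.Y_outside u hu]
  obtain ⟨w1, w2, w3⟩ := w
  obtain ⟨v1, v2⟩ := v
  simp only [alphaStd, xy, Prod.smul_mk, Prod.mk_add_mk, Prod.mk.injEq, smul_eq_mul]
  simp
  constructor
  · rintro ⟨rfl, rfl, rfl⟩
    exact ⟨by ring, rfl, rfl⟩
  · rintro ⟨h, rfl, rfl⟩
    exact ⟨rfl, rfl, by linarith⟩

/-- Coordinates with respect to `(X, Y)` at the points of the chart of a handle that lie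
outside the handle. -/
theorem hasCoords_outside_iff (hs : N.Small ε) (hf : IsTwistProfile f) (F : N.Framing ε f)
    {i : ι} {u : R3} (hu : u ∈ N.piece ε f (some i)) (hu' : u ∉ handle L ε f i) (w : R3)
    (v : ℝ × ℝ) : F.HasCoords (some i) u w v ↔
      alphaTube u w = 0 ∧ v = act (N.outFrame ε f i u) w.2 := by
  obtain ⟨D, hD, hxy⟩ := hasFDerivAt_toOutside hs hf hu hu'
  have h1 := F.X_glue i u hu hu'
  have h2 := F.Y_glue i u hu hu'
  have hm := N.toOutside_mem hs hf hu hu'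
  rw [hD.fderiv, F.X_outside _ hm] at h1
  rw [hD.fderiv, F.Y_outside _ hm] at h2
  refine coords_iff_of_frame (det_outFrame hu.2.1) (F.X_mem (some i) u hu)
    (F.Y_mem (some i) u hu) ?_ ?_ w v
  · rw [← hxy, h1]
    rfl
  · rw [← hxy, h2]
    rfl

/-- Coordinates with respect to `(X, Y)` in and near a handle, away from the strip where the
framing is not prescribed. -/
theorem hasCoords_handle_iff (hs : N.Small ε) (hf : IsTwistProfile f) (F : N.Framing ε f)
    {i : ι} {u : R3} (hu : u ∈ N.piece ε f (some i)) (hp : |u.2.1| ≤ ε)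
    (hδ : (L.coeff i : ℝ) * u.2.1 < ε - F.δ) (w : R3)
    (v : ℝ × ℝ) : F.HasCoords (some i) u w v ↔
      alphaTube u w = 0 ∧ v = act (N.handleFrame ε f F.ν i u) w.2 := by
  by_cases hu' : u ∈ handle L ε f i
  · have h1 := F.X_handle i hu.1 u hu' hδ
    have h2 := F.Y_handle i hu.1 u hu' hδ
    have h3 := handleFrame_mul_framingMatrix (N := N) (ε := ε) (f := f) (ν := F.ν) (i := i) hu.2.1
    refine coords_iff_of_frame (det_handleFrame hu.2.1) (F.X_mem (some i) u hu)
      (F.Y_mem (some i) u hu) ?_ ?_ w v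
    · have e : (F.X (some i) u).2 = act (N.framingMatrix ε f F.ν i u) (1, 0) := by
        rw [h1]
        simp [act]
      rw [e, ← act_mul, h3, act_one]
    · have e : (F.Y (some i) u).2 = act (N.framingMatrix ε f F.ν i u) (0, 1) := by
        rw [h2]
        simp [act]
      rw [e, ← act_mul, h3, act_one]
  · rw [hasCoords_outside_iff hs hf F hu hu', outFrame_eq_handleFrame hs hf F hu.1 hu' hp]

end StandardNeighborhood

/-! ### Reeb trajectories in the charts -/

/-- The direction of the Reeb vector field in the coordinates of a piece. -/
def reebDir {ι : Type*} : Option ι → R3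
  | none => (0, 0, 1)
  | some _ => (1, 0, 0)

theorem reebField_eq {ι : Type*} (a : Option ι) : reebField a = fun _ => reebDir a := by
  cases a <;> rfl

/-- A function with constant derivative near a point of an interval is affine there. -/
theorem eventually_affine {u : ℝ → R3} {R : R3} {I : Set ℝ} (hI : Convex ℝ I) {t : ℝ}
    (ht : t ∈ I) (h : ∀ᶠ s in 𝓝[I] t, HasDerivWithinAt u R I s) :
    ∀ᶠ s in 𝓝[I] t, u s = u t + (s - t) • R := by
  obtain ⟨δ, hδ, hb⟩ := Metric.mem_nhdsWithin_iff.1 h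
  have hJ : Convex ℝ (Metric.ball t δ ∩ I) := (convex_ball t δ).inter hI
  filter_upwards [inter_mem (mem_nhdsWithin_of_mem_nhds (Metric.ball_mem_nhds t hδ))
    self_mem_nhdsWithin] with s hs
  have hd : ∀ x ∈ Metric.ball t δ ∩ I,
      HasDerivWithinAt (fun x => u x - (x - t) • R) 0 (Metric.ball t δ ∩ I) x := by
    intro x hx
    have h1 : HasDerivWithinAt u R (Metric.ball t δ ∩ I) x := (hb hx).mono inter_subset_right
    have h2 : HasDerivWithinAt (fun x : ℝ => (x - t) • R) ((1 : ℝ) • R)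
        (Metric.ball t δ ∩ I) x :=
      ((hasDerivWithinAt_id x _).sub_const t).smul_const R
    have h3 := h1.sub h2
    rw [one_smul, sub_self] at h3
    exact h3
  have := hJ.norm_image_sub_le_of_norm_hasDerivWithin_le (C := 0) hd (by simp)
    ⟨Metric.mem_ball_self hδ, ht⟩ hs
  rw [zero_mul, norm_le_zero_iff, sub_eq_zero] at this
  simp only [sub_self, zero_smul, sub_zero] at this
  rw [← this, sub_add_cancel]

namespace StandardNeighborhood

variable {ι : Type*} {L : SurgeryLink ι} {ε₀ : ℝ} {N : StandardNeighborhood L ε₀}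
  {ε : ℝ} {f : ℝ → ℝ}

/-- Tubes commute with vertical translation by `toFun_eq`, and so does the gluing map, whose
corrections depend on p alone. -/
theorem toOutside_flow (hs : N.Small ε) (hf : IsTwistProfile f) {i : ι} {u : R3}
    (hu : u ∈ N.piece ε f (some i)) (hu' : u ∉ handle L ε f i) :
    ∀ᶠ s in 𝓝 (0 : ℝ), N.toOutside ε f i (u + s • ((1, 0, 0) : R3))
      = N.toOutside ε f i u + s • ((0, 0, 1) : R3) := by
  obtain ⟨z, p, q⟩ := u
  have e1 : ∀ s : ℝ, ((z, p, q) : R3) + s • ((1, 0, 0) : R3) = (z + s, p, q) := fun s => by simp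
  have hc : Tendsto (fun s : ℝ => ((z + s, p, q) : R3)) (𝓝 0) (𝓝 (z, p, q)) :=
    Continuous.tendsto' (by fun_prop) _ _ (by simp)
  have hpiece := hc.eventually ((isOpen_piece_some hf hs.pos i).mem_nhds hu)
  have key : ∀ z' q' s : ℝ, ((z', p, q') : R3) ∈ openTube ε₀ →
      ((z' + s, p, q') : R3) ∈ openTube ε₀ →
      N.toFun i (z' + s, p, q') = N.toFun i (z', p, q') + s • ((0, 0, 1) : R3) := by
    intro z' q' s h1 h2
    rw [N.toFun_eq q' h2.1 h2.2, N.toFun_eq q' h1.1 h1.2, add_assoc]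
    simp
  rcases le_or_gt |p| ε with hp | hp
  · rcases not_handle_cases hu' hp with h | h
    · have hz : z < 0 := lt_trans h (by linarith [hs.pos])
      have : ∀ᶠ s : ℝ in 𝓝 0, z + s < 0 :=
        (isOpen_lt (by fun_prop) continuous_const).mem_nhds (by simpa using hz)
      filter_upwards [this, hpiece] with s h1 h2
      have m1 := N.gluing_mem hs hf hu.2
      have m2 := N.gluing_mem hs hf h2.2
      rw [e1]
      simp only [toOutside]
      simp only [gluing, not_lt.2 hz.le, not_lt.2 h1.le, if_false] at m1 m2 ⊢
      exact key z q s m1 m2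
    · have hz : 0 < z := (top_pos hf hs.pos _ _).trans h
      have : ∀ᶠ s : ℝ in 𝓝 0, 0 < z + s :=
        (isOpen_lt continuous_const (by fun_prop)).mem_nhds (by simpa using hz)
      filter_upwards [this, hpiece] with s h1 h2
      have m1 := N.gluing_mem hs hf hu.2
      have m2 := N.gluing_mem hs hf h2.2
      rw [e1]
      simp only [toOutside]
      simp only [gluing, hz, h1, if_true, add_sub_right_comm] at m1 m2 ⊢
      exact key _ _ s m1 m2
  · filter_upwards [hpiece] with s h2
    have hm : ∀ z' : ℝ, ((z', p, q) : R3) ∈ N.piece ε f (some i) →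
        ((z', p, q) : R3) ∈ openTube ε₀ := by
      rintro z' ⟨-, h1, h2, h3⟩
      simp only [hf.HFun_right hs.pos hp.le, mul_zero, sub_zero] at h3
      exact ⟨abs_lt.2 ⟨h2, h3⟩, h1⟩
    rw [e1, toOutside_eq_of_abs hs hf h2 hp.le, toOutside_eq_of_abs hs hf hu hp.le]
    exact key z q s (hm z hu) (hm _ h2)

namespace ReebChord

variable (κ : N.ReebChord ε f)

theorem exists_chart {t : ℝ} (ht : t ∈ Icc 0 κ.T) : ∃ a u, N.At a u (κ.path t) ∧
    ∀ᶠ s in 𝓝[Icc 0 κ.T] t, N.At a (u + (s - t) • reebDir a) (κ.path s) := by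
  obtain ⟨a, u, h⟩ := κ.isIntegral t ht
  refine ⟨a, u t, (h.self_of_nhdsWithin ht).1, ?_⟩
  have h1 := h.mono fun s hs => hs.2
  rw [reebField_eq] at h1
  filter_upwards [h, eventually_affine (convex_Icc _ _) ht h1] with s hs hs'
  rw [← hs']
  exact hs.1

variable {κ}

theorem tendsto_sub_nhdsWithin {I : Set ℝ} (t : ℝ) :
    Tendsto (fun s : ℝ => s - t) (𝓝[I] t) (𝓝 0) :=
  (Continuous.tendsto' (by fun_prop) _ _ (by simp)).mono_left nhdsWithin_le_nhds

/-- The chart that comes with the chord may be that of a handle; the point is then off the handle,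
and the trajectory is carried over by the gluing map. -/
theorem flow_none (hs : N.Small ε) (hf : IsTwistProfile f) {t : ℝ} (ht : t ∈ Icc 0 κ.T) {x : R3}
    (hx : N.At none x (κ.path t)) :
    ∀ᶠ s in 𝓝[Icc 0 κ.T] t, N.At none (x + (s - t) • ((0, 0, 1) : R3)) (κ.path s) := by
  obtain ⟨a, u, hu, h⟩ := κ.exists_chart ht
  cases a with
  | none =>
    rw [hx.none_unique hs hf hu]
    exact h
  | some i =>
    have hu' : u ∉ handle L ε f i := fun hm => hu.not_none hs hf hm hx
    have hx' := hx.none_unique hs hf (hu.outside hs hf hu')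
    have hc : Tendsto (fun s : ℝ => u + (s - t) • ((1, 0, 0) : R3)) (𝓝[Icc 0 κ.T] t) (𝓝 u) :=
      (Continuous.tendsto' (by fun_prop) _ _ (by simp)).mono_left nhdsWithin_le_nhds
    have h2 := hc.eventually ((isClosed_handle hf hs.pos i).isOpen_compl.mem_nhds hu')
    have h3 := (tendsto_sub_nhdsWithin (I := Icc 0 κ.T) t).eventually
      (toOutside_flow hs hf hu.1 hu')
    filter_upwards [h, h2, h3] with s hs1 hs2 hs3
    rw [hx', ← hs3]
    exact At.outside hs hf hs1 hs2

theorem flow_handle (hs : N.Small ε) (hf : IsTwistProfile f) {t : ℝ} (ht : t ∈ Icc 0 κ.T) {i : ι}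
    {u : R3} (hu : u ∈ handle L ε f i) (hx : N.At (some i) u (κ.path t)) :
    ∀ᶠ s in 𝓝[Icc 0 κ.T] t, N.At (some i) (u + (s - t) • ((1, 0, 0) : R3)) (κ.path s) := by
  obtain ⟨a, v, hv, h⟩ := κ.exists_chart ht
  cases a with
  | none => exact absurd hv (hx.not_none hs hf hu)
  | some j =>
    obtain ⟨rfl, k, rfl⟩ := hx.handle_unique hs hf hu hv
    filter_upwards [h] with s hs1
    have := hs1.period (-k)
    have e : u + (0, 0, (k : ℝ)) + (s - t) • reebDir (some i) + (0, 0, ((-k : ℤ) : ℝ))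
        = u + (s - t) • ((1, 0, 0) : R3) := by
      ext <;> simp [reebDir]
    rwa [e] at this

/-- Whether a given vertical line carries the path is locally constant in time off the handles,
hence constant on a connected set of times. -/
theorem flow_outside_on (hs : N.Small ε) (hf : IsTwistProfile f) {S : Set ℝ}
    (hS : S ⊆ Icc 0 κ.T) (hc : IsPreconnected S) (hout : ∀ s ∈ S, ¬ N.InHandle (κ.path s))
    {t : ℝ} (ht : t ∈ S) {x : R3} (hx : N.At none x (κ.path t)) :
    ∀ s ∈ S, N.At none (x + (s - t) • ((0, 0, 1) : R3)) (κ.path s) := by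
  intro s hs'
  have := hc.induction₂ (fun a b => ∀ x, N.At none (x + a • ((0, 0, 1) : R3)) (κ.path a) ↔
    N.At none (x + b • ((0, 0, 1) : R3)) (κ.path b)) ?_
    (fun _ _ _ _ _ _ h1 h2 x => (h1 x).trans (h2 x)) (fun _ _ _ _ h x => (h x).symm) ht hs'
    (x - t • ((0, 0, 1) : R3))
  · rw [sub_add_cancel] at this
    have h2 := this.1 hx
    rwa [sub_add_eq_add_sub, add_sub_assoc, ← sub_smul] at h2
  · intro a ha
    obtain ⟨x₀, hx₀⟩ := (not_inHandle_iff hs hf).1 (hout a ha)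
    filter_upwards [nhdsWithin_mono a hS (flow_none hs hf (hS ha) hx₀)] with b hb x
    constructor
    · intro h
      have e := h.none_unique hs hf hx₀
      rwa [← e, add_assoc, ← add_smul, add_sub_cancel] at hb
    · intro h
      have e := h.none_unique hs hf hb
      have e' : x + a • ((0, 0, 1) : R3) = x₀ := by
        rw [sub_smul] at e
        have := congrArg (fun y => y - b • ((0, 0, 1) : R3) + a • ((0, 0, 1) : R3)) e
        rw [add_sub_cancel_right] at this
        rw [this]
        abel
      rwa [e']

/-- The same connectedness argument. At a time when the path is off the handles both sides of the
equivalence fail, and they fail at nearby times too. -/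
theorem flow_handle_on (hs : N.Small ε) (hf : IsTwistProfile f) {S : Set ℝ}
    (hS : S ⊆ Icc 0 κ.T) (hc : IsPreconnected S) {i : ι} {u : R3}
    (hin : ∀ s ∈ S, u + s • ((1, 0, 0) : R3) ∈ handle L ε f i)
    {t : ℝ} (ht : t ∈ S) (hx : N.At (some i) (u + t • ((1, 0, 0) : R3)) (κ.path t)) :
    ∀ s ∈ S, N.At (some i) (u + s • ((1, 0, 0) : R3)) (κ.path s) := by
  intro s hs'
  refine (hc.induction₂ (fun a b => N.At (some i) (u + a • ((1, 0, 0) : R3)) (κ.path a) ↔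
    N.At (some i) (u + b • ((1, 0, 0) : R3)) (κ.path b)) ?_
    (fun _ _ _ _ _ _ h1 h2 => h1.trans h2) (fun _ _ _ _ h => h.symm) ht hs').1 hx
  intro a ha
  by_cases hh : N.InHandle (κ.path a)
  · obtain ⟨j, v, hv, hv'⟩ := hh
    filter_upwards [nhdsWithin_mono a hS (flow_handle hs hf (hS ha) hv hv'), self_mem_nhdsWithin]
      with b hb hbS
    constructor
    · intro h
      obtain ⟨rfl, k, hk⟩ := At.handle_unique hs hf hv' hv h
      have := hb.period k
      have e : v + (b - a) • ((1, 0, 0) : R3) + (0, 0, (k : ℝ)) = u + b • ((1, 0, 0) : R3) := by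
        have e1 : v = u + a • ((1, 0, 0) : R3) - (0, 0, (k : ℝ)) := by rw [hk]; abel
        rw [e1, sub_smul]
        abel
      rwa [e] at this
    · intro h
      obtain ⟨rfl, k, hk⟩ := h.handle_unique hs hf (hin b hbS) hb
      have := At.period (show N.At (some i) v (κ.path a) from hv') (-k)
      have e : v + (0, 0, ((-k : ℤ) : ℝ)) = u + a • ((1, 0, 0) : R3) := by
        have e1 : v = u + b • ((1, 0, 0) : R3) + (0, 0, (k : ℝ)) - (b - a) • ((1, 0, 0) : R3) := by
          rw [← hk]; abel
        rw [e1, sub_smul]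
        have e2 : ((0, 0, ((-k : ℤ) : ℝ)) : R3) = -(0, 0, (k : ℝ)) := by simp
        rw [e2]
        abel
      rwa [e] at this
  · obtain ⟨x, hx⟩ := (not_inHandle_iff hs hf).1 hh
    filter_upwards [nhdsWithin_mono a hS (flow_none hs hf (hS ha) hx), self_mem_nhdsWithin]
      with b hb hbS
    exact ⟨fun h => absurd hx (h.not_none hs hf (hin a ha)),
      fun h => absurd hb (h.not_none hs hf (hin b hbS))⟩

theorem not_inHandle_end (hs : N.Small ε) (hf : IsTwistProfile f) :
    ¬ N.InHandle (κ.path κ.T) :=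
  (not_inHandle_iff hs hf).2 ⟨_, κ.end_eq⟩

theorem not_inHandle_start (hs : N.Small ε) (hf : IsTwistProfile f) :
    ¬ N.InHandle (κ.path 0) :=
  (not_inHandle_iff hs hf).2 ⟨_, κ.start_eq⟩

/-- A Reeb chord outside the handles runs up to its end or up to the bottom of a handle. -/
theorem outside_run (hs : N.Small ε) (hf : IsTwistProfile f) {t : ℝ} (h0 : 0 ≤ t) (hT : t < κ.T)
    {x : R3} (hx : ∀ᶠ s in 𝓝[>] t, N.At none (x + (s - t) • ((0, 0, 1) : R3)) (κ.path s)) :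
    (∀ s ∈ Ioc t κ.T, N.At none (x + (s - t) • ((0, 0, 1) : R3)) (κ.path s)) ∨
    ∃ e i p q, t < e ∧ e < κ.T ∧ |p| ≤ ε ∧
      (∀ s ∈ Ioo t e, ¬ N.InHandle (κ.path s)) ∧
      N.At (some i) (-ε, p, q) (κ.path e) ∧
      x + (e - t) • ((0, 0, 1) : R3) = N.toFun i (-ε, p, q) := by
  have key : ∀ S ⊆ Icc 0 κ.T, IsPreconnected S → S ∈ 𝓝[>] t →
      (∀ s ∈ S, ¬ N.InHandle (κ.path s)) →
      ∀ s ∈ S, N.At none (x + (s - t) • ((0, 0, 1) : R3)) (κ.path s) := by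
    intro S hS hc hSt hout s hs'
    obtain ⟨s₀, h1, h2⟩ := (hx.and hSt).exists
    have := flow_outside_on hs hf hS hc hout h2 h1 s hs'
    rwa [add_assoc, ← add_smul, sub_add_sub_cancel'] at this
  by_cases hall : ∀ s ∈ Ioc t κ.T, ¬ N.InHandle (κ.path s)
  · left
    exact key _ (fun s hs' => ⟨h0.trans hs'.1.le, hs'.2⟩) isPreconnected_Ioc
      (Ioc_mem_nhdsGT hT) hall
  right
  push Not at hall
  obtain ⟨s₁, hs₁, hs₁'⟩ := hall
  set H := {s | s ∈ Ioc t κ.T ∧ N.InHandle (κ.path s)} with hH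
  have hne : H.Nonempty := ⟨s₁, hs₁, hs₁'⟩
  have hbdd : BddBelow H := ⟨t, fun s hs' => hs'.1.1.le⟩
  set e := sInf H with he
  have het : t < e := by
    obtain ⟨b, hb, hb'⟩ := (mem_nhdsGT_iff_exists_Ioo_subset).1 hx
    refine lt_of_lt_of_le (mem_Ioi.1 hb) (le_csInf hne fun s hs' => ?_)
    by_contra! hlt
    exact (not_inHandle_iff hs hf).2 ⟨_, hb' ⟨hs'.1.1, hlt⟩⟩ hs'.2
  have heT : e ≤ κ.T := (csInf_le hbdd ⟨hs₁, hs₁'⟩).trans hs₁.2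
  have heI : e ∈ Icc 0 κ.T := ⟨h0.trans het.le, heT⟩
  have hbelow : ∀ s ∈ Ioo t e, ¬ N.InHandle (κ.path s) := fun s hs' h =>
    absurd (csInf_le hbdd ⟨⟨hs'.1, hs'.2.le.trans heT⟩, h⟩) (not_le.2 hs'.2)
  -- Being outside is an open condition in time, so the infimum of the handle times is attained.
  have heH : N.InHandle (κ.path e) := by
    by_contra hcon
    obtain ⟨y, hy⟩ := (not_inHandle_iff hs hf).1 hcon
    obtain ⟨δ, hδ, hb⟩ := Metric.mem_nhdsWithin_iff.1 (flow_none hs hf heI hy)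
    obtain ⟨s, hsH, hslt⟩ := exists_lt_of_csInf_lt hne (show sInf H < e + δ by linarith)
    have hse : e ≤ s := csInf_le hbdd hsH
    refine (not_inHandle_iff hs hf).2 ⟨_, hb ⟨?_, ⟨heI.1.trans hse, hsH.1.2⟩⟩⟩ hsH.2
    rw [Metric.mem_ball, Real.dist_eq, abs_lt]
    constructor <;> linarith
  have heT' : e < κ.T := by
    refine lt_of_le_of_ne heT fun h => ?_
    rw [h] at heH
    exact not_inHandle_end hs hf heH
  obtain ⟨i, ⟨z, p, q⟩, hu, hu'⟩ := heH
  have hfl := flow_handle hs hf heI hu hu'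
  have hIoo : Ioo t e ∈ 𝓝[<] e := Ioo_mem_nhdsLT het
  have hle : 𝓝[<] e ≤ 𝓝[Icc 0 κ.T] e := by
    rw [← nhdsWithin_Ioo_eq_nhdsLT het]
    exact nhdsWithin_mono _ fun s hs' => ⟨h0.trans hs'.1.le, hs'.2.le.trans heT⟩
  have e1 : ∀ s : ℝ, ((z, p, q) : R3) + (s - e) • ((1, 0, 0) : R3) = (z + (s - e), p, q) :=
    fun s => by simp
  -- Entry is through the bottom: from a point higher up, the backward flow would remain in the
  -- handle just before the first handle time.
  have hz : z = -ε := by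
    by_contra hne'
    have hlt : -ε < z := lt_of_le_of_ne hu.2.1 (Ne.symm hne')
    have h1 : ∀ᶠ s in 𝓝[<] e, -ε < z + (s - e) :=
      mem_nhdsWithin_of_mem_nhds ((isOpen_lt continuous_const (by fun_prop)).mem_nhds
        (by simpa using hlt))
    obtain ⟨s, hs1, hs2, hs3⟩ := (h1.and ((hfl.filter_mono hle).and hIoo)).exists
    rw [e1] at hs2
    refine hbelow s hs3 ⟨i, (z + (s - e), p, q), ⟨hu.1, hs1.le, ?_⟩, hs2⟩
    have := hu.2.2
    have := hs3.2
    simp only at *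
    linarith
  subst hz
  refine ⟨e, i, p, q, het, heT', hu.1, hbelow, hu', ?_⟩
  have hlt := hs.lt
  have hpos := hs.pos
  -- At e the path no longer has outside coordinates. The two descriptions are compared at a
  -- slightly earlier time s and then translated by e − s.
  have h1 : ∀ᶠ s in 𝓝[<] e, -ε₀ < -ε + (s - e) :=
    mem_nhdsWithin_of_mem_nhds ((isOpen_lt continuous_const (by fun_prop)).mem_nhds
      (by simpa using hlt))
  obtain ⟨s, hs1, hs2, hs3⟩ := (h1.and ((hfl.filter_mono hle).and hIoo)).exists
  rw [e1] at hs2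
  have hnot : ((-ε + (s - e), p, q) : R3) ∉ handle L ε f i := fun h => by
    have := h.2.1
    have := hs3.2
    simp only at *
    linarith
  have h3 := hs2.outside hs hf hnot
  have h4 := key (Ioo t e) (fun s hs' => ⟨h0.trans hs'.1.le, hs'.2.le.trans heT⟩)
    isPreconnected_Ioo (Ioo_mem_nhdsGT het) hbelow s hs3
  have h5 := h4.none_unique hs hf h3
  have hp0 : |p| < ε₀ := lt_of_le_of_lt hu.1 hlt
  have hneg : ¬ 0 < -ε + (s - e) := by linarith [hs3.2]
  simp only [toOutside, gluing, hneg, if_false] at h5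
  rw [N.toFun_eq q (abs_lt.2 ⟨hs1, by linarith [hs3.2]⟩) hp0] at h5
  rw [N.toFun_eq q (by rw [abs_neg, abs_of_pos hpos]; exact hlt) hp0]
  have e2 : (e - t) • ((0, 0, 1) : R3) = (s - t) • ((0, 0, 1) : R3) + (0, 0, e - s) := by
    simp
  rw [e2, ← add_assoc, h5, add_assoc]
  simp only [Prod.mk_add_mk, add_zero]
  congr 3
  ring

/-- A Reeb chord that enters a handle passes through it. -/
theorem handle_run (hs : N.Small ε) (hf : IsTwistProfile f) {e : ℝ} (h0 : 0 ≤ e) (hT : e < κ.T)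
    {i : ι} {p q : ℝ} (hp : |p| ≤ ε) (hx : N.At (some i) (-ε, p, q) (κ.path e)) {e' : ℝ}
    (he' : e' = e + 2 * ε + (L.coeff i : ℝ) * HFun f ε p) :
    e' < κ.T ∧ (∀ s ∈ Icc e e', N.At (some i) (-ε + (s - e), p, q) (κ.path s)) ∧
    ∀ᶠ s in 𝓝[>] e', N.At none
      (N.toFun i (ε, p, q + (L.coeff i : ℝ) * fScaled f ε p) + (s - e') • ((0, 0, 1) : R3))
      (κ.path s) := by
  have hpos := hs.pos
  have hlt := hs.lt
  have htop := top_pos hf hs.pos (L.coeff i) p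
  have e1 : ∀ s : ℝ, ((-ε - e, p, q) : R3) + s • ((1, 0, 0) : R3) = (-ε + (s - e), p, q) :=
    fun s => by simp; ring
  have hmem : ∀ s ∈ Icc e e', ((-ε + (s - e), p, q) : R3) ∈ handle L ε f i := by
    intro s hs'
    refine ⟨hp, ?_, ?_⟩
    · simp only; linarith [hs'.1]
    · simp only; linarith [hs'.2]
  -- It is not yet known that the chord lives until e', hence the minimum. Ending inside is then
  -- excluded, because chords end outside the handles.
  have hrun : ∀ s ∈ Icc e (min e' κ.T), N.At (some i) (-ε + (s - e), p, q) (κ.path s) := by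
    intro s hs'
    have := flow_handle_on (κ := κ) hs hf (S := Icc e (min e' κ.T)) (i := i)
      (u := (-ε - e, p, q))
      (fun s hs' => ⟨h0.trans hs'.1, hs'.2.trans (min_le_right _ _)⟩) isPreconnected_Icc
      (fun s hs' => by rw [e1]; exact hmem s ⟨hs'.1, hs'.2.trans (min_le_left _ _)⟩)
      (t := e) ⟨le_rfl, le_min (by linarith) hT.le⟩ (by rw [e1]; simpa using hx) s hs'
    rwa [e1] at this
  have heT : e' < κ.T := by
    by_contra! hle
    have hm : κ.T ∈ Icc e (min e' κ.T) := ⟨hT.le, le_min hle le_rfl⟩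
    exact not_inHandle_end hs hf ⟨i, _, hmem _ ⟨hT.le, hle⟩, hrun _ hm⟩
  rw [min_eq_left heT.le] at hrun
  refine ⟨heT, hrun, ?_⟩
  have hee : e ≤ e' := by linarith
  have hfl := flow_handle hs hf (κ := κ) (t := e') ⟨h0.trans hee, heT.le⟩
    (hmem e' ⟨hee, le_rfl⟩) (hrun e' ⟨hee, le_rfl⟩)
  have hle : 𝓝[>] e' ≤ 𝓝[Icc 0 κ.T] e' := by
    rw [← nhdsWithin_Ioo_eq_nhdsGT heT]
    exact nhdsWithin_mono _ fun s hs' => ⟨(h0.trans hee).trans hs'.1.le, hs'.2.le⟩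
  have h1 : ∀ᶠ s in 𝓝[>] e', ε + (s - e') < ε₀ :=
    mem_nhdsWithin_of_mem_nhds ((isOpen_lt (by fun_prop) continuous_const).mem_nhds
      (by simpa using hlt))
  filter_upwards [hfl.filter_mono hle, h1, self_mem_nhdsWithin] with s hs1 hs2 hs3
  have hs3 : e' < s := hs3
  have e2 : ((-ε + (e' - e), p, q) : R3) + (s - e') • ((1, 0, 0) : R3)
      = (-ε + (s - e), p, q) := by simp; ring
  rw [e2] at hs1
  have hnot : ((-ε + (s - e), p, q) : R3) ∉ handle L ε f i := fun h => by
    have := h.2.2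
    simp only at this
    linarith
  have h3 := hs1.outside hs hf hnot
  have hz : 0 < -ε + (s - e) := by linarith
  simp only [toOutside, gluing, hz, if_true] at h3
  have e3 : -ε + (s - e) - (L.coeff i : ℝ) * HFun f ε p = ε + (s - e') := by linarith
  have hp0 : |p| < ε₀ := lt_of_le_of_lt hp hlt
  rw [e3, N.toFun_eq _ (abs_lt.2 ⟨by linarith, hs2⟩) hp0] at h3
  rw [N.toFun_eq _ (by rwa [abs_of_pos hpos]) hp0, add_assoc]
  simpa using h3

end ReebChord

end StandardNeighborhood

/-! ### Decomposition of a Reeb chord into segments and passages -/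

namespace StandardNeighborhood

variable {ι : Type*} {L : SurgeryLink ι} {ε₀ : ℝ} {N : StandardNeighborhood L ε₀}
  {ε : ℝ} {f : ℝ → ℝ}

variable (N ε f) in
/-- The linearised Reeb flow, in the framing, along the passage of a handle, as a function of the
time after the entry at the point `(-ε, p, q)`. -/
noncomputable def passFrame (ν : ℝ → ℝ) (i : ι) (p q s : ℝ) : Matrix (Fin 2) (Fin 2) ℝ :=
  N.handleFrame ε f ν i (-ε + s, p, q) * (N.handleFrame ε f ν i (-ε, p, q))⁻¹

namespace ReebChord

/-- `κ.Run ν t w M`: after the time `t`, the Reeb chord `κ` is described by the chords of the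
word `w`, and its linearised flow from time `t` is given, in the framing, by `M`. -/
inductive Run (κ : N.ReebChord ε f) (ν : ℝ → ℝ) :
    ℝ → List L.Chord → (ℝ → Matrix (Fin 2) (Fin 2) ℝ) → Prop
  | last (t : ℝ) (r : L.Chord) (h0 : 0 ≤ t) (hT : t < κ.T)
      (hout : ∀ s ∈ Ioc t κ.T, ¬ N.InHandle (κ.path s)) (hidx : r.tipIdx = κ.endIdx)
      (htip : ∃ k : ℤ, |κ.endPar - k - r.tipPar| ≤ ε) : Run κ ν t [r] fun _ => 1
  | step (t e e' p q : ℝ) (r r' : L.Chord) (w : List L.Chord)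
      (M : ℝ → Matrix (Fin 2) (Fin 2) ℝ) (h0 : 0 ≤ t) (he : t < e) (hee : e < e') (hT : e' < κ.T)
      (hidx : r.tipIdx = r'.tailIdx) (hc : L.coeff r.tipIdx ≠ 0) (hp : |p| ≤ ε)
      (hq : |q - r.tipPar| ≤ ε)
      (hq' : ∃ k : ℤ, |q + (L.coeff r.tipIdx : ℝ) * fScaled f ε p - r'.tailPar - k| ≤ ε)
      (hlen : e' = e + 2 * ε + (L.coeff r.tipIdx : ℝ) * HFun f ε p)
      (hout : ∀ s ∈ Ioo t e, ¬ N.InHandle (κ.path s))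
      (hin : ∀ s ∈ Icc e e', N.At (some r.tipIdx) (-ε + (s - e), p, q) (κ.path s))
      (hrun : Run κ ν e' (r' :: w) M) :
      Run κ ν t (r :: r' :: w) fun s => M s * N.passFrame ε f ν r.tipIdx p q (s - e)

variable {κ : N.ReebChord ε f}

/-- The segment starts at or above the slice z = 0 of one tube and ends at or below that of the
other, so the points of the two slices under comparison are in strictly increasing height and
`Small.segments` applies. -/
theorem exists_segment (hs : N.Small ε) {i j : ι} {p' q' p q h' h d : ℝ} (hp' : |p'| ≤ ε)
    (hp : |p| ≤ ε) (hh' : h' ∈ Icc 0 ε) (hh : h ∈ Icc (-ε) 0) (hd : 0 < d)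
    (heq : N.toFun i (h', p', q') + d • ((0, 0, 1) : R3) = N.toFun j (h, p, q)) :
    ∃ r : L.Chord, r.tailIdx = i ∧ r.tipIdx = j ∧ ∃ k' k : ℤ,
      |q' - k' - r.tailPar| = |p| ∧ |q - k - r.tipPar| = |p'| := by
  have hlt := hs.lt
  rw [N.toFun_eq_plane q' (abs_lt.2 ⟨by linarith [hh'.1, hs.pos], by linarith [hh'.2]⟩)
    (hp'.trans_lt hlt), N.toFun_eq_plane q (abs_lt.2 ⟨by linarith [hh.1], by linarith [hh.2,
    hs.pos]⟩) (hp.trans_lt hlt)] at heq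
  simp only [Prod.smul_mk, smul_eq_mul, mul_zero, mul_one, Prod.mk_add_mk, add_zero,
    Prod.mk.injEq] at heq
  obtain ⟨h1, h2, h3⟩ := heq
  exact hs.segments i j p' q' p q hp' hp (Prod.ext h1 h2) (by linarith [hh'.1, hh.2])

/-- The induction is on the remaining time in units of ε, since every passage lasts longer than ε.
The height h' is 0 at a start on Λ⁰ and ε at the exit from a handle. For a chord meeting no handle,
the equalities in `Small.segments` recover both ends exactly. -/
theorem exists_run (hs : N.Small ε) (hf : IsTwistProfile f) (κ : N.ReebChord ε f) (ν : ℝ → ℝ)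
    (n : ℕ) : ∀ (t : ℝ) (i' : ι) (p' q' h' : ℝ), 0 ≤ t → t < κ.T → κ.T - t < n * ε → |p'| ≤ ε →
      h' ∈ Icc 0 ε →
      (∀ᶠ s in 𝓝[>] t, N.At none (N.toFun i' (h', p', q') + (s - t) • ((0, 0, 1) : R3))
        (κ.path s)) →
      ∃ r w M, κ.Run ν t (r :: w) M ∧ r.tailIdx = i' ∧ (∃ k : ℤ, |q' - k - r.tailPar| ≤ ε) ∧
        (w = [] → (∃ k : ℤ, q' - k = r.tailPar) ∧
          ∃ k : ℤ, |κ.endPar - k - r.tipPar| = |p'|) := by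
  induction n with
  | zero =>
    intro t i' p' q' h' _ hT hn
    rw [Nat.cast_zero, zero_mul] at hn
    linarith
  | succ n ih =>
    intro t i' p' q' h' h0 hT hn hp' hh' hx
    have hpos := hs.pos
    rcases outside_run hs hf h0 hT hx with hall | ⟨e, i, p, q, het, heT, hp, hout, hat, hseg⟩
    · have h1 := hall κ.T ⟨hT, le_rfl⟩
      have h2 := h1.none_unique hs hf κ.end_eq
      rw [← N.core] at h2
      obtain ⟨r, hr1, hr2, k', k, e1, e2⟩ := exists_segment hs (p := 0) (h := 0) hp'
        (by simpa using hs.pos.le) hh' ⟨by linarith, le_rfl⟩ (by linarith) h2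
      rw [abs_zero, abs_eq_zero] at e1
      refine ⟨r, [], _, .last t r h0 hT
        (fun s hs' => (not_inHandle_iff hs hf).2 ⟨_, hall s hs'⟩) hr2 ⟨k, by rw [e2]; exact hp'⟩,
        hr1, ⟨k', by rw [e1, abs_zero]; exact hs.pos.le⟩, fun _ => ⟨⟨k', by linarith⟩, k, e2⟩⟩
    · obtain ⟨r, hr1, hr2, k', k, e1, e2⟩ := exists_segment hs hp' hp hh'
        ⟨le_rfl, by linarith⟩ (by linarith) hseg
      subst hr2
      have hat' : N.At (some r.tipIdx) (-ε, p, q - k) (κ.path e) := by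
        have := hat.period (-k)
        simpa [sub_eq_add_neg] using this
      have hc : L.coeff r.tipIdx ≠ 0 := hat.1.1
      have htop := top_pos hf hs.pos (L.coeff r.tipIdx) p
      obtain ⟨hT', hin, hnext⟩ := handle_run hs hf (h0.trans het.le) heT hp hat' rfl
      set e' := e + 2 * ε + (L.coeff r.tipIdx : ℝ) * HFun f ε p with he'
      push_cast at hn
      obtain ⟨r', w, M, hrun, hr1', ⟨k₁, hk₁⟩, -⟩ := ih e' r.tipIdx p _ ε (by linarith) hT'
        (by linarith) hp ⟨hs.pos.le, le_rfl⟩ hnext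
      refine ⟨r, r' :: w, _, .step t e e' p (q - k) r r' w M h0 het (by linarith) hT' hr1'.symm hc
        hp (by rw [e2]; exact hp') ⟨k₁, ?_⟩ he' hout hin hrun, hr1,
        ⟨k', by rw [e1]; exact hp⟩, by simp⟩
      convert hk₁ using 2
      ring

theorem exists_run_start (hs : N.Small ε) (hf : IsTwistProfile f) (κ : N.ReebChord ε f)
    (ν : ℝ → ℝ) : ∃ r w M, κ.Run ν 0 (r :: w) M ∧ r.tailIdx = κ.startIdx ∧
      (∃ k : ℤ, |κ.startPar - k - r.tailPar| ≤ ε) ∧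
      (w = [] → (∃ k : ℤ, κ.startPar - k = r.tailPar) ∧ ∃ k : ℤ, κ.endPar - k = r.tipPar) := by
  obtain ⟨n, hn⟩ := exists_nat_gt (κ.T / ε)
  have hpos := hs.pos
  rw [div_lt_iff₀ hpos] at hn
  have h0 := flow_none hs hf (κ := κ) (t := 0) ⟨le_rfl, κ.T_pos.le⟩ κ.start_eq
  have hle : 𝓝[>] (0 : ℝ) ≤ 𝓝[Icc 0 κ.T] 0 := by
    rw [← nhdsWithin_Ioo_eq_nhdsGT κ.T_pos]
    exact nhdsWithin_mono _ Ioo_subset_Icc_self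
  obtain ⟨r, w, M, h1, h2, h3, h4⟩ := exists_run hs hf κ ν n 0 κ.startIdx 0 κ.startPar 0 le_rfl
    κ.T_pos (by simpa using hn) (by simpa using hpos.le) ⟨le_rfl, hpos.le⟩
    (by rw [N.core]; exact h0.filter_mono hle)
  refine ⟨r, w, M, h1, h2, h3, fun hw => ⟨(h4 hw).1, ?_⟩⟩
  obtain ⟨k, hk⟩ := (h4 hw).2
  rw [abs_zero, abs_eq_zero] at hk
  exact ⟨k, by linarith⟩

/-! ### The word of a run -/

theorem Run.isWord_aux {ν : ℝ → ℝ} {t : ℝ} {w : List L.Chord}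
    {M : ℝ → Matrix (Fin 2) (Fin 2) ℝ} (h : κ.Run ν t w M) :
    (∀ l (hl : l + 1 < w.length),
      w[l].tipIdx = w[l + 1].tailIdx ∧ L.coeff w[l].tipIdx ≠ 0) ∧
    ∃ h : w ≠ [], (w.getLast h).tipIdx = κ.endIdx := by
  induction h with
  | last t r h0 hT hout hidx htip =>
    exact ⟨fun l hl => by simp at hl, by simp, by simpa using hidx⟩
  | step t e e' p q r r' w M h0 he hee hT hidx hc hp hq hq' hlen hout hin hrun ih =>
    refine ⟨fun l hl => ?_, by simp, ?_⟩
    · cases l with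
      | zero => exact ⟨hidx, hc⟩
      | succ l => exact ih.1 l (by simpa using hl)
    · obtain ⟨_, h⟩ := ih.2
      rw [List.getLast_cons (by simp)]
      exact h

theorem Run.isWord {ν : ℝ → ℝ} {t : ℝ} {r : L.Chord} {w : List L.Chord}
    {M : ℝ → Matrix (Fin 2) (Fin 2) ℝ} (h : κ.Run ν t (r :: w) M) (hr : r.tailIdx = κ.startIdx) :
    L.IsWord (r :: w) := by
  obtain ⟨h1, h2, h3⟩ := h.isWord_aux
  refine ⟨h1, h2, ?_, ?_⟩
  · rw [List.head_cons, hr, κ.start_coeff]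
  · rw [h3, κ.end_coeff]

/-- The entry and exit times of the first passage are prepended to those of the remaining run. -/
theorem Run.times {ν : ℝ → ℝ} {t : ℝ} {w : List L.Chord}
    {M : ℝ → Matrix (Fin 2) (Fin 2) ℝ} (h : κ.Run ν t w M) :
    ∃ enter leave : ℕ → ℝ,
    (∀ l (hl : l + 1 < w.length),
      t < enter l ∧ enter l < leave l ∧ leave l < κ.T ∧
      κ.path (enter l) ∈ N.entrySquare ε f w[l] ∧
      κ.path (leave l) ∈ N.exitSquare ε f w[l + 1]) ∧
    (∀ l, l + 2 < w.length → leave l < enter (l + 1)) ∧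
    (∀ s ∈ Ioc t κ.T, N.InHandle (κ.path s) ↔
      ∃ l, l + 1 < w.length ∧ s ∈ Icc (enter l) (leave l)) := by
  induction h with
  | last t r h0 hT hout hidx htip =>
    refine ⟨0, 0, fun l hl => by simp at hl, fun l hl => by simp at hl, fun s hs' => ?_⟩
    simp only [hout s hs', false_iff]
    rintro ⟨l, hl, -⟩
    simp at hl
  | step t e e' p q r r' w M h0 he hee hT hidx hc hp hq hq' hlen hout hin hrun ih =>
    obtain ⟨enter, leave, h1, h2, h3⟩ := ih
    refine ⟨fun l => Nat.casesOn l e enter, fun l => Nat.casesOn l e' leave, ?_, ?_, ?_⟩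
    · intro l hl
      cases l with
      | zero =>
        refine ⟨he, hee, hT, ?_, ?_⟩
        · obtain ⟨h, hh⟩ := hin e ⟨le_rfl, hee.le⟩
          simp only [sub_self, add_zero] at h hh
          exact ⟨p, q, hp, hq, h, hh⟩
        · obtain ⟨k, hk⟩ := hq'
          -- `exitSquare` bounds a real lift of q, whereas the run controls it only modulo 1; the
          -- period shift supplies the right lift.
          have h := (hin e' ⟨hee.le, le_rfl⟩).period (-k)
          have e1 : -ε + (e' - e) = ε + (L.coeff r'.tailIdx : ℝ) * HFun f ε p := by
            rw [← hidx]; linarith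
          simp only [Prod.mk_add_mk, add_zero, Int.cast_neg, e1] at h
          rw [hidx] at h hk
          obtain ⟨h, hh⟩ := h
          refine ⟨p, q + -k, hp, ?_, h, hh⟩
          change |q + -k + (L.coeff r'.tailIdx : ℝ) * fScaled f ε p - r'.tailPar| ≤ ε
          convert hk using 2
          ring
      | succ l =>
        obtain ⟨g1, g2⟩ := h1 l (by simpa using hl)
        exact ⟨(he.trans hee).trans g1, g2⟩
    · intro l hl
      cases l with
      | zero => exact (h1 0 (by simpa using hl)).1
      | succ l => exact h2 l (by simpa using hl)
    · intro s hs'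
      rcases lt_or_ge s e with hse | hse
      · simp only [hout s ⟨hs'.1, hse⟩, false_iff]
        rintro ⟨l, hl, hl'⟩
        cases l with
        | zero => exact absurd hse (not_lt.2 hl'.1)
        | succ l =>
          have := (h1 l (by simpa using hl)).1
          have := hl'.1
          simp only at this
          linarith
      rcases le_or_gt s e' with hse' | hse'
      · refine ⟨fun _ => ⟨0, by simp, hse, hse'⟩, fun _ => ⟨r.tipIdx, _, ?_, hin s ⟨hse, hse'⟩⟩⟩
        refine ⟨hp, ?_, ?_⟩
        · simp only; linarith
        · simp only; linarith
      · rw [h3 s ⟨hse', hs'.2⟩]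
        constructor
        · rintro ⟨l, hl, hl'⟩
          exact ⟨l + 1, by simpa using hl, hl'⟩
        · rintro ⟨l, hl, hl'⟩
          cases l with
          | zero => exact absurd hse' (not_lt.2 hl'.2)
          | succ l => exact ⟨l, by simpa using hl, hl'⟩

theorem Run.hasWord {ν : ℝ → ℝ} (hs : N.Small ε) (hf : IsTwistProfile f) {r : L.Chord}
    {w : List L.Chord} {M : ℝ → Matrix (Fin 2) (Fin 2) ℝ} (h : κ.Run ν 0 (r :: w) M)
    (hr : r.tailIdx = κ.startIdx)
    (hw : w = [] → (∃ k : ℤ, κ.startPar - k = r.tailPar) ∧ ∃ k : ℤ, κ.endPar - k = r.tipPar) :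
    κ.HasWord (r :: w) := by
  obtain ⟨enter, leave, h1, h2, h3⟩ := h.times
  refine ⟨enter, leave, h1, h2, fun t ht => ?_, ?_⟩
  · rcases ht.1.eq_or_lt with rfl | ht0
    · have := not_inHandle_start hs hf (κ := κ)
      simp only [InHandle] at this
      simp only [this, false_iff]
      rintro ⟨l, hl, hl'⟩
      exact absurd hl'.1 (not_le.2 (h1 l hl).1)
    · exact h3 t ⟨ht0, ht.2⟩
  · intro r' hr'
    simp only [List.cons.injEq] at hr'
    obtain ⟨rfl, rfl⟩ := hr'
    obtain ⟨⟨k, hk⟩, ⟨k', hk'⟩⟩ := hw rfl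
    obtain ⟨-, _, hlast⟩ := h.isWord_aux
    simp only [List.getLast_singleton] at hlast
    constructor
    · rw [SurgeryLink.Chord.tail, hr, ← hk, ← SurgeryLink.curve_add_int _ (κ.startPar - k) k, sub_add_cancel]
    · rw [SurgeryLink.Chord.tip, hlast, ← hk', ← SurgeryLink.curve_add_int _ (κ.endPar - k') k', sub_add_cancel]

/-! ### Uniqueness of the word -/

/-- A finite union of disjoint ordered closed intervals determines the intervals. -/
theorem intervals_aux {m m' : ℕ} {T : ℝ} {a b a' b' : ℕ → ℝ}
    (h1 : ∀ l < m, 0 < a l ∧ a l < b l ∧ b l < T) (h2 : ∀ l, l + 1 < m → b l < a (l + 1))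
    (h1' : ∀ l < m', 0 < a' l ∧ a' l < b' l ∧ b' l < T)
    (h2' : ∀ l, l + 1 < m' → b' l < a' (l + 1))
    (h : ∀ t ∈ Icc 0 T, (∃ l < m, t ∈ Icc (a l) (b l)) ↔ ∃ l < m', t ∈ Icc (a' l) (b' l)) :
    ∀ l < m, l < m' ∧ a l = a' l ∧ b l = b' l := by
  have ord : ∀ {m : ℕ} {a b : ℕ → ℝ}, (∀ l < m, 0 < a l ∧ a l < b l ∧ b l < T) →
      (∀ l, l + 1 < m → b l < a (l + 1)) → ∀ k l, k < l → l < m → b k < a l := by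
    intro m a b h1 h2 k l hkl hl
    induction l, hkl using Nat.le_induction with
    | base => exact h2 k hl
    | succ l hkl ih =>
      have := ih (by omega)
      have := (h1 l (by omega)).2.1
      have := h2 l hl
      linarith
  -- The left end a l lies in some interval of the second family. That interval has index at least
  -- l, as the earlier ones agree with intervals already passed; hence a' l ≤ a l. Symmetry gives
  -- equality.
  have half : ∀ {m m' : ℕ} {a b a' b' : ℕ → ℝ}, (∀ l < m, 0 < a l ∧ a l < b l ∧ b l < T) →
      (∀ l, l + 1 < m → b l < a (l + 1)) → (∀ l < m', 0 < a' l ∧ a' l < b' l ∧ b' l < T) →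
      (∀ l, l + 1 < m' → b' l < a' (l + 1)) →
      (∀ t ∈ Icc 0 T, (∃ l < m, t ∈ Icc (a l) (b l)) ↔ ∃ l < m', t ∈ Icc (a' l) (b' l)) →
      ∀ l < m, (∀ k < l, k < m' ∧ a k = a' k ∧ b k = b' k) → l < m' ∧ a' l ≤ a l := by
    intro m m' a b a' b' h1 h2 h1' h2' h l hl hk
    obtain ⟨g1, g2, g3⟩ := h1 l hl
    obtain ⟨k, hkm, hk1, hk2⟩ := (h (a l) ⟨g1.le, (g2.trans g3).le⟩).1 ⟨l, hl, le_rfl, g2.le⟩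
    have hlk : l ≤ k := by
      by_contra! hlt
      have h3 := ord h1 h2 k l hlt hl
      rw [(hk k hlt).2.2] at h3
      linarith
    refine ⟨hlk.trans_lt hkm, ?_⟩
    rcases hlk.eq_or_lt with rfl | hlt
    · exact hk1
    · have h3 := ord h1' h2' l k hlt hkm
      have h4 := (h1' l (hlt.trans hkm)).2.1
      linarith
  -- If b l exceeded b' l, a time just after b' l would be covered by the first family but fall into
  -- a gap of the second.
  have right : ∀ {m m' : ℕ} {a b a' b' : ℕ → ℝ}, (∀ l < m, 0 < a l ∧ a l < b l ∧ b l < T) →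
      (∀ l, l + 1 < m → b l < a (l + 1)) → (∀ l < m', 0 < a' l ∧ a' l < b' l ∧ b' l < T) →
      (∀ l, l + 1 < m' → b' l < a' (l + 1)) →
      (∀ t ∈ Icc 0 T, (∃ l < m, t ∈ Icc (a l) (b l)) ↔ ∃ l < m', t ∈ Icc (a' l) (b' l)) →
      ∀ l < m, l < m' → a l = a' l → b l ≤ b' l := by
    intro m m' a b a' b' h1 h2 h1' h2' h l hl hl' ha
    by_contra! hlt
    obtain ⟨g1, g2, g3⟩ := h1 l hl
    obtain ⟨g1', g2', g3'⟩ := h1' l hl'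
    have hex : ∃ t, b' l < t ∧ t < b l ∧ ∀ k < m', t ∉ Icc (a' k) (b' k) := by
      by_cases hl1 : l + 1 < m'
      · obtain ⟨t, ht1, ht2⟩ := exists_between (lt_min hlt (h2' l hl1))
        refine ⟨t, ht1, ht2.trans_le (min_le_left _ _), fun k hk hkt => ?_⟩
        have hta := ht2.trans_le (min_le_right _ _)
        rcases lt_trichotomy k l with hkl | rfl | hkl
        · linarith [ord h1' h2' k l hkl hl', hkt.2]
        · linarith [hkt.2]
        · rcases (Nat.succ_le_of_lt hkl).eq_or_lt with rfl | hkl'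
          · linarith [hkt.1]
          · have h5 := ord h1' h2' (l + 1) k hkl' hk
            have h6 := (h1' (l + 1) hl1).2.1
            linarith [hkt.1]
      · obtain ⟨t, ht1, ht2⟩ := exists_between hlt
        refine ⟨t, ht1, ht2, fun k hk hkt => ?_⟩
        rcases lt_trichotomy k l with hkl | rfl | hkl
        · linarith [ord h1' h2' k l hkl hl', hkt.2]
        · linarith [hkt.2]
        · omega
    obtain ⟨t, ht1, ht2, ht3⟩ := hex
    obtain ⟨k, hk, hk'⟩ := (h t ⟨by linarith, by linarith⟩).1 ⟨l, hl, by linarith, ht2.le⟩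
    exact ht3 k hk hk'
  have h' := fun t ht => (h t ht).symm
  intro l
  induction l using Nat.strong_induction_on with
  | _ l ih =>
    intro hl
    have hk : ∀ k < l, k < m' ∧ a k = a' k ∧ b k = b' k := fun k hkl => ih k hkl (hkl.trans hl)
    obtain ⟨hl', hle⟩ := half h1 h2 h1' h2' h l hl hk
    obtain ⟨-, hle'⟩ := half h1' h2' h1 h2 h' l hl'
      (fun k hkl => ⟨hkl.trans hl, (hk k hkl).2.1.symm, (hk k hkl).2.2.symm⟩)
    have ha := le_antisymm hle' hle
    exact ⟨hl', ha, le_antisymm (right h1 h2 h1' h2' h l hl hl' ha)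
      (right h1' h2' h1 h2 h' l hl' hl ha.symm)⟩

/-- A common point puts the two tips within 2ε of each other modulo 1 on the same component, where
`Small.tip_unique` leaves only one chord. -/
theorem entry_unique (hs : N.Small ε) (hf : IsTwistProfile f) {m : N.Surgered ε f}
    {r r' : L.Chord} (h : m ∈ N.entrySquare ε f r) (h' : m ∈ N.entrySquare ε f r') : r = r' := by
  obtain ⟨p, q, hp, hq, hm⟩ := h
  obtain ⟨p', q', hp', hq', hm'⟩ := h'
  have htop := top_pos hf hs.pos (L.coeff r.tipIdx) p
  have hu : ((-ε, p, q) : R3) ∈ handle L ε f r.tipIdx :=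
    ⟨hp, le_rfl, by simp only; linarith [hs.pos]⟩
  obtain ⟨h1, k, hk⟩ := At.handle_unique hs hf (u := (-ε, p, q)) (v := (-ε, p', q')) hm hu hm'
  simp only [Prod.mk_add_mk, add_zero, Prod.mk.injEq] at hk
  refine hs.tip_unique r r' h1 (-k) ?_
  have h2 := abs_le.1 hq
  have h3 := abs_le.1 hq'
  push_cast
  exact abs_le.2 ⟨by linarith [hk.2.2], by linarith [hk.2.2]⟩

theorem exit_unique (hs : N.Small ε) (hf : IsTwistProfile f) {m : N.Surgered ε f}
    {r r' : L.Chord} (h : m ∈ N.exitSquare ε f r) (h' : m ∈ N.exitSquare ε f r') : r = r' := by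
  obtain ⟨p, q, hp, hq, hm⟩ := h
  obtain ⟨p', q', hp', hq', hm'⟩ := h'
  have htop := top_pos hf hs.pos (L.coeff r.tailIdx) p
  have hu : ((ε + (L.coeff r.tailIdx : ℝ) * HFun f ε p, p, q) : R3) ∈ handle L ε f r.tailIdx :=
    ⟨hp, by simp only; linarith [hs.pos], le_rfl⟩
  obtain ⟨h1, k, hk⟩ := At.handle_unique hs hf
    (u := (ε + (L.coeff r.tailIdx : ℝ) * HFun f ε p, p, q))
    (v := (ε + (L.coeff r'.tailIdx : ℝ) * HFun f ε p', p', q')) hm hu hm'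
  simp only [Prod.mk_add_mk, add_zero, Prod.mk.injEq] at hk
  refine hs.tail_unique r r' h1 (-k) ?_
  obtain ⟨-, rfl, rfl⟩ := hk
  rw [← h1] at hq'
  have h2 := abs_le.1 hq
  have h3 := abs_le.1 hq'
  push_cast
  exact abs_le.2 ⟨by linarith, by linarith⟩

/-- The set of handle times determines the entry and exit times. The first letter is then read off
the first entry square, every later letter off an exit square, and a single letter off the starting
point of the chord. -/
theorem word_unique (hs : N.Small ε) (hf : IsTwistProfile f) {w w' : List L.Chord}
    (h : L.IsWord w) (h' : L.IsWord w') (hw : κ.HasWord w) (hw' : κ.HasWord w') : w = w' := by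
  obtain ⟨a, b, h1, h2, h3, h4⟩ := hw
  obtain ⟨a', b', h1', h2', h3', h4'⟩ := hw'
  obtain ⟨-, hne, -, -⟩ := h
  obtain ⟨-, hne', -, -⟩ := h'
  have hpos := List.length_pos_iff.2 hne
  have hpos' := List.length_pos_iff.2 hne'
  have g1 : ∀ l < w.length - 1, 0 < a l ∧ a l < b l ∧ b l < κ.T := fun l hl => by
    obtain ⟨i1, i2, i3, -⟩ := h1 l (by omega)
    exact ⟨i1, i2, i3⟩
  have g1' : ∀ l < w'.length - 1, 0 < a' l ∧ a' l < b' l ∧ b' l < κ.T := fun l hl => by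
    obtain ⟨i1, i2, i3, -⟩ := h1' l (by omega)
    exact ⟨i1, i2, i3⟩
  have g2 : ∀ l, l + 1 < w.length - 1 → b l < a (l + 1) := fun l hl => h2 l (by omega)
  have g2' : ∀ l, l + 1 < w'.length - 1 → b' l < a' (l + 1) := fun l hl => h2' l (by omega)
  have g3 : ∀ t ∈ Icc 0 κ.T, (∃ l < w.length - 1, t ∈ Icc (a l) (b l)) ↔
      ∃ l < w'.length - 1, t ∈ Icc (a' l) (b' l) := by
    intro t ht
    have e1 := h3 t ht
    have e2 := h3' t ht
    simp only [← Nat.lt_sub_iff_add_lt] at e1 e2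
    rw [← e1, ← e2]
  have A := intervals_aux g1 g2 g1' g2' g3
  have A' := intervals_aux g1' g2' g1 g2 fun t ht => (g3 t ht).symm
  have hlen : w.length = w'.length := by
    rcases lt_trichotomy w.length w'.length with hlt | heq | hlt
    · have := (A' (w.length - 1) (by omega)).1
      omega
    · exact heq
    · have := (A (w'.length - 1) (by omega)).1
      omega
  rcases Nat.lt_or_ge 1 w.length with hlt | hle
  · refine List.ext_getElem hlen fun l hl hl' => ?_
    cases l with
    | zero =>
      have e1 := (h1 0 (by omega)).2.2.2.1
      have e2 := (h1' 0 (by omega)).2.2.2.1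
      rw [← (A 0 (by omega)).2.1] at e2
      exact entry_unique hs hf e1 e2
    | succ l =>
      have e1 := (h1 l (by omega)).2.2.2.2
      have e2 := (h1' l (by omega)).2.2.2.2
      rw [← (A l (by omega)).2.2] at e2
      exact exit_unique hs hf e1 e2
  · obtain ⟨r, rfl⟩ := List.length_eq_one_iff.1 (show w.length = 1 by omega)
    obtain ⟨r', rfl⟩ := List.length_eq_one_iff.1 (show w'.length = 1 by omega)
    obtain ⟨i1, i2⟩ := h4 r rfl
    obtain ⟨i1', i2'⟩ := h4' r' rfl
    obtain ⟨j1, k1, j2⟩ := L.embedded _ _ _ _ (i1.symm.trans i1')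
    have e1 := hs.tail_unique r r' j1 (-k1) (by
      rw [j2]
      push_cast
      have : r.tailPar - (r.tailPar + k1) - -(k1 : ℝ) = 0 := by ring
      rw [this, abs_zero]
      linarith [hs.pos])
    rw [e1]

end ReebChord

end StandardNeighborhood

/-! ### The linearised flow in the framing -/

namespace StandardNeighborhood

variable {ι : Type*} {L : SurgeryLink ι} {ε₀ : ℝ} {N : StandardNeighborhood L ε₀}
  {ε : ℝ} {f : ℝ → ℝ}

/-- A passage meets exactly the condition in `IsAdapted`, so p lies where f has slope one. In
particular f_ε' does not vanish at p, which keeps p away from the strip where the framing is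
arbitrary. -/
theorem adapted_pass (hs : N.Small ε) (hf : IsTwistProfile f) (ha : IsAdapted L ε f)
    (F : N.Framing ε f) {r r' : L.Chord} {p q : ℝ}
    (hidx : r.tipIdx = r'.tailIdx) (hc : L.coeff r.tipIdx ≠ 0) (hp : |p| ≤ ε)
    (hq : |q - r.tipPar| ≤ ε)
    (hq' : ∃ k : ℤ, |q + (L.coeff r.tipIdx : ℝ) * fScaled f ε p - r'.tailPar - k| ≤ ε) :
    deriv (fScaled f ε) p = 1 / ε ∧ (L.coeff r.tipIdx : ℝ) * p < ε - F.δ := by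
  have hpos := hs.pos
  obtain ⟨ρ, hρ, h⟩ := ha
  have hpρ := h r r' hidx hc p q hp hq hq'
  have h1 : deriv (fScaled f ε) p = 1 / ε := by
    rw [hf.deriv_fScaled, hρ]
    rw [abs_div, abs_of_pos hpos, div_le_iff₀ hpos]
    exact hpρ
  refine ⟨h1, ?_⟩
  by_contra! hle
  have h2 : ε - F.δ ≤ |p| := by
    refine hle.trans ?_
    rcases coeff_cases hc with ⟨-, h⟩ | ⟨-, h⟩ <;> rw [h]
    · rw [one_mul]; exact le_abs_self p
    · rw [neg_one_mul]; exact neg_le_abs p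
  have h3 := F.δ_strip p h2
  rw [h1] at h3
  have : 0 < 1 / ε := by positivity
  linarith

/-- Together with `passFrame_of_ge`: the matrix of a passage is constant before entry and after
exit. This is why the matrices of a run can be defined for all times as products. -/
theorem passFrame_of_nonpos (hs : N.Small ε) (hf : IsTwistProfile f) (F : N.Framing ε f) {i : ι}
    (hc : L.coeff i ≠ 0) {p : ℝ} (q : ℝ) (hp : |p| ≤ ε) {s : ℝ} (h : s ≤ 0) :
    N.passFrame ε f F.ν i p q s = 1 := by
  rw [passFrame, handleFrame_bottom hs hf F hc hp (by linarith),
    handleFrame_bottom hs hf F hc hp le_rfl,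
    Matrix.mul_nonsing_inv _ (by simp [N.det_basisChange q (hp.trans_lt hs.lt)])]

theorem passFrame_of_ge (hs : N.Small ε) (hf : IsTwistProfile f) (F : N.Framing ε f) {i : ι}
    (hc : L.coeff i ≠ 0) {p : ℝ} (q : ℝ) {s : ℝ}
    (h : 2 * ε + (L.coeff i : ℝ) * HFun f ε p ≤ s) :
    N.passFrame ε f F.ν i p q s
      = N.passFrame ε f F.ν i p q (2 * ε + (L.coeff i : ℝ) * HFun f ε p) := by
  rw [passFrame, passFrame, handleFrame_top hf hs.pos F hc (z := -ε + s) (by linarith),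
    handleFrame_top hf hs.pos F hc
      (z := -ε + (2 * ε + (L.coeff i : ℝ) * HFun f ε p)) (by linarith)]

theorem det_passFrame (hs : N.Small ε) {ν : ℝ → ℝ} {i : ι} {p q s : ℝ} (hp : |p| ≤ ε) :
    (N.passFrame ε f ν i p q s).det = 1 := by
  have hp' := hp.trans_lt hs.lt
  have h1 := det_handleFrame (N := N) (ε := ε) (f := f) (ν := ν) (i := i) (u := (-ε + s, p, q)) hp'
  have h2 := det_handleFrame (N := N) (ε := ε) (f := f) (ν := ν) (i := i) (u := (-ε, p, q)) hp'
  rw [passFrame, Matrix.det_mul, Matrix.det_nonsing_inv, h1, h2]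
  simp

theorem continuous_basisChange_comp {i : ι} {p : ℝ} (hp : |p| < ε₀) {g : ℝ → ℝ}
    (hg : Continuous g) : Continuous fun s => N.basisChange i p (g s) := by
  refine continuous_matrix fun a b => continuous_iff_continuousAt.2 fun s => ?_
  exact ContinuousAt.comp (g := fun v : ℝ × ℝ => N.basisChange i v.1 v.2 a b)
    (f := fun s => (p, g s)) (N.continuousAt_basisChange (by exact hp) a b) (by fun_prop)

theorem continuous_handleFrame (hs : N.Small ε) (hf : IsTwistProfile f) (F : N.Framing ε f)
    {i : ι} {p q : ℝ} (hp : |p| ≤ ε) :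
    Continuous fun s => N.handleFrame ε f F.ν i (s, p, q) := by
  have h1 : Continuous F.ν := F.ν_smooth.continuous
  have h2 : Continuous (fScaled f ε) :=
    continuous_iff_continuousAt.2 fun p => (hf.hasDerivAt_fScaled ε p).continuousAt
  have h3 := hf.continuous_deriv_fScaled ε
  simp only [handleFrame]
  refine Continuous.matrix_mul (continuous_basisChange_comp (hp.trans_lt hs.lt) (by fun_prop)) ?_
  refine continuous_matrix fun a b => ?_
  fin_cases a <;> fin_cases b <;> simp [shear] <;> fun_prop

theorem continuous_act {M : ℝ → Matrix (Fin 2) (Fin 2) ℝ} (h : Continuous M) (v : ℝ × ℝ) :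
    Continuous fun s => act (M s) v := by
  have h' : ∀ a b, Continuous fun s => M s a b := fun a b => h.matrix_elem a b
  have h1 := h' 0 0
  have h2 := h' 0 1
  have h3 := h' 1 0
  have h4 := h' 1 1
  simp only [act]
  fun_prop

theorem fderiv_reebField (a : Option ι) (u : R3) : fderiv ℝ (reebField a) u = 0 := by
  rw [reebField_eq]
  exact (hasFDerivAt_const _ u).fderiv

namespace ReebChord

variable {κ : N.ReebChord ε f}

/-- The condition defining `IsFlowInvariant`, at one time. -/
def LocallyInvariant (κ : N.ReebChord ε f) (F : N.Framing ε f) (v : ℝ → ℝ × ℝ) (t : ℝ) : Prop :=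
  ∃ (a : Option ι) (u w : ℝ → R3), ∀ᶠ s in 𝓝[Icc 0 κ.T] t,
    (∃ h : u s ∈ N.piece ε f a, κ.path s = N.pt ε f a (u s) h) ∧
    HasDerivWithinAt u (reebField a (u s)) (Icc 0 κ.T) s ∧
    HasDerivWithinAt w (fderiv ℝ (reebField a) (u s) (w s)) (Icc 0 κ.T) s ∧
    contactForm a (u s) (w s) = 0 ∧
    F.HasCoords a (u s) (w s) (v s)

theorem LocallyInvariant.congr {F : N.Framing ε f} {v v' : ℝ → ℝ × ℝ} {t : ℝ}
    (h : κ.LocallyInvariant F v t) (he : ∀ᶠ s in 𝓝[Icc 0 κ.T] t, v' s = v s) :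
    κ.LocallyInvariant F v' t := by
  obtain ⟨a, u, w, h⟩ := h
  refine ⟨a, u, w, ?_⟩
  filter_upwards [h, he] with s hs hs'
  rw [hs']
  exact hs

/-- The Reeb field has constant coefficients in every chart, so the variational equation is w' = 0
and w can be frozen. -/
theorem LocallyInvariant.exists_chart {F : N.Framing ε f} {v : ℝ → ℝ × ℝ} {t : ℝ}
    (ht : t ∈ Icc 0 κ.T) (h : κ.LocallyInvariant F v t) :
    ∃ (a : Option ι) (u w : R3), ∀ᶠ s in 𝓝[Icc 0 κ.T] t,
      N.At a (u + (s - t) • reebDir a) (κ.path s) ∧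
      contactForm a (u + (s - t) • reebDir a) w = 0 ∧
      F.HasCoords a (u + (s - t) • reebDir a) w (v s) := by
  obtain ⟨a, u, w, h⟩ := h
  refine ⟨a, u t, w t, ?_⟩
  have h1 := h.mono fun s hs => hs.2.1
  have h2 := h.mono fun s hs => hs.2.2.1
  rw [reebField_eq] at h1
  simp only [fderiv_reebField, zero_apply] at h2
  filter_upwards [h, eventually_affine (convex_Icc _ _) ht h1,
    eventually_affine (convex_Icc _ _) ht h2] with s hs hs1 hs2
  rw [smul_zero, add_zero] at hs2
  rw [← hs1, ← hs2]
  exact ⟨hs.1, hs.2.2.2⟩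

theorem eventually_const_of_outside (hs : N.Small ε) (hf : IsTwistProfile f) {F : N.Framing ε f}
    {v : ℝ → ℝ × ℝ} {t : ℝ} (ht : t ∈ Icc 0 κ.T) (h : κ.LocallyInvariant F v t)
    (hout : ¬ N.InHandle (κ.path t)) : ∀ᶠ s in 𝓝[Icc 0 κ.T] t, v s = v t := by
  obtain ⟨a, u, w, h⟩ := h.exists_chart ht
  have h0 := h.self_of_nhdsWithin ht
  rw [sub_self, zero_smul, add_zero] at h0
  cases a with
  | none =>
    have e0 := ((hasCoords_none_iff F h0.1.1 _ _).1 h0.2.2).2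
    filter_upwards [h] with s hs'
    rw [((hasCoords_none_iff F hs'.1.1 _ _).1 hs'.2.2).2, e0]
  | some i =>
    have hu : u ∉ handle L ε f i := fun hm => hout ⟨i, u, hm, h0.1⟩
    have e0 := ((hasCoords_outside_iff hs hf F h0.1.1 hu _ _).1 h0.2.2).2
    have hc : Tendsto (fun s : ℝ => u + (s - t) • ((1, 0, 0) : R3)) (𝓝[Icc 0 κ.T] t) (𝓝 u) :=
      (Continuous.tendsto' (by fun_prop) _ _ (by simp)).mono_left nhdsWithin_le_nhds
    filter_upwards [h, hc.eventually ((isClosed_handle hf hs.pos i).isOpen_compl.mem_nhds hu),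
      (tendsto_sub_nhdsWithin (I := Icc 0 κ.T) t).eventually
        (outFrame_flow (N := N) hf hs.pos hu)] with s h1 h2 h3
    rw [((hasCoords_outside_iff hs hf F h1.1.1 h2 _ _).1 h1.2.2).2, e0, ← h3]
    rfl

/-- In handle coordinates the field is constant; all change of its framing coordinates comes from
the frame. -/
theorem eventually_of_inside (hs : N.Small ε) (hf : IsTwistProfile f) {F : N.Framing ε f}
    {v : ℝ → ℝ × ℝ} {t : ℝ} (ht : t ∈ Icc 0 κ.T) (h : κ.LocallyInvariant F v t) {i : ι}
    {u : R3} (hu : u ∈ handle L ε f i) (hδ : (L.coeff i : ℝ) * u.2.1 < ε - F.δ)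
    (hat : N.At (some i) u (κ.path t)) : ∃ W, ∀ᶠ s in 𝓝[Icc 0 κ.T] t,
      v s = act (N.handleFrame ε f F.ν i (u + (s - t) • ((1, 0, 0) : R3))) W := by
  obtain ⟨a, u', w, h⟩ := h.exists_chart ht
  have h0 := h.self_of_nhdsWithin ht
  rw [sub_self, zero_smul, add_zero] at h0
  cases a with
  | none => exact absurd h0.1 (hat.not_none hs hf hu)
  | some j =>
    obtain ⟨rfl, k, rfl⟩ := hat.handle_unique hs hf hu h0.1
    refine ⟨w.2, ?_⟩
    filter_upwards [h] with s hs'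
    have e2 : (u + (0, 0, (k : ℝ)) + (s - t) • reebDir (some i)).2.1 = u.2.1 := by
      simp [reebDir]
    have e3 : u + (0, 0, (k : ℝ)) + (s - t) • reebDir (some i)
        = u + (s - t) • ((1, 0, 0) : R3) + (0, 0, (k : ℝ)) := by
      simp only [reebDir]
      abel
    rw [((hasCoords_handle_iff hs hf F hs'.1.1 (by rw [e2]; exact hu.1) (by rw [e2]; exact hδ)
      _ _).1 hs'.2.2).2, e3, handleFrame_add_int]
    have : |u.2.1| < ε₀ := lt_of_le_of_lt hu.1 hs.lt
    simpa using this

theorem locallyInvariant_outside (hs : N.Small ε) (hf : IsTwistProfile f) (F : N.Framing ε f)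
    (v : ℝ × ℝ) {t : ℝ} (ht : t ∈ Icc 0 κ.T) (hout : ¬ N.InHandle (κ.path t)) :
    κ.LocallyInvariant F (fun _ => v) t := by
  obtain ⟨x, hx⟩ := (not_inHandle_iff hs hf).1 hout
  refine ⟨none, fun s => x + (s - t) • ((0, 0, 1) : R3), fun _ => (v.1, v.2, x.2.1 * v.1), ?_⟩
  filter_upwards [flow_none hs hf ht hx] with s hs'
  have hα : alphaStd (x + (s - t) • ((0, 0, 1) : R3)) (v.1, v.2, x.2.1 * v.1) = 0 := by
    simp [alphaStd]
  refine ⟨hs', ?_, ?_, hα, (hasCoords_none_iff F hs'.1 _ _).2 ⟨hα, rfl⟩⟩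
  · have := (((hasDerivWithinAt_id s (Icc 0 κ.T)).sub_const t).smul_const
      ((0, 0, 1) : R3)).const_add x
    rw [one_smul] at this
    exact this
  · rw [fderiv_reebField]
    exact hasDerivWithinAt_const _ _ _

theorem locallyInvariant_inside (hs : N.Small ε) (hf : IsTwistProfile f) (F : N.Framing ε f)
    (W : ℝ × ℝ) {t : ℝ} (ht : t ∈ Icc 0 κ.T) {i : ι}
    {u : R3} (hu : u ∈ handle L ε f i) (hδ : (L.coeff i : ℝ) * u.2.1 < ε - F.δ)
    (hat : N.At (some i) u (κ.path t)) : κ.LocallyInvariant F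
      (fun s => act (N.handleFrame ε f F.ν i (u + (s - t) • ((1, 0, 0) : R3))) W) t := by
  refine ⟨some i, fun s => u + (s - t) • ((1, 0, 0) : R3), fun _ => (-u.2.1 * W.2, W), ?_⟩
  filter_upwards [flow_handle hs hf ht hu hat] with s hs'
  have hα : alphaTube (u + (s - t) • ((1, 0, 0) : R3)) (-u.2.1 * W.2, W) = 0 := by
    simp [alphaTube]
  have e2 : (u + (s - t) • ((1, 0, 0) : R3)).2.1 = u.2.1 := by simp
  refine ⟨hs', ?_, ?_, hα, (hasCoords_handle_iff hs hf F hs'.1 (by rw [e2]; exact hu.1)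
    (by rw [e2]; exact hδ) _ _).2 ⟨hα, rfl⟩⟩
  · have := (((hasDerivWithinAt_id s (Icc 0 κ.T)).sub_const t).smul_const
      ((1, 0, 0) : R3)).const_add u
    rw [one_smul] at this
    exact this
  · rw [fderiv_reebField]
    exact hasDerivWithinAt_const _ _ _

/-! ### The linearised flow along a run -/

variable {F : N.Framing ε f}

theorem Run.nonneg_lt {ν : ℝ → ℝ} {t : ℝ} {w : List L.Chord}
    {M : ℝ → Matrix (Fin 2) (Fin 2) ℝ} (h : κ.Run ν t w M) : 0 ≤ t ∧ t < κ.T := by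
  cases h with
  | last _ r h0 hT => exact ⟨h0, hT⟩
  | step _ e e' p q r r' w M h0 he hee hT => exact ⟨h0, he.trans (hee.trans hT)⟩

/-- The margin τ − t makes the matrices of a remaining run trivial throughout the passage before it
and for a short time after the exit. -/
theorem Run.eq_one (hs : N.Small ε) (hf : IsTwistProfile f) {t : ℝ} {w : List L.Chord}
    {M : ℝ → Matrix (Fin 2) (Fin 2) ℝ} (h : κ.Run F.ν t w M) : ∃ τ > t, ∀ s ≤ τ, M s = 1 := by
  induction h with
  | last t r h0 hT hout hidx htip => exact ⟨t + 1, by linarith, fun _ _ => rfl⟩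
  | step t e e' p q r r' w M h0 he hee hT hidx hc hp hq hq' hlen hout hin hrun ih =>
    obtain ⟨τ, hτ, h1⟩ := ih
    refine ⟨e, he, fun s hse => ?_⟩
    beta_reduce
    rw [h1 s (by linarith), passFrame_of_nonpos hs hf F hc q hp (by linarith), one_mul]

theorem Run.det (hs : N.Small ε) {ν : ℝ → ℝ} {t : ℝ} {w : List L.Chord}
    {M : ℝ → Matrix (Fin 2) (Fin 2) ℝ} (h : κ.Run ν t w M) (s : ℝ) : (M s).det = 1 := by
  induction h with
  | last t r h0 hT hout hidx htip => simp
  | step t e e' p q r r' w M h0 he hee hT hidx hc hp hq hq' hlen hout hin hrun ih =>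
    rw [Matrix.det_mul, ih, det_passFrame hs hp, one_mul]

theorem Run.continuous (hs : N.Small ε) (hf : IsTwistProfile f) {t : ℝ} {w : List L.Chord}
    {M : ℝ → Matrix (Fin 2) (Fin 2) ℝ} (h : κ.Run F.ν t w M) : Continuous M := by
  induction h with
  | last t r h0 hT hout hidx htip => exact continuous_const
  | step t e e' p q r r' w M h0 he hee hT hidx hc hp hq hq' hlen hout hin hrun ih =>
    refine ih.matrix_mul ?_
    have h1 : Continuous fun s : ℝ => -ε + (s - e) := by fun_prop
    exact ((continuous_handleFrame hs hf F hp).comp h1).matrix_mul continuous_const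

theorem mem_handle_of_pass (hs : N.Small ε) {i : ι} {p q e e' : ℝ} (hp : |p| ≤ ε)
    (hlen : e' = e + 2 * ε + (L.coeff i : ℝ) * HFun f ε p) {s : ℝ} (h : s ∈ Icc e e') :
    ((-ε + (s - e), p, q) : R3) ∈ handle L ε f i := by
  have := hs.pos
  refine ⟨hp, ?_, ?_⟩
  · simp only; linarith [h.1]
  · simp only; linarith [h.2]

/-- Off the handles v is constant; in a handle the inverse frame applied to v is constant. The
hypothesis of constancy just after t is needed because, after a passage, the path at time t still
lies on the handle. -/
theorem Run.flow_eq (hs : N.Small ε) (hf : IsTwistProfile f) (ha : IsAdapted L ε f)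
    {v : ℝ → ℝ × ℝ} (hv : κ.IsFlowInvariant F v) {t : ℝ} {w : List L.Chord}
    {M : ℝ → Matrix (Fin 2) (Fin 2) ℝ} (h : κ.Run F.ν t w M)
    (hvt : ∀ᶠ s in 𝓝[>] t, v s = v t) : ∀ s ∈ Icc t κ.T, v s = act (M s) (v t) := by
  have hv : ∀ t ∈ Icc 0 κ.T, κ.LocallyInvariant F v t := hv
  have hconst : ∀ S ⊆ Icc 0 κ.T, IsPreconnected S → (∀ s ∈ S, ¬ N.InHandle (κ.path s)) →
      ∀ s ∈ S, ∀ s' ∈ S, v s = v s' := by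
    intro S hS hc hout s hsS s' hs'
    refine hc.induction₂ (fun a b => v a = v b) ?_ (fun _ _ _ _ _ _ h1 h2 => h1.trans h2)
      (fun _ _ _ _ h => h.symm) hsS hs'
    intro a ha
    filter_upwards [nhdsWithin_mono a hS (eventually_const_of_outside hs hf (hS ha) (hv a (hS ha))
      (hout a ha))] with b hb
    exact hb.symm
  induction h with
  | last t r h0 hT hout hidx htip =>
    intro s hs'
    rw [act_one]
    rcases hs'.1.eq_or_lt with rfl | hlt
    · rfl
    obtain ⟨s₀, h1, h2⟩ := (hvt.and (Ioc_mem_nhdsGT hT)).exists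
    rw [← h1]
    exact hconst _ (fun s hs' => ⟨h0.trans hs'.1.le, hs'.2⟩) isPreconnected_Ioc hout s
      ⟨hlt, hs'.2⟩ s₀ h2
  | step t e e' p q r r' w M h0 he hee hT hidx hc hp hq hq' hlen hout hin hrun ih =>
    obtain ⟨-, hδ⟩ := adapted_pass hs hf ha F hidx hc hp hq hq'
    have hp' : |p| < ε₀ := hp.trans_lt hs.lt
    have hI : Icc e e' ⊆ Icc 0 κ.T := Icc_subset_Icc (h0.trans he.le) hT.le
    set Hf := fun s : ℝ => N.handleFrame ε f F.ν r.tipIdx (-ε + (s - e), p, q) with hHf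
    have hdet : ∀ s, (Hf s).det = 1 := fun s => det_handleFrame hp'
    have hloc : ∀ a ∈ Icc e e', ∃ W, ∀ᶠ s in 𝓝[Icc 0 κ.T] a, v s = act (Hf s) W := by
      intro a ha
      obtain ⟨W, hW⟩ := eventually_of_inside hs hf (hI ha) (hv a (hI ha))
        (mem_handle_of_pass hs (q := q) hp hlen ha) hδ (hin a ha)
      refine ⟨W, ?_⟩
      filter_upwards [hW] with s hs'
      rw [hs', hHf]
      congr 2
      simp only [Prod.smul_mk, smul_eq_mul, mul_one, mul_zero, Prod.mk_add_mk, add_zero]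
      congr 1
      ring
    have hpass : ∀ a ∈ Icc e e', act (Hf a)⁻¹ (v a) = act (Hf e)⁻¹ (v e) := by
      intro a ha
      refine isPreconnected_Icc.induction₂ (s := Icc e e')
        (fun a b => act (Hf a)⁻¹ (v a) = act (Hf b)⁻¹ (v b)) ?_
        (fun _ _ _ _ _ _ h1 h2 => h1.trans h2) (fun _ _ _ _ h => h.symm) ha ⟨le_rfl, hee.le⟩
      intro a ha
      obtain ⟨W, hW⟩ := hloc a ha
      have h1 := hW.self_of_nhdsWithin (hI ha)
      filter_upwards [nhdsWithin_mono a hI hW] with b hb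
      rw [h1, hb, act_inv_act (hdet a), act_inv_act (hdet b)]
    -- No continuity of v is assumed. The inside formula is valid slightly before e as well, where
    -- the frame already has its value at the bottom.
    have hve : v e = v t := by
      obtain ⟨W, hW⟩ := hloc e ⟨le_rfl, hee.le⟩
      have h1 := hW.self_of_nhdsWithin (hI ⟨le_rfl, hee.le⟩)
      have hle : 𝓝[<] e ≤ 𝓝[Icc 0 κ.T] e := by
        rw [← nhdsWithin_Ioo_eq_nhdsLT he]
        exact nhdsWithin_mono _ fun s hs' => ⟨h0.trans hs'.1.le, by linarith [hs'.2]⟩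
      obtain ⟨s₁, h2, h3⟩ := ((hW.filter_mono hle).and (Ioo_mem_nhdsLT he)).exists
      obtain ⟨s₀, h4, h5⟩ := (hvt.and (Ioo_mem_nhdsGT he)).exists
      have h6 : Hf s₁ = Hf e := by
        simp only [hHf]
        rw [handleFrame_bottom hs hf F hc hp (by linarith [h3.2]),
          handleFrame_bottom hs hf F hc hp (by linarith)]
      rw [h1, ← h6, ← h2, ← h4]
      exact hconst (Ioo t e) (fun s hs' => ⟨h0.trans hs'.1.le, by linarith [hs'.2]⟩)
        isPreconnected_Ioo hout _ h3 _ h5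
    have hvpass : ∀ a ∈ Icc e e', v a = act (N.passFrame ε f F.ν r.tipIdx p q (a - e)) (v t) := by
      intro a ha
      have := congrArg (act (Hf a)) (hpass a ha)
      rw [act_act_inv (hdet a), ← act_mul, hve] at this
      rw [this]
      simp [hHf, passFrame]
    have hright : ∀ᶠ s in 𝓝[>] e', v s = v e' := by
      obtain ⟨W, hW⟩ := hloc e' ⟨hee.le, le_rfl⟩
      have h1 := hW.self_of_nhdsWithin (hI ⟨hee.le, le_rfl⟩)
      have hle : 𝓝[>] e' ≤ 𝓝[Icc 0 κ.T] e' := by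
        rw [← nhdsWithin_Ioo_eq_nhdsGT hT]
        exact nhdsWithin_mono _ fun s hs' => ⟨by linarith [hs'.1], hs'.2.le⟩
      filter_upwards [hW.filter_mono hle, self_mem_nhdsWithin] with s h2 h3
      have h3 : e' < s := h3
      rw [h1, h2]
      simp only [hHf]
      rw [handleFrame_top hf hs.pos F hc (by linarith),
        handleFrame_top hf hs.pos F hc (by linarith)]
    obtain ⟨τ, hτ, hone⟩ := hrun.eq_one hs hf
    intro s hs'
    beta_reduce
    rcases le_or_gt s e with h1 | h1
    · rw [hone s (by linarith), passFrame_of_nonpos hs hf F hc q hp (by linarith), one_mul, act_one]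
      rcases h1.eq_or_lt with rfl | hlt
      · exact hve
      rcases hs'.1.eq_or_lt with rfl | hlt'
      · rfl
      obtain ⟨s₀, h4, h5⟩ := (hvt.and (Ioo_mem_nhdsGT he)).exists
      rw [← h4]
      exact hconst (Ioo t e) (fun s hs' => ⟨h0.trans hs'.1.le, by linarith [hs'.2]⟩)
        isPreconnected_Ioo hout _ ⟨hlt', hlt⟩ _ h5
    rcases le_or_gt s e' with h2 | h2
    · rw [hone s (by linarith), one_mul]
      exact hvpass s ⟨h1.le, h2⟩
    · rw [act_mul, passFrame_of_ge hs hf F hc q (by linarith)]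
      have h3 := hvpass e' ⟨hee.le, le_rfl⟩
      have h4 : e' - e = 2 * ε + (L.coeff r.tipIdx : ℝ) * HFun f ε p := by linarith
      rw [h4] at h3
      rw [← h3]
      exact ih hright s ⟨h2.le, hs'.2⟩

theorem Run.locallyInvariant (hs : N.Small ε) (hf : IsTwistProfile f) (ha : IsAdapted L ε f)
    {t : ℝ} {w : List L.Chord}
    {M : ℝ → Matrix (Fin 2) (Fin 2) ℝ} (h : κ.Run F.ν t w M) :
    ∀ v, ∀ s ∈ Ioc t κ.T, κ.LocallyInvariant F (fun s => act (M s) v) s := by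
  induction h with
  | last t r h0 hT hout hidx htip =>
    intro v s hs'
    refine (locallyInvariant_outside hs hf F v ⟨h0.trans hs'.1.le, hs'.2⟩ (hout s hs')).congr ?_
    simp
  | step t e e' p q r r' w M h0 he hee hT hidx hc hp hq hq' hlen hout hin hrun ih =>
    obtain ⟨-, hδ⟩ := adapted_pass hs hf ha F hidx hc hp hq hq'
    obtain ⟨τ, hτ, hone⟩ := hrun.eq_one hs hf
    intro v s hs'
    rcases lt_or_ge s e with h1 | h1
    · refine (locallyInvariant_outside hs hf F v ⟨h0.trans hs'.1.le, hs'.2⟩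
        (hout s ⟨hs'.1, h1⟩)).congr ?_
      filter_upwards [mem_nhdsWithin_of_mem_nhds (Iio_mem_nhds h1)] with b hb
      have hb : b < e := hb
      rw [hone b (by linarith), passFrame_of_nonpos hs hf F hc q hp (by linarith), one_mul, act_one]
    rcases le_or_gt s e' with h2 | h2
    · refine (locallyInvariant_inside hs hf F
        (act (N.handleFrame ε f F.ν r.tipIdx (-ε, p, q))⁻¹ v) ⟨h0.trans hs'.1.le, hs'.2⟩
        (mem_handle_of_pass hs (q := q) hp hlen ⟨h1, h2⟩) hδ (hin s ⟨h1, h2⟩)).congr ?_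
      filter_upwards [mem_nhdsWithin_of_mem_nhds (Iio_mem_nhds (h2.trans_lt hτ))] with b hb
      rw [hone b (le_of_lt hb), one_mul, passFrame, act_mul]
      congr 2
      simp only [Prod.smul_mk, smul_eq_mul, mul_one, mul_zero, Prod.mk_add_mk, add_zero]
      congr 1
      ring
    · refine (ih (act (N.passFrame ε f F.ν r.tipIdx p q
        (2 * ε + (L.coeff r.tipIdx : ℝ) * HFun f ε p)) v) s ⟨h2, hs'.2⟩).congr ?_
      filter_upwards [mem_nhdsWithin_of_mem_nhds (Ioi_mem_nhds h2)] with b hb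
      have hb : e' < b := hb
      rw [act_mul, passFrame_of_ge hs hf F hc q (by linarith)]

/-- The matrices of a run define fields along the chord invariant under the linearised flow. -/
theorem Run.isFlowInvariant (hs : N.Small ε) (hf : IsTwistProfile f) (ha : IsAdapted L ε f)
    {w : List L.Chord} {M : ℝ → Matrix (Fin 2) (Fin 2) ℝ} (h : κ.Run F.ν 0 w M) (v : ℝ × ℝ) :
    κ.IsFlowInvariant F fun s => act (M s) v := by
  intro t ht
  rcases ht.1.eq_or_lt with rfl | hlt
  · obtain ⟨τ, hτ, hone⟩ := h.eq_one hs hf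
    refine (locallyInvariant_outside hs hf F v ⟨le_rfl, κ.T_pos.le⟩
      (not_inHandle_start hs hf)).congr ?_
    filter_upwards [mem_nhdsWithin_of_mem_nhds (Iio_mem_nhds hτ)] with b hb
    rw [hone b (le_of_lt hb), act_one]
  · exact h.locallyInvariant hs hf ha v t ⟨hlt, ht.2⟩

/-- Every field invariant under the linearised flow is given by the matrices of a run. -/
theorem Run.eq_of_isFlowInvariant (hs : N.Small ε) (hf : IsTwistProfile f)
    (ha : IsAdapted L ε f) {w : List L.Chord} {M : ℝ → Matrix (Fin 2) (Fin 2) ℝ}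
    (h : κ.Run F.ν 0 w M) {v : ℝ → ℝ × ℝ} (hv : κ.IsFlowInvariant F v) :
    ∀ s ∈ Icc 0 κ.T, v s = act (M s) (v 0) := by
  refine h.flow_eq hs hf ha hv ?_
  have hle : 𝓝[>] (0 : ℝ) ≤ 𝓝[Icc 0 κ.T] 0 := by
    rw [← nhdsWithin_Ioo_eq_nhdsGT κ.T_pos]
    exact nhdsWithin_mono _ Ioo_subset_Icc_self
  exact (eventually_const_of_outside hs hf ⟨le_rfl, κ.T_pos.le⟩
    (hv 0 ⟨le_rfl, κ.T_pos.le⟩) (not_inHandle_start hs hf)).filter_mono hle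

end ReebChord

end StandardNeighborhood

/-! ### Angles of paths of lines -/

namespace StandardNeighborhood

theorem SpansLine.exists_int {v : ℝ × ℝ} {θ θ' : ℝ} (h : SpansLine v θ) (h' : SpansLine v θ') :
    ∃ k : ℤ, θ' = θ + k * Real.pi := by
  obtain ⟨r, hr, rfl⟩ := h
  obtain ⟨r', hr', h⟩ := h'
  rw [Prod.mk.injEq] at h
  have h1 : Real.sin (θ' - θ) = 0 := by
    rw [Real.sin_sub]
    have : r * r' * (Real.sin θ' * Real.cos θ - Real.cos θ' * Real.sin θ) = 0 := by
      linear_combination (r' * Real.sin θ') * h.1 - r' * Real.cos θ' * h.2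
    exact (mul_eq_zero.1 this).resolve_left (mul_ne_zero hr hr')
  obtain ⟨k, hk⟩ := Real.sin_eq_zero_iff.1 h1
  exact ⟨k, by linarith⟩

theorem SpansLine.add_int {v : ℝ × ℝ} {θ : ℝ} (h : SpansLine v θ) (k : ℤ) :
    SpansLine v (θ + k * Real.pi) := by
  obtain ⟨r, hr, rfl⟩ := h
  refine ⟨r * (-1) ^ k, mul_ne_zero hr (zpow_ne_zero _ (by norm_num)), ?_⟩
  have h1 : ((-1 : ℝ) ^ k) * (-1) ^ k = 1 := by
    rw [← mul_zpow]; norm_num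
  rw [Real.cos_add_int_mul_pi, Real.sin_add_int_mul_pi, Prod.mk.injEq]
  constructor
  · linear_combination (-(r * Real.cos θ)) * h1
  · linear_combination (-(r * Real.sin θ)) * h1

theorem SpansLine.smul {v : ℝ × ℝ} {θ ρ : ℝ} (hρ : ρ ≠ 0) (h : SpansLine v θ) :
    SpansLine (ρ • v) θ := by
  obtain ⟨r, hr, rfl⟩ := h
  exact ⟨ρ * r, mul_ne_zero hρ hr, by simp [mul_assoc]⟩

theorem SpansLine.of_smul {v : ℝ × ℝ} {θ ρ : ℝ} (hρ : ρ ≠ 0) (h : SpansLine (ρ • v) θ) :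
    SpansLine v θ := by
  have := h.smul (inv_ne_zero hρ)
  rwa [inv_smul_smul₀ hρ] at this

/-- If a path of lines is never orthogonal to a path of directions and contains it at both ends,
then both turn by the same angle. -/
theorem SpansLine.variation_eq {v : ℝ → ℝ × ℝ} {Θ Ψ : ℝ → ℝ} {a b : ℝ} (hab : a ≤ b)
    (hΘ : ContinuousOn Θ (Icc a b)) (hΨ : ContinuousOn Ψ (Icc a b))
    (hv : ∀ s ∈ Icc a b, SpansLine (v s) (Θ s))
    (hne : ∀ s ∈ Icc a b, (v s).1 * Real.cos (Ψ s) + (v s).2 * Real.sin (Ψ s) ≠ 0)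
    (ha : SpansLine (v a) (Ψ a)) (hb : SpansLine (v b) (Ψ b)) : Θ b - Θ a = Ψ b - Ψ a := by
  -- Θ − Ψ avoids the odd multiples of π/2 and is a multiple of π at both ends; by the intermediate
  -- value theorem it is the same multiple.
  have hcos : ∀ s ∈ Icc a b, ∀ k : ℤ, Θ s - Ψ s ≠ k * Real.pi + Real.pi / 2 := by
    intro s hs k hk
    obtain ⟨r, hr, h⟩ := hv s hs
    have := hne s hs
    rw [h] at this
    have h1 : Real.cos (Θ s - Ψ s) = 0 := by
      rw [hk]
      exact Real.cos_eq_zero_iff.2 ⟨k, by ring⟩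
    rw [Real.cos_sub] at h1
    apply this
    linear_combination r * h1
  obtain ⟨k, hk⟩ := ha.exists_int (hv a ⟨le_rfl, hab⟩)
  obtain ⟨l, hl⟩ := hb.exists_int (hv b ⟨hab, le_rfl⟩)
  have hD := hΘ.sub hΨ
  have hpi := Real.pi_pos
  rcases lt_trichotomy k l with h | h | h
  · have h' : (k : ℝ) + 1 ≤ l := by exact_mod_cast h
    obtain ⟨s, hs, hs'⟩ := intermediate_value_Icc hab hD (show (k : ℝ) * Real.pi + Real.pi / 2 ∈ _ from
      ⟨by simp only [Pi.sub_apply]; rw [hk]; linarith, by simp only [Pi.sub_apply]; rw [hl]; nlinarith⟩)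
    exact absurd hs' (hcos s hs k)
  · rw [hk, hl, h]; ring
  · have h' : (l : ℝ) + 1 ≤ k := by exact_mod_cast h
    obtain ⟨s, hs, hs'⟩ := intermediate_value_Icc' hab hD (show (l : ℝ) * Real.pi + Real.pi / 2 ∈ _ from
      ⟨by simp only [Pi.sub_apply]; rw [hl]; linarith, by simp only [Pi.sub_apply]; rw [hk]; nlinarith⟩)
    exact absurd hs' (hcos s hs l)

theorem SpansLine.dot_ne {v : ℝ × ℝ} {θ : ℝ} (h : SpansLine v θ) :
    v.1 * Real.cos θ + v.2 * Real.sin θ ≠ 0 := by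
  obtain ⟨r, hr, rfl⟩ := h
  have := Real.cos_sq_add_sin_sq θ
  intro h0
  apply hr
  linear_combination h0 - r * this

/-- Two continuous angle functions of the same path of lines have the same variation. -/
theorem SpansLine.variation_unique {v : ℝ → ℝ × ℝ} {Θ Ψ : ℝ → ℝ} {a b : ℝ} (hab : a ≤ b)
    (hΘ : ContinuousOn Θ (Icc a b)) (hΨ : ContinuousOn Ψ (Icc a b))
    (hv : ∀ s ∈ Icc a b, SpansLine (v s) (Θ s)) (hv' : ∀ s ∈ Icc a b, SpansLine (v s) (Ψ s)) :
    Θ b - Θ a = Ψ b - Ψ a :=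
  SpansLine.variation_eq hab hΘ hΨ hv (fun s hs => (hv' s hs).dot_ne) (hv' a ⟨le_rfl, hab⟩)
    (hv' b ⟨hab, le_rfl⟩)

theorem SpansLine.const {v : ℝ × ℝ} {Θ : ℝ → ℝ} {a b : ℝ} (hab : a ≤ b)
    (hΘ : ContinuousOn Θ (Icc a b)) (hv : ∀ s ∈ Icc a b, SpansLine v (Θ s)) : Θ b = Θ a := by
  have := SpansLine.variation_unique (v := fun _ => v) hab hΘ (Ψ := fun _ => Θ a) continuousOn_const hv
    (fun _ _ => hv a ⟨le_rfl, hab⟩)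
  linarith

theorem spansLine_cos_sin (θ : ℝ) : SpansLine (Real.cos θ, Real.sin θ) θ :=
  ⟨1, one_ne_zero, by simp⟩

/-- Existence of a continuous angle function. -/
theorem exists_angle {v : ℝ → ℝ × ℝ} (hv : Continuous v) (h0 : ∀ s, v s ≠ 0) :
    ∃ Θ : ℝ → ℝ, Continuous Θ ∧ ∀ s, ∃ r > 0, v s = (r * Real.cos (Θ s), r * Real.sin (Θ s)) := by
  set c : ℝ → ℂ := fun s => ⟨(v s).1, (v s).2⟩ with hc
  have hcc : Continuous c := by
    have : c = fun s => ((v s).1 : ℂ) + ((v s).2 : ℂ) * Complex.I := by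
      funext s
      exact Complex.mk_eq_add_mul_I _ _
    rw [this]
    fun_prop
  have hc0 : ∀ s, c s ≠ 0 := by
    intro s h
    rw [Complex.ext_iff] at h
    exact h0 s (Prod.ext h.1 h.2)
  have hg : Continuous fun s => c s / (‖c s‖ : ℂ) :=
    hcc.div (by fun_prop) fun s => by simpa using hc0 s
  set g : C(ℝ, Circle) := ⟨fun s => ⟨c s / (‖c s‖ : ℂ), 
    mem_sphere_zero_iff_norm.2 (by simp [hc0 s])⟩, hg.subtype_mk _⟩ with hgdef
  obtain ⟨e, he⟩ := Circle.exp_surjective (g 0)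
  obtain ⟨Θ, ⟨-, hΘ⟩, -⟩ := Circle.isCoveringMap_exp.existsUnique_continuousMap_lifts g (a₀ := 0)
    (e₀ := e) he
  refine ⟨Θ, Θ.continuous, fun s => ⟨‖c s‖, norm_pos_iff.2 (hc0 s), ?_⟩⟩
  have h1 : ((Circle.exp (Θ s) : Circle) : ℂ) = c s / (‖c s‖ : ℂ) := by
    have := congrFun hΘ s
    simp only [Function.comp_apply] at this
    rw [this]
    rfl
  rw [Circle.coe_exp, eq_div_iff (by simpa using hc0 s), Complex.exp_mul_I] at h1
  have h2 : c s = (‖c s‖ : ℂ) * (Complex.cos (Θ s) + Complex.sin (Θ s) * Complex.I) := by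
    rw [mul_comm, h1]
  rw [← Complex.ofReal_cos, ← Complex.ofReal_sin] at h2
  refine Prod.ext ?_ ?_
  · have := congrArg Complex.re h2
    simpa [← Complex.ofReal_cos, ← Complex.ofReal_sin] using this
  · have := congrArg Complex.im h2
    simpa [← Complex.ofReal_cos, ← Complex.ofReal_sin] using this

/-- Makes the lift chosen in `angleVariation` irrelevant: any two lifts span the same lines and so
vary equally. -/
theorem angleVariation_eq {e : ℝ → ℝ × ℝ} {a b : ℝ} (hab : a ≤ b) {Θ : ℝ → ℝ}
    (hΘ : ContinuousOn Θ (Icc a b))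
    (h : ∀ t ∈ Icc a b, e t = (Real.cos (Θ t), Real.sin (Θ t))) :
    angleVariation e a b = Θ b - Θ a := by
  have hex : ∃ Θ : ℝ → ℝ, ContinuousOn Θ (Icc a b) ∧
      ∀ t ∈ Icc a b, e t = (Real.cos (Θ t), Real.sin (Θ t)) := ⟨Θ, hΘ, h⟩
  rw [angleVariation, dif_pos hex]
  obtain ⟨h1, h2⟩ := hex.choose_spec
  refine SpansLine.variation_unique (v := e) hab h1 hΘ (fun s hs => ?_) fun s hs => ?_
  · rw [h2 s hs]; exact spansLine_cos_sin _
  · rw [h s hs]; exact spansLine_cos_sin _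

end StandardNeighborhood

/-! ### Rotation of a line during one passage -/

theorem SurgeryLink.exists_tangent_angle {ι : Type*} (L : SurgeryLink ι) (i : ι) :
    ∃ τ : ℝ → ℝ, Continuous τ ∧ ∀ s, L.tangent i s = (Real.cos (τ s), Real.sin (τ s)) := by
  have hu : ∀ s, (L.tangent i s).1 ^ 2 + (L.tangent i s).2 ^ 2 = 1 := L.unit_speed i
  obtain ⟨τ, hτ, h⟩ := StandardNeighborhood.exists_angle (L.continuous_tangent i) fun s h0 => by
    have := hu s
    rw [h0] at this
    simp at this
  refine ⟨τ, hτ, fun s => ?_⟩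
  obtain ⟨r, hr, h1⟩ := h s
  have h2 := hu s
  rw [h1] at h2
  have h3 : r ^ 2 = 1 := by
    linear_combination h2 - r ^ 2 * Real.cos_sq_add_sin_sq (τ s)
  have h4 : r = 1 := by nlinarith
  rw [h1, h4, one_mul, one_mul]

/-- The strands at a crossing differ by a quarter turn. This converts the coordinates in which a
vector leaves the tail of a chord into those in which it reaches the tip. -/
theorem act_under (v : ℝ × ℝ) : act underMatrix v = act overMatrix (-v.2, v.1) := by
  simp only [act, underMatrix, overMatrix, Prod.mk.injEq]
  constructor <;> simp <;> ring

theorem det_overMatrix : overMatrix.det = 1 := by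
  have h : (1 / √2 : ℝ) * (1 / √2) = 1 / 2 := by
    rw [div_mul_div_comm, Real.mul_self_sqrt (by norm_num)]; norm_num
  simp only [overMatrix, Matrix.det_fin_two_of]
  linarith

theorem det_underMatrix : underMatrix.det = 1 := by
  have h : (1 / √2 : ℝ) * (1 / √2) = 1 / 2 := by
    rw [div_mul_div_comm, Real.mul_self_sqrt (by norm_num)]; norm_num
  simp only [underMatrix, Matrix.det_fin_two_of]
  linarith

namespace StandardNeighborhood

variable {ι : Type*} {L : SurgeryLink ι} {ε₀ : ℝ} {N : StandardNeighborhood L ε₀}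
  {ε : ℝ} {f : ℝ → ℝ}

theorem basisChange_tip (hs : N.Small ε) (r : L.Chord) : ∃ σ : ℝ, (σ = 1 ∨ σ = -1) ∧
    ∀ p q, ∀ k : ℤ, |p| ≤ ε → |q - k - r.tipPar| ≤ ε →
      N.basisChange r.tipIdx p q = σ • overMatrix := by
  obtain ⟨σ, hσ, h⟩ := hs.near_tip r
  refine ⟨σ, hσ, fun p q k hp hq => ?_⟩
  have := N.basisChange_add_int (i := r.tipIdx) (q := q - k) (hp.trans_lt hs.lt) k
  rw [sub_add_cancel] at this
  rw [this, h p (q - k) hp hq]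

theorem basisChange_tail (hs : N.Small ε) (r : L.Chord) : ∃ σ : ℝ, (σ = 1 ∨ σ = -1) ∧
    ∀ p q, ∀ k : ℤ, |p| ≤ ε → |q - k - r.tailPar| ≤ ε →
      N.basisChange r.tailIdx p q = σ • underMatrix := by
  obtain ⟨σ, hσ, h⟩ := hs.near_tail r
  refine ⟨σ, hσ, fun p q k hp hq => ?_⟩
  have := N.basisChange_add_int (i := r.tailIdx) (q := q - k) (hp.trans_lt hs.lt) k
  rw [sub_add_cancel] at this
  rw [this, h p (q - k) hp hq]

theorem tangent_tip (hs : N.Small ε) (r : L.Chord) : ∃ σ : ℝ, (σ = 1 ∨ σ = -1) ∧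
    ∀ q, ∀ k : ℤ, |q - k - r.tipPar| ≤ ε →
      L.tangent r.tipIdx q = σ • act overMatrix (0, 1) := by
  obtain ⟨σ, hσ, h⟩ := basisChange_tip hs r
  refine ⟨σ, hσ, fun q k hq => ?_⟩
  rw [N.tangent_eq (hs.pos.trans hs.lt), h 0 q k (by simpa using hs.pos.le) hq, act_smul_left]

theorem tangent_tail (hs : N.Small ε) (r : L.Chord) : ∃ σ : ℝ, (σ = 1 ∨ σ = -1) ∧
    ∀ q, ∀ k : ℤ, |q - k - r.tailPar| ≤ ε →
      L.tangent r.tailIdx q = σ • act underMatrix (0, 1) := by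
  obtain ⟨σ, hσ, h⟩ := basisChange_tail hs r
  refine ⟨σ, hσ, fun q k hq => ?_⟩
  rw [N.tangent_eq (hs.pos.trans hs.lt), h 0 q k (by simpa using hs.pos.le) hq, act_smul_left]

theorem ne_zero_of_sign {σ : ℝ} (h : σ = 1 ∨ σ = -1) : σ ≠ 0 := by
  rcases h with rfl | rfl <;> norm_num

/-- `overMatrix` is the rotation by −3π/4; correspondingly `underMatrix` is the rotation by −π/4. -/
theorem spansLine_over {a b : ℝ} (ha : a ≠ 0) : SpansLine (act overMatrix (a, b))
    (-(3 * Real.pi / 4) + Real.arctan (b / a)) := by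
  have h1 : Real.cos (Real.arctan (b / a)) ≠ 0 := (Real.cos_arctan_pos _).ne'
  have h2 : Real.sin (Real.arctan (b / a)) = b / a * Real.cos (Real.arctan (b / a)) := by
    rw [← Real.tan_mul_cos h1, Real.tan_arctan]
  have h3 : Real.cos (3 * Real.pi / 4) = -(1 / √2) := by
    rw [show 3 * Real.pi / 4 = Real.pi - Real.pi / 4 by ring, Real.cos_pi_sub, Real.cos_pi_div_four,
      Real.sqrt_div_self']
  have h4 : Real.sin (3 * Real.pi / 4) = 1 / √2 := by
    rw [show 3 * Real.pi / 4 = Real.pi - Real.pi / 4 by ring, Real.sin_pi_sub, Real.sin_pi_div_four,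
      Real.sqrt_div_self']
  refine ⟨a / Real.cos (Real.arctan (b / a)), div_ne_zero ha h1, ?_⟩
  rw [Real.cos_add, Real.sin_add, h2, Real.cos_neg, Real.sin_neg, h3, h4]
  simp only [act, overMatrix, Prod.mk.injEq]
  constructor <;> simp <;> field_simp

theorem spansLine_over_dq : SpansLine (act overMatrix (0, 1)) (-(Real.pi / 4)) := by
  refine ⟨1, one_ne_zero, ?_⟩
  rw [Real.cos_neg, Real.sin_neg, Real.cos_pi_div_four, Real.sin_pi_div_four,
      Real.sqrt_div_self']
  simp [act, overMatrix]

theorem spansLine_under_dq : SpansLine (act underMatrix (0, 1)) (Real.pi / 4) := by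
  refine ⟨1, one_ne_zero, ?_⟩
  rw [Real.cos_pi_div_four, Real.sin_pi_div_four, Real.sqrt_div_self']
  simp [act, underMatrix]

/-- Used near a crossing: the strand is straight there, so the tangent angle at a nearby parameter
is the one at the end of the chord. -/
theorem angle_eq_of_abs_le {v : ℝ → ℝ × ℝ} {u : ℝ × ℝ} {τ : ℝ → ℝ} (hτ : Continuous τ) {x y δ : ℝ}
    (hv : ∀ s, SpansLine (v s) (τ s))
    (hx : |x - y| ≤ δ) (h : ∀ s, |s - y| ≤ δ → ∃ σ : ℝ, σ ≠ 0 ∧ v s = σ • u) : τ x = τ y := by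
  have hu : ∀ s, |s - y| ≤ δ → SpansLine u (τ s) := by
    intro s hs
    obtain ⟨σ, hσ, h1⟩ := h s hs
    exact (h1 ▸ hv s).of_smul hσ
  obtain ⟨h1, h2⟩ := abs_le.1 hx
  rcases le_total x y with hxy | hxy
  · exact (SpansLine.const hxy hτ.continuousOn fun s hs =>
      hu s (abs_le.2 ⟨by linarith [hs.1], by linarith [hs.2]⟩)).symm
  · exact SpansLine.const hxy hτ.continuousOn fun s hs =>
      hu s (abs_le.2 ⟨by linarith [hs.1], by linarith [hs.2]⟩)

/-- If the twist takes a point near the tip of `r` to a point near the tail of `r'`, it moves it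
about the length of the capping path. -/
theorem fract_of_pass (hs : N.Small ε) {r r' : L.Chord} (hidx : r.tipIdx = r'.tailIdx) {q y : ℝ}
    (hq : |q - r.tipPar| ≤ ε) (hy : y - q ∈ Icc (0 : ℝ) 1) {k : ℤ} (hk : |y - k - r'.tailPar| ≤ ε) :
    r.tipPar + Int.fract (r'.tailPar - r.tipPar) = r'.tailPar + k := by
  -- The displacement from the tip to the lifted tail lies in [−2ε, 1 + 2ε]. Separation for k and
  -- for k − 1 excludes the 2ε-neighbourhoods of 0 and 1, so it lies in (0, 1) and is the fractional
  -- part.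
  have h1 := hs.tip_tail r r' hidx k
  have h2 := hs.tip_tail r r' hidx (k - 1)
  obtain ⟨q1, q2⟩ := abs_le.1 hq
  obtain ⟨k1, k2⟩ := abs_le.1 hk
  obtain ⟨y1, y2⟩ := hy
  push_cast at h2
  have h3 : r'.tailPar + k - r.tipPar ∈ Ioo (0 : ℝ) 1 := by
    rw [lt_abs] at h1 h2
    have hpos := hs.pos
    constructor
    · rcases h1 with h | h <;> linarith
    · rcases h2 with h | h <;> linarith
  have : Int.fract (r'.tailPar - r.tipPar) = r'.tailPar + k - r.tipPar :=
    Int.fract_eq_iff.2 ⟨h3.1.le, h3.2, -k, by push_cast; ring⟩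
  linarith

theorem cappingAngle_eq {r r' : L.Chord} {τ : ℝ → ℝ} (hτ : Continuous τ)
    (h : ∀ s, L.tangent r.tipIdx s = (Real.cos (τ s), Real.sin (τ s))) :
    L.cappingAngle r r' = τ (r.tipPar + Int.fract (r'.tailPar - r.tipPar)) - τ r.tipPar :=
  angleVariation_eq (by linarith [Int.fract_nonneg (r'.tailPar - r.tipPar)]) hτ.continuousOn
    fun t _ => h t

/-- Modulo π the tangent angle is −π/4 at a tip and π/4 at a tail. The capping angle is thus an odd
multiple of π/2, and the floor in `rot` loses exactly π/2. -/
theorem cappingAngle_eq_rot (hs : N.Small ε) {r r' : L.Chord} (hidx : r.tipIdx = r'.tailIdx) :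
    L.cappingAngle r r' = Real.pi * L.rot r r' + Real.pi / 2 := by
  obtain ⟨τ, hτ, h⟩ := L.exists_tangent_angle r.tipIdx
  have hv : ∀ s, SpansLine (L.tangent r.tipIdx s) (τ s) := fun s => by
    rw [h]; exact spansLine_cos_sin _
  obtain ⟨σ, hσ, h1⟩ := tangent_tip hs r
  obtain ⟨σ', hσ', h2⟩ := tangent_tail hs r'
  have h3 := hv r.tipPar
  rw [h1 r.tipPar 0 (by simpa using hs.pos.le)] at h3
  obtain ⟨a, ha⟩ := spansLine_over_dq.exists_int (h3.of_smul (ne_zero_of_sign hσ))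
  set x := r.tipPar + Int.fract (r'.tailPar - r.tipPar) with hx
  have h4 := hv x
  rw [hidx, h2 x (-⌊r'.tailPar - r.tipPar⌋) (by
    have : x - ((-⌊r'.tailPar - r.tipPar⌋ : ℤ) : ℝ) - r'.tailPar = 0 := by
      rw [hx, Int.fract]; push_cast; ring
    rw [this]
    simpa using hs.pos.le)] at h4
  obtain ⟨b, hb⟩ := spansLine_under_dq.exists_int (h4.of_smul (ne_zero_of_sign hσ'))
  have h5 : L.cappingAngle r r' = Real.pi * ((b - a : ℤ) : ℝ) + Real.pi / 2 := by
    rw [cappingAngle_eq hτ h, ← hx, ha, hb]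
    push_cast
    ring
  have h6 : L.rot r r' = b - a := by
    rw [SurgeryLink.rot, h5, Int.floor_eq_iff]
    have hpi := Real.pi_pos
    have e : (Real.pi * ((b - a : ℤ) : ℝ) + Real.pi / 2) / Real.pi = ((b - a : ℤ) : ℝ) + 1 / 2 := by
      field_simp
    rw [e]
    constructor <;> linarith
  rw [h5, h6]

/-- Along the core ∂p maps to the tangent turned clockwise by a quarter turn, and ∂q to the tangent
itself. -/
theorem act_core_slope (h0 : 0 < ε₀) {i : ι} {τ : ℝ → ℝ}
    (h : ∀ s, L.tangent i s = (Real.cos (τ s), Real.sin (τ s))) (q x : ℝ) :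
    ∃ r > 0, act (N.basisChange i 0 q) (1, x)
      = (r * Real.cos (τ q - Real.pi / 2 + Real.arctan x),
          r * Real.sin (τ q - Real.pi / 2 + Real.arctan x)) := by
  have h1 := Real.cos_arctan_pos x
  have h2 : Real.sin (Real.arctan x) = x * Real.cos (Real.arctan x) := by
    rw [← Real.tan_mul_cos h1.ne', Real.tan_arctan]
  have h3 : L.tangent i q = _ := h q
  refine ⟨(Real.cos (Real.arctan x))⁻¹, inv_pos.2 h1, ?_⟩
  rw [N.basisChange_core h0, h3, Real.cos_add, Real.sin_add, h2, Real.cos_sub_pi_div_two,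
    Real.sin_sub_pi_div_two]
  simp only [act, Prod.mk.injEq]
  constructor <;> simp <;> field_simp

/-- The rotation of a line under the linearised flow along the passage of a handle. -/
theorem pass_angle (hs : N.Small ε) (hf : IsTwistProfile f) (ha : IsAdapted L ε f)
    (F : N.Framing ε f) {r r' : L.Chord} {p q : ℝ}
    (hidx : r.tipIdx = r'.tailIdx) (hc : L.coeff r.tipIdx ≠ 0) (hp : |p| ≤ ε)
    (hq : |q - r.tipPar| ≤ ε)
    (hq' : ∃ k : ℤ, |q + (L.coeff r.tipIdx : ℝ) * fScaled f ε p - r'.tailPar - k| ≤ ε)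
    {e e' : ℝ} (hee : e < e')
    (hlen : e' = e + 2 * ε + (L.coeff r.tipIdx : ℝ) * HFun f ε p)
    {W : ℝ × ℝ} (hW : W.1 ≠ 0) {Θ : ℝ → ℝ} (hΘ : ContinuousOn Θ (Icc e e'))
    (hspan : ∀ s ∈ Icc e e',
      SpansLine (act (N.handleFrame ε f F.ν r.tipIdx (-ε + (s - e), p, q)) W) (Θ s)) :
    Θ e' - Θ e = L.cappingAngle r r'
      + (Real.arctan (W.2 / W.1 + (L.coeff r.tipIdx : ℝ) / ε) - Real.arctan (W.2 / W.1)) := by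
  obtain ⟨hd, -⟩ := adapted_pass hs hf ha F hidx hc hp hq hq'
  obtain ⟨τ, hτ, h⟩ := L.exists_tangent_angle r.tipIdx
  have hpos := hs.pos
  have h0 : 0 < ε₀ := hpos.trans hs.lt
  have hv : ∀ s, SpansLine (L.tangent r.tipIdx s) (τ s) := fun s => by
    rw [h]; exact spansLine_cos_sin _
  have hp0 : |(0 : ℝ)| ≤ ε := by simpa using hpos.le
  have hp' := hp.trans_lt hs.lt
  set i := r.tipIdx with hi
  set c : ℝ := (L.coeff i : ℝ) with hcdef
  have hcont : Continuous (fScaled f ε) :=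
    continuous_iff_continuousAt.2 fun p => (hf.hasDerivAt_fScaled ε p).continuousAt
  have hdcont := hf.continuous_deriv_fScaled ε
  have hν : Continuous F.ν := F.ν_smooth.continuous
  -- the point of the knot and the slope at time `s`
  set ζ : ℝ → ℝ := fun s => p * F.ν (-ε + (s - e)) - c * ε * (1 - F.ν (-ε + (s - e))) with hζ
  have hζc : Continuous ζ := by fun_prop
  have hζe : ζ e = -(c * ε) := by
    simp only [hζ, sub_self, add_zero, F.ν_bottom _ le_rfl]; ring
  have hζe' : ζ e' = p := by
    have h2 := hf.HFun_zero_le hpos p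
    have h3 := hf.HFun_nonpos hpos p
    have h4 := hf.HFun_nonpos hpos 0
    have : F.ν (-ε + (e' - e)) = 1 := by
      apply F.ν_top
      rcases coeff_cases hc with ⟨-, hh⟩ | ⟨-, hh⟩ <;> rw [hcdef, hh] at hlen <;> linarith
    simp only [hζ, this]; ring
  -- For c = −1 the twist −f_ε is replaced by 1 − f_ε, which is the same modulo 1. With this m the
  -- parameter η + m starts at q and ends at most one period ahead, like the capping path, for both
  -- signs.
  obtain ⟨m, hm0, hm1, hm2⟩ : ∃ m : ℤ, c * fScaled f ε (-(c * ε)) + m = 0 ∧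
      deriv (fScaled f ε) (-(c * ε)) = 0 ∧ ∀ x, c * fScaled f ε x + m ∈ Icc (0 : ℝ) 1 := by
    rcases coeff_cases hc with ⟨-, hh⟩ | ⟨-, hh⟩ <;> rw [hcdef, hh]
    · refine ⟨0, ?_, hf.deriv_fScaled_eq_zero hpos ?_, fun x => ?_⟩
      · rw [one_mul, one_mul, hf.fScaled_left hpos le_rfl]; simp
      · rw [one_mul, abs_neg, abs_of_pos hpos]
      · have := hf.fScaled_mem ε x
        simpa using this
    · refine ⟨1, ?_, hf.deriv_fScaled_eq_zero hpos ?_, fun x => ?_⟩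
      · rw [neg_one_mul, neg_one_mul, neg_neg, hf.fScaled_right hpos le_rfl]; simp
      · rw [neg_one_mul, neg_neg, abs_of_pos hpos]
      · have := hf.fScaled_mem ε x
        constructor <;> push_cast <;> linarith [this.1, this.2]
  set η : ℝ → ℝ := fun s => q + c * fScaled f ε (ζ s) with hη
  set x : ℝ → ℝ := fun s => W.2 / W.1 + c * deriv (fScaled f ε) (ζ s) with hx
  -- The angle of the comparison line, obtained by moving the base point to the core, p = 0.
  set Ψ : ℝ → ℝ := fun s => τ (η s + m) - Real.pi / 2 + Real.arctan (x s) with hΨ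
  have hΨc : Continuous Ψ := by
    have h1 : Continuous x := by fun_prop
    have h2 : Continuous η := by fun_prop
    exact ((hτ.comp (h2.add continuous_const)).sub continuous_const).add
      (Real.continuous_arctan.comp h1)
  have hvec : ∀ s, act (N.handleFrame ε f F.ν i (-ε + (s - e), p, q)) W
      = W.1 • act (N.basisChange i p (η s)) (1, x s) := by
    intro s
    have e1 : act (shear (c * deriv (fScaled f ε) (ζ s))) W = W.1 • (1, x s) := by
      rw [act_shear]
      simp only [hx, Prod.smul_mk, smul_eq_mul, mul_one, Prod.mk.injEq, true_and]
      field_simp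
    rw [handleFrame, act_mul]
    change act _ (act (shear (c * deriv (fScaled f ε) (ζ s))) W) = _
    rw [e1, act_smul]
  have hcore : ∀ s, ∃ ρ > 0, act (N.basisChange i 0 (η s)) (1, x s)
      = (ρ * Real.cos (Ψ s), ρ * Real.sin (Ψ s)) := by
    intro s
    obtain ⟨ρ, hρ, h1⟩ := act_core_slope (N := N) h0 h (η s + m) (x s)
    refine ⟨ρ, hρ, ?_⟩
    rw [← h1, N.basisChange_add_int (by simpa using h0)]
  have hend : ∀ s, N.basisChange i p (η s) = N.basisChange i 0 (η s) →
      SpansLine (act (N.handleFrame ε f F.ν i (-ε + (s - e), p, q)) W) (Ψ s) := by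
    intro s hs'
    rw [hvec, hs']
    obtain ⟨ρ, hρ, h1⟩ := hcore s
    exact SpansLine.smul hW ⟨ρ, hρ.ne', h1⟩
  obtain ⟨k, hk⟩ := hq'
  have hηe : η e = q - m := by simp only [hη, hζe]; linarith
  have hηe' : η e' = q + c * fScaled f ε p := by simp only [hη, hζe']
  obtain ⟨σ, hσ, htip⟩ := basisChange_tip hs r
  obtain ⟨σ', hσ', htail⟩ := basisChange_tail hs r'
  rw [← hidx] at htail
  -- Non-orthogonality is `Small.close`. At entry and exit η is near a tip and a tail, where the
  -- change of basis does not depend on p, so the two lines coincide.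
  have hkey := SpansLine.variation_eq hee.le hΘ hΨc.continuousOn hspan (fun s _ => by
      obtain ⟨ρ, hρ, h1⟩ := hcore s
      have h2 := hs.close i p (η s) hp (1, x s) (by simp)
      rw [hvec]
      rw [h1] at h2
      intro h3
      have h4 : W.1 * ((act (N.basisChange i p (η s)) (1, x s)).1 * (ρ * Real.cos (Ψ s))
          + (act (N.basisChange i p (η s)) (1, x s)).2 * (ρ * Real.sin (Ψ s))) = 0 := by
        simp only [Prod.smul_fst, Prod.smul_snd, smul_eq_mul] at h3
        linear_combination ρ * h3
      exact (mul_ne_zero hW h2.ne') h4)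
    (hend e (by
      rw [hηe, htip p (q - m) (-m) hp (by push_cast; simpa using hq),
        htip 0 (q - m) (-m) hp0 (by push_cast; simpa using hq)]))
    (hend e' (by
      have : |q + c * fScaled f ε p - k - r'.tailPar| ≤ ε := by rwa [sub_right_comm]
      rw [hηe', htail p _ k hp this, htail 0 _ k hp0 this]))
  rw [hkey]
  have hxe : x e = W.2 / W.1 := by simp only [hx, hζe, hm1]; ring
  have hxe' : x e' = W.2 / W.1 + c / ε := by simp only [hx, hζe', hd]; ring
  have hτe : τ (η e + m) = τ r.tipPar := by
    rw [hηe, sub_add_cancel]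
    obtain ⟨σ, hσ, h1⟩ := tangent_tip hs r
    exact angle_eq_of_abs_le hτ hv hq fun s hs' =>
      ⟨σ, ne_zero_of_sign hσ, h1 s 0 (by simpa using hs')⟩
  have hfr := fract_of_pass hs hidx hq (y := η e' + m) (k := k + m)
    (by rw [hηe']; convert hm2 p using 1; ring)
    (by rw [hηe']; push_cast; convert hk using 2; ring)
  have hτe' : τ (η e' + m) = τ (r.tipPar + Int.fract (r'.tailPar - r.tipPar)) := by
    obtain ⟨σ, hσ, h1⟩ := tangent_tail hs r'
    rw [← hidx] at h1
    refine angle_eq_of_abs_le hτ hv (δ := ε) ?_ fun s hs' =>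
      ⟨σ, ne_zero_of_sign hσ, h1 s (k + m) ?_⟩
    · rw [hfr, hηe']
      push_cast
      convert hk using 2; ring
    · rw [hfr] at hs'
      convert hs' using 2; ring
  simp only [hΨ, hxe, hxe', hτe, hτe']
  rw [cappingAngle_eq hτ h]
  ring

end StandardNeighborhood

/-! ### Accumulated rotation along a chord -/

namespace StandardNeighborhood

variable {ι : Type*} {L : SurgeryLink ι} {ε₀ : ℝ} {N : StandardNeighborhood L ε₀}
  {ε : ℝ} {f : ℝ → ℝ}

/-- The linearised flow along the passage of a handle, and the rotation of a line. -/
theorem pass_over (hs : N.Small ε) (hf : IsTwistProfile f) (ha : IsAdapted L ε f)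
    (F : N.Framing ε f) {r r' : L.Chord} {p q : ℝ}
    (hidx : r.tipIdx = r'.tailIdx) (hc : L.coeff r.tipIdx ≠ 0) (hp : |p| ≤ ε)
    (hq : |q - r.tipPar| ≤ ε)
    (hq' : ∃ k : ℤ, |q + (L.coeff r.tipIdx : ℝ) * fScaled f ε p - r'.tailPar - k| ≤ ε)
    {e e' : ℝ} (hee : e < e')
    (hlen : e' = e + 2 * ε + (L.coeff r.tipIdx : ℝ) * HFun f ε p) (a b : ℝ) :
    (∃ σ : ℝ, (σ = 1 ∨ σ = -1) ∧
      act (N.passFrame ε f F.ν r.tipIdx p q (e' - e)) (act overMatrix (a, b))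
        = σ • act underMatrix (a, b + (L.coeff r.tipIdx : ℝ) / ε * a)) ∧
    ∀ Θ : ℝ → ℝ, a ≠ 0 → ContinuousOn Θ (Icc e e') →
      (∀ s ∈ Icc e e', SpansLine
        (act (N.passFrame ε f F.ν r.tipIdx p q (s - e)) (act overMatrix (a, b))) (Θ s)) →
      Θ e' - Θ e = Real.pi * L.rot r r' + Real.pi / 2
        + (Real.arctan (b / a + (L.coeff r.tipIdx : ℝ) / ε) - Real.arctan (b / a)) := by
  obtain ⟨hd, -⟩ := adapted_pass hs hf ha F hidx hc hp hq hq'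
  obtain ⟨σ, hσ, htip⟩ := hs.near_tip r
  obtain ⟨σ', hσ', htail⟩ := basisChange_tail hs r'
  rw [← hidx] at htail
  have hσ1 : σ * σ = 1 := by rcases hσ with rfl | rfl <;> norm_num
  have hB : act (N.handleFrame ε f F.ν r.tipIdx (-ε, p, q))⁻¹ (act overMatrix (a, b))
      = σ • (a, b) := by
    have hdet : (N.handleFrame ε f F.ν r.tipIdx (-ε, p, q)).det = 1 :=
      det_handleFrame (hp.trans_lt hs.lt)
    have : act overMatrix (a, b)
        = act (N.handleFrame ε f F.ν r.tipIdx (-ε, p, q)) (σ • (a, b)) := by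
      rw [handleFrame_bottom hs hf F hc hp le_rfl, htip p q hp hq, act_smul_left, act_smul,
        smul_smul, hσ1, one_smul]
    rw [this, act_inv_act hdet]
  have hpass : ∀ s, act (N.passFrame ε f F.ν r.tipIdx p q s) (act overMatrix (a, b))
      = act (N.handleFrame ε f F.ν r.tipIdx (-ε + s, p, q)) (σ • (a, b)) := by
    intro s
    rw [passFrame, act_mul, hB]
  constructor
  · obtain ⟨k, hk⟩ := hq'
    refine ⟨σ * σ', ?_, ?_⟩
    · rcases hσ with rfl | rfl <;> rcases hσ' with rfl | rfl <;> norm_num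
    · rw [hpass, handleFrame_top hf hs.pos F hc (by linarith),
        htail p _ k hp (by rwa [sub_right_comm]), act_mul, act_smul, act_smul, act_smul_left,
        act_shear, hd, smul_smul]
      simp only [mul_one_div]
  · intro Θ ha0 hΘ hspan
    have hσ0 := ne_zero_of_sign hσ
    have h1 := pass_angle hs hf ha F hidx hc hp hq hq' hee hlen (W := σ • (a, b))
      (by simpa using ⟨hσ0, ha0⟩) hΘ (fun s hs' => by rw [← hpass]; exact hspan s hs')
    rw [h1, cappingAngle_eq_rot hs hidx]
    simp only [Prod.smul_mk, smul_eq_mul, mul_div_mul_left _ _ hσ0]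

theorem arctan_add_arctan_inv {c S : ℝ} (h : c = 1 ∧ 0 < S ∨ c = -1 ∧ S < 0) :
    Real.arctan S + Real.arctan S⁻¹ = c * (Real.pi / 2) := by
  rcases h with ⟨rfl, h⟩ | ⟨rfl, h⟩
  · rw [Real.arctan_inv_of_pos h]; ring
  · rw [Real.arctan_inv_of_neg h]; ring

theorem wordIndex_cons (r r' : L.Chord) (w : List L.Chord) : L.wordIndex (r :: r' :: w)
    = L.rot r r' + (if L.coeff r.tipIdx = 1 then 1 else 0) + L.wordIndex (r' :: w) := by
  simp [SurgeryLink.wordIndex]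

theorem wordIndex_singleton (r : L.Chord) : L.wordIndex [r] = 0 := by
  simp [SurgeryLink.wordIndex]

/-- The π/2 left over from the capping angle and the cπ/2 from the shears combine to the correction
in `wordIndex`: a half turn for c = 1, nothing for c = −1. -/
theorem pi_mul_coeff {i : ι} (hc : L.coeff i ≠ 0) :
    Real.pi / 2 + (L.coeff i : ℝ) * (Real.pi / 2)
      = Real.pi * ((if L.coeff i = 1 then 1 else 0 : ℤ) : ℝ) := by
  rcases coeff_cases hc with ⟨h, h'⟩ | ⟨h, h'⟩
  · rw [h', h]; simp
  · rw [h', h]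
    simp [show (-1 : SignType) ≠ 1 by decide]

theorem slope_bounds (hs : N.Small ε) {a b : ℝ} (hab : |b| ≤ |a|) :
    |b / a| ≤ 1 ∧ 2 ≤ 1 / ε := by
  refine ⟨?_, ?_⟩
  · rw [abs_div]
    exact div_le_one_of_le₀ hab (abs_nonneg _)
  · rw [le_div_iff₀ hs.pos]
    linarith [hs.le_half]

namespace ReebChord

variable {κ : N.ReebChord ε f} {F : N.Framing ε f}

/-- The rotation of a line under the linearised flow up to the exit from the first handle. -/
theorem step_angle (hs : N.Small ε) (hf : IsTwistProfile f) (ha : IsAdapted L ε f)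
    {t e e' p q : ℝ} {r r' : L.Chord} {w : List L.Chord} {M : ℝ → Matrix (Fin 2) (Fin 2) ℝ}
    (he : t < e) (hee : e < e')
    (hidx : r.tipIdx = r'.tailIdx) (hc : L.coeff r.tipIdx ≠ 0) (hp : |p| ≤ ε)
    (hq : |q - r.tipPar| ≤ ε)
    (hq' : ∃ k : ℤ, |q + (L.coeff r.tipIdx : ℝ) * fScaled f ε p - r'.tailPar - k| ≤ ε)
    (hlen : e' = e + 2 * ε + (L.coeff r.tipIdx : ℝ) * HFun f ε p)
    (hrun : κ.Run F.ν e' (r' :: w) M) {a b : ℝ} {Θ : ℝ → ℝ}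
    (hΘ : ContinuousOn Θ (Icc t κ.T))
    (hspan : ∀ s ∈ Icc t κ.T,
      SpansLine (act (M s * N.passFrame ε f F.ν r.tipIdx p q (s - e)) (act overMatrix (a, b)))
        (Θ s)) :
    (a ≠ 0 → Θ e' - Θ t = Real.pi * L.rot r r' + Real.pi / 2
      + (Real.arctan (b / a + (L.coeff r.tipIdx : ℝ) / ε) - Real.arctan (b / a))) ∧
    ∀ s ∈ Icc e' κ.T, SpansLine (act (M s)
      (act (N.passFrame ε f F.ν r.tipIdx p q (e' - e)) (act overMatrix (a, b)))) (Θ s) := by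
  obtain ⟨τ, hτ, hone⟩ := hrun.eq_one hs hf
  have hT := hrun.nonneg_lt.2
  have h1 : Θ e = Θ t := by
    refine SpansLine.const (v := act overMatrix (a, b)) he.le
      (hΘ.mono (Icc_subset_Icc le_rfl (by linarith))) fun s hs' => ?_
    have := hspan s ⟨hs'.1, by linarith [hs'.2]⟩
    rwa [hone s (by linarith [hs'.2]),
      passFrame_of_nonpos hs hf F hc q hp (by linarith [hs'.2]), one_mul, act_one] at this
  have h2 := fun ha0 => (pass_over hs hf ha F hidx hc hp hq hq' hee hlen a b).2 Θ ha0
    (hΘ.mono (Icc_subset_Icc (by linarith) (by linarith))) fun s hs' => by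
      have := hspan s ⟨by linarith [hs'.1], by linarith [hs'.2]⟩
      rwa [hone s (by linarith [hs'.2]), one_mul] at this
  refine ⟨fun ha0 => by rw [← h1, h2 ha0], fun s hs' => ?_⟩
  have := hspan s ⟨by linarith [hs'.1], hs'.2⟩
  rw [passFrame_of_ge hs hf F hc q (by linarith [hs'.1]), act_mul] at this
  have e1 : e' - e = 2 * ε + (L.coeff r.tipIdx : ℝ) * HFun f ε p := by linarith
  rwa [e1]

/-- The rotation of a line that is close to the under-crossing strand at the beginning of a run. -/
theorem Run.forward (hs : N.Small ε) (hf : IsTwistProfile f) (ha : IsAdapted L ε f) {t : ℝ}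
    {w : List L.Chord} {M : ℝ → Matrix (Fin 2) (Fin 2) ℝ} (h : κ.Run F.ν t w M) :
    ∀ (a b : ℝ) (Θ : ℝ → ℝ), a ≠ 0 → |b| ≤ |a| → ContinuousOn Θ (Icc t κ.T) →
      (∀ s ∈ Icc t κ.T, SpansLine (act (M s) (act overMatrix (a, b))) (Θ s)) →
      ∃ a' b' : ℝ, act (M κ.T) (act overMatrix (a, b)) = act overMatrix (a', b') ∧ a' ≠ 0 ∧
        Θ κ.T - Θ t = Real.pi * L.wordIndex w + Real.arctan (b' / a') - Real.arctan (b / a) := by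
  induction h with
  | last t r h0 hT hout hidx htip =>
    intro a b Θ ha0 hab hΘ hspan
    refine ⟨a, b, by rw [act_one], ha0, ?_⟩
    rw [SpansLine.const (v := act overMatrix (a, b)) hT.le hΘ
      fun s hs' => by simpa using hspan s hs', wordIndex_singleton]
    simp
  | step t e e' p q r r' w M h0 he hee hT hidx hc hp hq hq' hlen hout hin hrun ih =>
    intro a b Θ ha0 hab hΘ hspan
    obtain ⟨h1, h2⟩ := step_angle hs hf ha he hee hidx hc hp hq hq' hlen hrun hΘ hspan
    replace h1 := h1 ha0
    obtain ⟨⟨σ, hσ, h3⟩, -⟩ := pass_over hs hf ha F hidx hc hp hq hq' hee hlen a b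
    obtain ⟨g1, g2⟩ := slope_bounds hs hab
    have hpos := hs.pos
    set c : ℝ := (L.coeff r.tipIdx : ℝ) with hcdef
    set S := b / a + c / ε with hS
    -- The entry slope has modulus at most 1 and 1/ε ≥ 2, so the shear decides the sign of S and
    -- pushes its modulus to at least 1.
    have hSc : c = 1 ∧ 1 ≤ S ∨ c = -1 ∧ S ≤ -1 := by
      obtain ⟨g3, g4⟩ := abs_le.1 g1
      rcases coeff_cases hc with ⟨-, hh⟩ | ⟨-, hh⟩ <;> rw [← hcdef] at hh
      · left; refine ⟨hh, ?_⟩; rw [hS, hh]; linarith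
      · right; refine ⟨hh, ?_⟩; rw [hS, hh, neg_div]; linarith
    have hS0 : S ≠ 0 := by rintro h; rcases hSc with h' | h' <;> linarith [h'.2]
    have hS1 : 1 ≤ |S| := by
      rw [le_abs]; rcases hSc with h' | h'
      · left; exact h'.2
      · right; linarith [h'.2]
    have hSa : b + c / ε * a = S * a := by rw [hS]; field_simp
    have hσ0 := ne_zero_of_sign hσ
    rw [hSa, act_under, ← act_smul] at h3
    have h4 : act (N.passFrame ε f F.ν r.tipIdx p q (e' - e)) (act overMatrix (a, b))
        = act overMatrix (σ * -(S * a), σ * a) := h3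
    obtain ⟨a', b', h5, h6, h7⟩ := ih (σ * -(S * a)) (σ * a) Θ
      (mul_ne_zero hσ0 (neg_ne_zero.2 (mul_ne_zero hS0 ha0)))
      (by
        rw [abs_mul, abs_mul, abs_neg, abs_mul]
        exact mul_le_mul_of_nonneg_left (le_mul_of_one_le_left (abs_nonneg _) hS1) (abs_nonneg _))
      (hΘ.mono (Icc_subset_Icc (by linarith) le_rfl)) (fun s hs' => by rw [← h4]; exact h2 s hs')
    refine ⟨a', b', ?_, h6, ?_⟩
    · have e1 : e' - e = 2 * ε + c * HFun f ε p := by linarith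
      beta_reduce
      rw [← h5, ← h4, act_mul, passFrame_of_ge hs hf F hc q (s := κ.T - e) (by linarith), e1]
    -- The remaining run starts with slope −1/S. Its arctangent joins that of S to give cπ/2, and
    -- the arctangents of the intermediate slopes disappear.
    · have e1 : σ * a / (σ * -(S * a)) = -S⁻¹ := by
        rw [mul_div_mul_left _ _ hσ0]; field_simp
      rw [e1, Real.arctan_neg] at h7
      have e2 := arctan_add_arctan_inv (c := c) (S := S)
        (by rcases hSc with h' | h'
            · left; exact ⟨h'.1, by linarith [h'.2]⟩
            · right; exact ⟨h'.1, by linarith [h'.2]⟩)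
      have e3 := pi_mul_coeff hc
      rw [wordIndex_cons]
      push_cast at e3 ⊢
      linarith

/-- The rotation of a line that becomes the over-crossing strand at the end of a run. -/
theorem Run.backward (hs : N.Small ε) (hf : IsTwistProfile f) (ha : IsAdapted L ε f) {t : ℝ}
    {w : List L.Chord} {M : ℝ → Matrix (Fin 2) (Fin 2) ℝ} (h : κ.Run F.ν t w M) :
    ∀ (v : ℝ × ℝ) (ρ : ℝ) (Θ : ℝ → ℝ), ρ ≠ 0 → act (M κ.T) v = ρ • act overMatrix (0, 1) →
      ContinuousOn Θ (Icc t κ.T) → (∀ s ∈ Icc t κ.T, SpansLine (act (M s) v) (Θ s)) →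
      ∃ a b : ℝ, v = act underMatrix (a, b) ∧ a ≠ 0 ∧ |b| ≤ |a| ∧
        Θ κ.T - Θ t = Real.pi * L.wordIndex w - Real.arctan (b / a) := by
  induction h with
  | last t r h0 hT hout hidx htip =>
    intro v ρ Θ hρ hv hΘ hspan
    rw [act_one] at hv
    refine ⟨ρ, 0, ?_, hρ, by simp, ?_⟩
    · rw [hv, act_under, ← act_smul]; simp
    · rw [SpansLine.const (v := v) hT.le hΘ fun s hs' => by simpa using hspan s hs',
        wordIndex_singleton]
      simp
  | step t e e' p q r r' w M h0 he hee hT hidx hc hp hq hq' hlen hout hin hrun ih =>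
    intro v ρ Θ hρ hv hΘ hspan
    obtain ⟨a, b, rfl⟩ : ∃ a b : ℝ, v = act overMatrix (a, b) :=
      ⟨_, _, (act_act_inv det_overMatrix v).symm⟩
    obtain ⟨⟨σ, hσ, h3⟩, -⟩ := pass_over hs hf ha F hidx hc hp hq hq' hee hlen a b
    have hpos := hs.pos
    set c : ℝ := (L.coeff r.tipIdx : ℝ) with hcdef
    have hσ0 := ne_zero_of_sign hσ
    have hlast : act (M κ.T) (act (N.passFrame ε f F.ν r.tipIdx p q (e' - e))
        (act overMatrix (a, b))) = ρ • act overMatrix (0, 1) := by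
      have e1 : e' - e = 2 * ε + c * HFun f ε p := by linarith
      rw [← hv]
      beta_reduce
      rw [act_mul, passFrame_of_ge hs hf F hc q (s := κ.T - e) (by linarith), e1]
    obtain ⟨h1, hspan'⟩ := step_angle hs hf ha he hee hidx hc hp hq hq' hlen hrun hΘ hspan
    obtain ⟨A, B, h4, hA, hAB, h5⟩ := ih _ ρ Θ hρ hlast
      (hΘ.mono (Icc_subset_Icc (by linarith) le_rfl)) hspan'
    rw [h3, ← act_smul] at h4
    have h6 := congrArg (act underMatrix⁻¹) h4
    rw [act_inv_act det_underMatrix, act_inv_act det_underMatrix] at h6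
    simp only [Prod.smul_mk, smul_eq_mul, Prod.mk.injEq] at h6
    obtain ⟨rfl, rfl⟩ := h6
    have ha0 : a ≠ 0 := right_ne_zero_of_mul hA
    replace h1 := h1 ha0
    obtain ⟨g1, g2⟩ := slope_bounds hs hAB
    have e0 : σ * (b + c / ε * a) / (σ * a) = b / a + c / ε := by
      rw [mul_div_mul_left _ _ hσ0]; field_simp
    rw [e0] at g1 h5
    set S := b / a with hS
    -- Backwards, the bound is on the slope after the shear, S + c/ε. Since 1/ε ≥ 2, the slope S
    -- before it has the sign of −c and modulus at least 1.
    have hSc : -c = 1 ∧ 1 ≤ S ∨ -c = -1 ∧ S ≤ -1 := by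
      obtain ⟨g3, g4⟩ := abs_le.1 g1
      rcases coeff_cases hc with ⟨-, hh⟩ | ⟨-, hh⟩ <;> rw [← hcdef] at hh <;> rw [hh] at g3 g4 ⊢
      · right; refine ⟨rfl, ?_⟩; linarith
      · left; refine ⟨by norm_num, ?_⟩; rw [neg_div] at g3; linarith
    have hS0 : S ≠ 0 := by rintro h; rcases hSc with h' | h' <;> linarith [h'.2]
    have hS1 : 1 ≤ |S| := by
      rw [le_abs]; rcases hSc with h' | h'
      · left; exact h'.2
      · right; linarith [h'.2]
    have hb : b = S * a := by rw [hS]; field_simp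
    refine ⟨b, -a, ?_, ?_, ?_, ?_⟩
    · rw [act_under, neg_neg]
    · rw [hb]; exact mul_ne_zero hS0 ha0
    · rw [abs_neg, hb, abs_mul]
      exact le_mul_of_one_le_left (abs_nonneg _) hS1
    · have e1 : -a / b = -S⁻¹ := by rw [hb]; field_simp
      rw [e1, Real.arctan_neg]
      have e2 := arctan_add_arctan_inv (c := -c) (S := S)
        (by rcases hSc with h' | h'
            · left; exact ⟨h'.1, by linarith [h'.2]⟩
            · right; exact ⟨h'.1, by linarith [h'.2]⟩)
      have e3 := pi_mul_coeff hc
      rw [wordIndex_cons]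
      push_cast at e3 ⊢
      linarith

end ReebChord

end StandardNeighborhood

/-! ### Comparison with the tangent lines of Λ⁰ at the ends of a chord -/

namespace StandardNeighborhood

variable {ι : Type*} {L : SurgeryLink ι} {ε₀ : ℝ} {N : StandardNeighborhood L ε₀}
  {ε : ℝ} {f : ℝ → ℝ}

theorem tangent_eq_of_curve_eq {i j : ι} {s t : ℝ} (h : L.curve i s = L.curve j t) :
    L.tangent i s = L.tangent j t := by
  obtain ⟨rfl, k, rfl⟩ := L.embedded i j s t h
  rw [L.tangent_add_int]

theorem curve_mem_piece (hs : N.Small ε) {i : ι} (hi : L.coeff i = 0) (s : ℝ) :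
    L.curve i s ∈ N.piece ε f none := by
  rintro ⟨j, hj, u, hu, he⟩
  have hpos := hs.pos.trans hs.lt
  rw [← N.core] at he
  obtain ⟨rfl, -⟩ := N.embedded j i u ⟨hu.1.trans_lt hs.lt, hu.2.trans_lt hs.lt⟩ (0, 0, s)
    ⟨by simpa using hpos, by simpa using hpos⟩ he
  exact hj hi

theorem hasCoords_curve_iff (hs : N.Small ε) (F : N.Framing ε f) {i : ι} (hi : L.coeff i = 0)
    (s : ℝ) (v : ℝ × ℝ) :
    F.HasCoords none (L.curve i s) (deriv (L.curve i) s) v ↔ v = L.tangent i s := by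
  rw [hasCoords_none_iff F (curve_mem_piece hs hi s), SurgeryLink.tangent]
  exact and_iff_right (L.legendrian i s)

theorem spansLine_under {a b : ℝ} (ha : a ≠ 0) : SpansLine (act underMatrix (a, b))
    (-(Real.pi / 4) + Real.arctan (b / a)) := by
  have h1 : Real.cos (Real.arctan (b / a)) ≠ 0 := (Real.cos_arctan_pos _).ne'
  have h2 : Real.sin (Real.arctan (b / a)) = b / a * Real.cos (Real.arctan (b / a)) := by
    rw [← Real.tan_mul_cos h1, Real.tan_arctan]
  refine ⟨a / Real.cos (Real.arctan (b / a)), div_ne_zero ha h1, ?_⟩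
  rw [Real.cos_add, Real.sin_add, h2, Real.cos_neg, Real.sin_neg, Real.cos_pi_div_four,
    Real.sin_pi_div_four, Real.sqrt_div_self']
  simp only [act, underMatrix, Prod.mk.injEq]
  constructor <;> simp <;> field_simp

theorem pi_div_two_add_arctan_mem (x : ℝ) :
    Real.pi / 2 + Real.arctan x ∈ Ioo (0 : ℝ) Real.pi :=
  ⟨by linarith [Real.neg_pi_div_two_lt_arctan x], by linarith [Real.arctan_lt_pi_div_two x]⟩

namespace ReebChord

variable {κ : N.ReebChord ε f} {F : N.Framing ε f}

theorem Run.exists_tip {ν : ℝ → ℝ} {t : ℝ} {w : List L.Chord}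
    {M : ℝ → Matrix (Fin 2) (Fin 2) ℝ} (h : κ.Run ν t w M) :
    ∃ r : L.Chord, r.tipIdx = κ.endIdx ∧ ∃ k : ℤ, |κ.endPar - k - r.tipPar| ≤ ε := by
  induction h with
  | last t r h0 hT hout hidx htip => exact ⟨r, hidx, htip⟩
  | step t e e' p q r r' w M h0 he hee hT hidx hc hp hq hq' hlen hout hin hrun ih => exact ih

/-- The tangent vector at the beginning of a traversed Reeb chord, in the framing. -/
noncomputable def sourceVec (κ : N.ReebChord ε f) (a : ℤˣ) : ℝ × ℝ :=
  if a = 1 then L.tangent κ.startIdx κ.startPar else L.tangent κ.endIdx κ.endPar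

/-- The tangent vector at the end of a traversed Reeb chord, in the framing. -/
noncomputable def targetVec (κ : N.ReebChord ε f) (a : ℤˣ) : ℝ × ℝ :=
  if a = 1 then L.tangent κ.endIdx κ.endPar else L.tangent κ.startIdx κ.startPar

theorem hasCoords_source_iff (hs : N.Small ε) (κ : N.ReebChord ε f) (a : ℤˣ) (v : ℝ × ℝ) :
    F.HasCoords none (κ.source a) (κ.sourceTangent a) v ↔ v = κ.sourceVec a := by
  simp only [source, sourceTangent, sourceVec]
  split_ifs
  · exact hasCoords_curve_iff hs F κ.start_coeff _ _
  · exact hasCoords_curve_iff hs F κ.end_coeff _ _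

theorem tangent_eq_sourceVec {i : ι} {s : ℝ} {a : ℤˣ} (h : L.curve i s = κ.source a) :
    L.tangent i s = κ.sourceVec a := by
  simp only [source, sourceVec] at h ⊢
  split_ifs at h ⊢ <;> exact tangent_eq_of_curve_eq h

theorem tangent_eq_targetVec {i : ι} {s : ℝ} {a : ℤˣ} (h : L.curve i s = κ.target a) :
    L.tangent i s = κ.targetVec a := by
  simp only [target, targetVec] at h ⊢
  split_ifs at h ⊢ <;> exact tangent_eq_of_curve_eq h

theorem continuous_time (κ : N.ReebChord ε f) (a : ℤˣ) : Continuous (κ.time a) := by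
  unfold time
  split_ifs <;> fun_prop

/-- By uniqueness of the word, the run built from the geometry has the given word. -/
theorem exists_run_of_hasWord (hs : N.Small ε) (hf : IsTwistProfile f) (ν : ℝ → ℝ)
    {W : List L.Chord} (hW : L.IsWord W) (hW' : κ.HasWord W) :
    ∃ (r : L.Chord) (M : ℝ → Matrix (Fin 2) (Fin 2) ℝ), κ.Run ν 0 W M ∧ r.tailIdx = κ.startIdx ∧ ∃ k : ℤ, |κ.startPar - k - r.tailPar| ≤ ε := by
  obtain ⟨r, w, M, h1, h2, h3, h4⟩ := exists_run_start hs hf κ ν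
  have := word_unique hs hf (h1.isWord h2) hW (h1.hasWord hs hf h2 h4) hW'
  subst this
  exact ⟨r, M, h1, h2, h3⟩

theorem existsUnique_word (hs : N.Small ε) (hf : IsTwistProfile f) (κ : N.ReebChord ε f) :
    ∃! w : List L.Chord, L.IsWord w ∧ κ.HasWord w := by
  obtain ⟨r, w, M, h1, h2, -, h4⟩ := exists_run_start hs hf κ fun _ => 0
  exact ⟨r :: w, ⟨h1.isWord h2, h1.hasWord hs hf h2 h4⟩, fun w' h' =>
    word_unique hs hf h'.1 (h1.isWord h2) h'.2 (h1.hasWord hs hf h2 h4)⟩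

/-- The rotation of the tangent line under the linearised flow along a Reeb chord, corrected by
the smallest clockwise rotation to the tangent line at the end. -/
theorem variation (hs : N.Small ε) (hf : IsTwistProfile f) (ha : IsAdapted L ε f)
    {W : List L.Chord} (hW : L.IsWord W) (hW' : κ.HasWord W) (a : ℤˣ) {v : ℝ → ℝ × ℝ}
    (hv : κ.IsFlowInvariant F v) (h0 : v (κ.time a 0) = κ.sourceVec a) {Θ : ℝ → ℝ}
    (hΘ : ContinuousOn Θ (Icc 0 1))
    (hspan : ∀ t ∈ Icc (0 : ℝ) 1, SpansLine (v (κ.time a t)) (Θ t)) :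
    ∃ β ∈ Ioo 0 Real.pi, SpansLine (κ.targetVec a) (Θ 1 - β) ∧
      Θ 1 - β - Θ 0 = Real.pi * (-(1 / 2) + ((a : ℤ) : ℝ) * L.wordIndex W) := by
  obtain ⟨r, M, hrun, hr, k, hk⟩ := exists_run_of_hasWord hs hf F.ν hW hW'
  obtain ⟨r', hr', k', hk'⟩ := hrun.exists_tip
  have hflow := hrun.eq_of_isFlowInvariant hs hf ha hv
  have hT := κ.T_pos
  obtain ⟨σ, hσ, h1⟩ := tangent_tail hs r
  obtain ⟨σ', hσ', h2⟩ := tangent_tip hs r'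
  replace h1 := h1 _ k hk
  replace h2 := h2 _ k' hk'
  rw [hr] at h1
  rw [hr'] at h2
  have hσ0 := ne_zero_of_sign hσ
  have hσ0' := ne_zero_of_sign hσ'
  have hdiv : ∀ s ∈ Icc 0 κ.T, s / κ.T ∈ Icc (0 : ℝ) 1 := fun s hs' =>
    ⟨div_nonneg hs'.1 hT.le, div_le_one_of_le₀ hs'.2 hT.le⟩
  rcases Int.units_eq_one_or a with rfl | rfl
  · simp only [time, sourceVec, targetVec, if_true] at *
    rw [zero_mul, h1] at h0
    -- The tangent to the under-crossing strand has slope 0 in over-crossing coordinates, so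
    -- `Run.forward` begins without a boundary term.
    have h3 : v 0 = act overMatrix (-σ, 0) := by
      rw [h0, act_under, ← act_smul]; simp
    have hc : ContinuousOn (fun s => Θ (s / κ.T)) (Icc 0 κ.T) :=
      hΘ.comp (by fun_prop) hdiv
    obtain ⟨a', b', h4, h5, h6⟩ := hrun.forward hs hf ha (-σ) 0 (fun s => Θ (s / κ.T))
      (neg_ne_zero.2 hσ0) (by simp) hc fun s hs' => by
        have := hspan _ (hdiv s hs')
        rwa [div_mul_cancel₀ _ hT.ne', hflow s hs', h3] at this
    have h7 := hspan 1 ⟨zero_le_one, le_rfl⟩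
    rw [one_mul, hflow _ ⟨hT.le, le_rfl⟩, h3, h4] at h7
    obtain ⟨m, hm⟩ := (spansLine_over h5).exists_int h7
    simp only [div_self hT.ne', zero_div, Real.arctan_zero] at h6
    -- The flow ends at angle −3π/4 + arctan(b'/a') modulo π. The next line at −π/4 modulo π met
    -- clockwise is at −5π/4, which accounts both for this rotation and for m − 1.
    refine ⟨_, pi_div_two_add_arctan_mem (b' / a'), ?_, ?_⟩
    · rw [h2]
      convert (spansLine_over_dq.smul hσ0').add_int (m - 1) using 1
      rw [hm]; push_cast; ring
    · simp only [Units.val_one, Int.cast_one]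
      linarith
  · have hne : ¬ ((-1 : ℤˣ) = 1) := by decide
    simp only [time, sourceVec, targetVec, if_neg hne] at *
    rw [sub_zero, one_mul, h2] at h0
    have hdiv' : ∀ s ∈ Icc 0 κ.T, 1 - s / κ.T ∈ Icc (0 : ℝ) 1 := fun s hs' =>
      ⟨by linarith [(hdiv s hs').2], by linarith [(hdiv s hs').1]⟩
    have hc : ContinuousOn (fun s => Θ (1 - s / κ.T)) (Icc 0 κ.T) :=
      hΘ.comp (by fun_prop) hdiv'
    have h3 := hflow κ.T ⟨hT.le, le_rfl⟩
    obtain ⟨a', b', h4, h5, -, h6⟩ := hrun.backward hs hf ha (v 0) σ' (fun s => Θ (1 - s / κ.T))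
      hσ0' (by rw [← h3, h0]) hc fun s hs' => by
        have := hspan _ (hdiv' s hs')
        rwa [sub_sub_cancel, div_mul_cancel₀ _ hT.ne', hflow s hs'] at this
    have h7 := hspan 1 ⟨zero_le_one, le_rfl⟩
    rw [sub_self, zero_mul, h4] at h7
    obtain ⟨m, hm⟩ := (spansLine_under h5).exists_int h7
    simp only [div_self hT.ne', zero_div, sub_self, sub_zero] at h6
    -- For the reversed chord the flow ends at −π/4 + arctan(b'/a') modulo π, and the target is the
    -- under-crossing strand; going clockwise it is reached at −3π/4.
    refine ⟨_, pi_div_two_add_arctan_mem (b' / a'), ?_, ?_⟩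
    · rw [h1]
      convert (spansLine_under_dq.smul hσ0).add_int (m - 1) using 1
      rw [hm]; push_cast; ring
    · simp only [Units.val_neg, Units.val_one, Int.cast_neg, Int.cast_one]
      linarith

theorem exists_isFlowInvariant (hs : N.Small ε) (hf : IsTwistProfile f) (ha : IsAdapted L ε f)
    (F : N.Framing ε f) (κ : N.ReebChord ε f) (a : ℤˣ) :
    ∃ v : ℝ → ℝ × ℝ, κ.IsFlowInvariant F v ∧ v (κ.time a 0) = κ.sourceVec a ∧
      Continuous v ∧ ∀ s, v s ≠ 0 := by
  obtain ⟨r, w, M, hrun, -, -, -⟩ := exists_run_start hs hf κ F.ν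
  have hM := hrun.continuous hs hf
  have hdet := hrun.det hs
  set u := act (M (κ.time a 0))⁻¹ (κ.sourceVec a) with hu
  have h0 : act (M (κ.time a 0)) u = κ.sourceVec a := act_act_inv (hdet _) _
  refine ⟨fun s => act (M s) u, hrun.isFlowInvariant hs hf ha u, h0, continuous_act hM u,
    fun s h => ?_⟩
  have h1 : u = 0 := by
    have h : act (M s) u = 0 := h
    rw [← act_inv_act (hdet s) u, h]; simp [act]
  rw [h1] at h0
  have h2 : κ.sourceVec a = 0 := by rw [← h0]; simp [act]
  have hunit : ∀ i t, L.tangent i t ≠ 0 := by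
    intro i t h
    have : (L.tangent i t).1 ^ 2 + (L.tangent i t).2 ^ 2 = 1 := L.unit_speed i t
    rw [h] at this
    simp at this
  unfold sourceVec at h2
  split_ifs at h2 <;> exact hunit _ _ h2

end ReebChord

end StandardNeighborhood

/-! ### Concatenation of angle functions -/

theorem exists_concat {g h : ℝ → ℝ} {a b c : ℝ} (hab : a ≤ b) (hbc : b ≤ c)
    (hg : ContinuousOn g (Icc a b)) (hh : ContinuousOn h (Icc b c)) (hgh : g b = h b) :
    ∃ F : ℝ → ℝ, ContinuousOn F (Icc a c) ∧ EqOn F g (Icc a b) ∧ EqOn F h (Icc b c) := by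
  classical
  set F : ℝ → ℝ := fun t => if t ≤ b then g t else h t with hF
  have h1 : EqOn F g (Icc a b) := fun t ht => by simp [hF, ht.2]
  have h2 : EqOn F h (Icc b c) := by
    intro t ht
    rcases ht.1.eq_or_lt with rfl | hlt
    · simp [hF, hgh]
    · simp [hF, not_le.2 hlt]
  refine ⟨F, ?_, h1, h2⟩
  rw [← Icc_union_Icc_eq_Icc hab hbc]
  exact (hg.congr h1).union_of_isClosed (hh.congr h2) isClosed_Icc isClosed_Icc

/-- Consecutive blocks agree at their junction only modulo π. Each new block is shifted by the
multiple of π accumulated so far. -/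
theorem exists_concat_blocks (n : ℕ) {g : ℕ → ℝ → ℝ}
    (hg : ∀ k ≤ n, ContinuousOn (g k) (Icc 0 3))
    (hm : ∀ k < n, ∃ m : ℤ, g k 3 = g (k + 1) 0 + m * Real.pi) :
    ∃ Θ : ℝ → ℝ, ContinuousOn Θ (Icc 0 (3 * (n + 1 : ℕ))) ∧
      ∀ k ≤ n, ∃ m : ℤ, ∀ t ∈ Icc (0 : ℝ) 3, Θ (3 * k + t) = g k t + m * Real.pi := by
  induction n with
  | zero =>
    refine ⟨g 0, by simpa using hg 0 le_rfl, fun k hk => ⟨0, fun t _ => ?_⟩⟩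
    obtain rfl : k = 0 := by omega
    simp
  | succ n ih =>
    obtain ⟨Θ, h1, h2⟩ := ih (fun k hk => hg k (by omega)) fun k hk => hm k (by omega)
    obtain ⟨m, hm⟩ := hm n (by omega)
    obtain ⟨m', hm'⟩ := h2 n le_rfl
    set b : ℝ := 3 * (n + 1 : ℕ) with hb
    have hb0 : 0 ≤ b := by positivity
    have hc : ContinuousOn (fun t => g (n + 1) (t - b) + (m + m' : ℤ) * Real.pi)
        (Icc b (b + 3)) := by
      refine ContinuousOn.add ?_ continuousOn_const
      exact (hg (n + 1) le_rfl).comp (by fun_prop) fun t ht =>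
        ⟨by linarith [ht.1], by linarith [ht.2]⟩
    have hval : Θ b = g (n + 1) (b - b) + (m + m' : ℤ) * Real.pi := by
      have h3 := hm' 3 ⟨by norm_num, le_rfl⟩
      have e1 : (3 : ℝ) * n + 3 = b := by rw [hb]; push_cast; ring
      rw [e1, hm] at h3
      rw [h3, sub_self]
      push_cast
      ring
    obtain ⟨F, f1, f2, f3⟩ := exists_concat hb0 (by linarith) h1 hc hval
    refine ⟨F, ?_, fun k hk => ?_⟩
    · convert f1 using 2
      rw [hb]; push_cast; ring
    · rcases Nat.lt_or_ge n k with h | h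
      · obtain rfl : k = n + 1 := by omega
        refine ⟨m + m', fun t ht => ?_⟩
        rw [← hb, f3 ⟨by linarith [ht.1], by linarith [ht.2]⟩]
        beta_reduce
        rw [add_sub_cancel_left]
      · obtain ⟨l, hl⟩ := h2 k h
        refine ⟨l, fun t ht => ?_⟩
        have hkn : (k : ℝ) ≤ n := by exact_mod_cast h
        have hbn : b = 3 * n + 3 := by rw [hb]; push_cast; ring
        rw [f2 ⟨by have := ht.1; positivity, by linarith [ht.2]⟩, hl t ht]

/-! ### The blocks of the loop of lines and its degree -/

namespace StandardNeighborhood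

variable {ι : Type*} {L : SurgeryLink ι} {ε₀ : ℝ} {N : StandardNeighborhood L ε₀}
  {ε : ℝ} {f : ℝ → ℝ} {n : ℕ} [NeZero n]

namespace BrokenString

variable {b : N.BrokenString ε f n} {F : N.Framing ε f}

/-- The part of a lift of the loop of lines that belongs to `(a_k κ_k) * ζ_k`. -/
structure IsBlock (b : N.BrokenString ε f n) (F : N.Framing ε f) (k : Fin n) (g : ℝ → ℝ) :
    Prop where
  flow : ∃ v : ℝ → ℝ × ℝ, (b.chord k).IsFlowInvariant F v ∧
    F.HasCoords none ((b.chord k).source (b.sign k)) ((b.chord k).sourceTangent (b.sign k))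
      (v ((b.chord k).time (b.sign k) 0)) ∧
    ∀ t ∈ Icc (0 : ℝ) 1, SpansLine (v ((b.chord k).time (b.sign k) t)) (g t)
  close : ∃ β ∈ Ioo 0 Real.pi, ∀ t ∈ Icc (0 : ℝ) 1, g (1 + t) = g 1 - t * β
  arc : ∀ t ∈ Icc (0 : ℝ) 1, ∃ v : ℝ × ℝ,
    F.HasCoords none (L.curve (b.arcIdx k) (b.arcPar k t))
      (deriv (L.curve (b.arcIdx k)) (b.arcPar k t)) v ∧ SpansLine v (g (2 + t))

theorem IsBlock.add_int {k : Fin n} {g g' : ℝ → ℝ} (h : b.IsBlock F k g) (m : ℤ)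
    (hg : ∀ t ∈ Icc (0 : ℝ) 3, g' t = g t + m * Real.pi) : b.IsBlock F k g' := by
  obtain ⟨v, h1, h2, h3⟩ := h.flow
  obtain ⟨β, h4, h5⟩ := h.close
  refine ⟨⟨v, h1, h2, fun t ht => ?_⟩, ⟨β, h4, fun t ht => ?_⟩, fun t ht => ?_⟩
  · rw [hg t ⟨ht.1, by linarith [ht.2]⟩]
    exact (h3 t ht).add_int m
  · rw [hg _ ⟨by linarith [ht.1], by linarith [ht.2]⟩, hg 1 ⟨by norm_num, by norm_num⟩, h5 t ht]
    ring
  · obtain ⟨v, h6, h7⟩ := h.arc t ht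
    refine ⟨v, h6, ?_⟩
    rw [hg _ ⟨by linarith [ht.1], by linarith [ht.2]⟩]
    exact h7.add_int m

theorem IsBlock.spansLine_source (hs : N.Small ε) {k : Fin n} {g : ℝ → ℝ} (h : b.IsBlock F k g) :
    SpansLine ((b.chord k).sourceVec (b.sign k)) (g 0) := by
  obtain ⟨v, -, h2, h3⟩ := h.flow
  rw [← (ReebChord.hasCoords_source_iff hs _ _ _).1 h2]
  exact h3 0 ⟨le_rfl, zero_le_one⟩

theorem IsBlock.spansLine_arc (hs : N.Small ε) {k : Fin n} {g : ℝ → ℝ} (h : b.IsBlock F k g)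
    {t : ℝ} (ht : t ∈ Icc (0 : ℝ) 1) :
    SpansLine (L.tangent (b.arcIdx k) (b.arcPar k t)) (g (2 + t)) := by
  obtain ⟨v, h1, h2⟩ := h.arc t ht
  rwa [(hasCoords_curve_iff hs F (b.arc_coeff k) _ _).1 h1] at h2

theorem IsBlock.spansLine_end (hs : N.Small ε) {k : Fin n} {g : ℝ → ℝ} (h : b.IsBlock F k g) :
    SpansLine ((b.chord (k + 1)).sourceVec (b.sign (k + 1))) (g 3) := by
  have := h.spansLine_arc hs (t := 1) ⟨zero_le_one, le_rfl⟩
  rw [ReebChord.tangent_eq_sourceVec (b.arc_end k)] at this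
  convert this using 1
  norm_num

theorem eq_of_int_mul_pi {β β' : ℝ} (h : β ∈ Ioo 0 Real.pi) (h' : β' ∈ Ioo 0 Real.pi) {k : ℤ}
    (hk : β' = β + k * Real.pi) : β' = β := by
  have h1 : (k : ℝ) < 1 := by nlinarith [h.1, h'.2, Real.pi_pos]
  have h2 : (-1 : ℝ) < k := by nlinarith [h.2, h'.1, Real.pi_pos]
  have h3 : k = 0 := by
    have : k < 1 := by exact_mod_cast h1
    have : -1 < k := by exact_mod_cast h2
    omega
  rw [hk, h3]; simp

/-- The closing rotation of a block must end on the line with which the arc begins. The one in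
`ReebChord.variation` ends on the same line, and two angles in (0, π) differing by a multiple of π
are equal. Along the arc the line turns as its tangent vector does. -/
theorem IsBlock.variation (hs : N.Small ε) (hf : IsTwistProfile f) (ha : IsAdapted L ε f)
    {k : Fin n} {W : List L.Chord} (hW : L.IsWord W) (hW' : (b.chord k).HasWord W) {g : ℝ → ℝ}
    (hg : ContinuousOn g (Icc 0 3)) (h : b.IsBlock F k g) :
    g 3 - g 0 = Real.pi * (b.arcAngle k / Real.pi - 1 / 2
      + ((b.sign k : ℤ) : ℝ) * (L.wordIndex W : ℝ)) := by
  obtain ⟨v, h1, h2, h3⟩ := h.flow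
  obtain ⟨β', h4, h5⟩ := h.close
  rw [ReebChord.hasCoords_source_iff hs] at h2
  obtain ⟨β, hβ, h6, h7⟩ := (b.chord k).variation hs hf ha hW hW' (b.sign k) h1 h2
    (hg.mono (Icc_subset_Icc le_rfl (by norm_num))) h3
  have h8 := h.spansLine_arc hs (t := 0) ⟨le_rfl, zero_le_one⟩
  rw [ReebChord.tangent_eq_targetVec (b.arc_start k), add_zero] at h8
  have h9 := h5 1 ⟨zero_le_one, le_rfl⟩
  rw [one_mul, one_add_one_eq_two] at h9
  rw [h9] at h8
  obtain ⟨m, hm⟩ := h8.exists_int h6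
  have h10 : β' = β := eq_of_int_mul_pi hβ h4 (k := m) (by linarith)
  obtain ⟨τ, hτ, h11⟩ := L.exists_tangent_angle (b.arcIdx k)
  have hcτ : ContinuousOn (fun t => τ (b.arcPar k t)) (Icc 0 1) :=
    hτ.comp_continuousOn (b.arc_continuous k)
  have h12 : b.arcAngle k = τ (b.arcPar k 1) - τ (b.arcPar k 0) :=
    angleVariation_eq zero_le_one hcτ fun t _ => h11 _
  have h13 := SpansLine.variation_unique (v := fun t => L.tangent (b.arcIdx k) (b.arcPar k t))
    (Θ := fun t => g (2 + t)) zero_le_one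
    (hg.comp (by fun_prop) fun t ht => ⟨by linarith [ht.1], by linarith [ht.2]⟩) hcτ
    (fun t ht => h.spansLine_arc hs ht) fun t _ => by
      rw [h11]
      exact spansLine_cos_sin _
  beta_reduce at h13
  rw [add_zero, ← h12, show (2 : ℝ) + 1 = 3 by norm_num] at h13
  have hpi := Real.pi_ne_zero
  have e1 : Real.pi * (b.arcAngle k / Real.pi) = b.arcAngle k := by field_simp
  rw [mul_add, mul_sub, e1]
  rw [mul_add] at h7
  rw [h10] at h9
  linarith

/-- Joins an angle function of the flowed tangent, the linear clockwise rotation, and the tangent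
angle along the arc, the last shifted by the multiple of π that makes it fit. -/
theorem exists_isBlock (hs : N.Small ε) (hf : IsTwistProfile f) (ha : IsAdapted L ε f)
    (b : N.BrokenString ε f n) (F : N.Framing ε f) (k : Fin n) :
    ∃ g : ℝ → ℝ, ContinuousOn g (Icc 0 3) ∧ b.IsBlock F k g := by
  obtain ⟨v, h1, h2, h3, h4⟩ := (b.chord k).exists_isFlowInvariant hs hf ha F (b.sign k)
  obtain ⟨W, ⟨hW, hW'⟩, -⟩ := (b.chord k).existsUnique_word hs hf
  obtain ⟨θ, hθ, h5⟩ := exists_angle (v := fun t => v ((b.chord k).time (b.sign k) t))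
    (h3.comp ((b.chord k).continuous_time _)) fun t => h4 _
  have h5' : ∀ t, SpansLine (v ((b.chord k).time (b.sign k) t)) (θ t) := fun t => by
    obtain ⟨r, hr, h⟩ := h5 t
    exact ⟨r, hr.ne', h⟩
  obtain ⟨β, hβ, h6, -⟩ := (b.chord k).variation hs hf ha hW hW' (b.sign k) h1 h2
    hθ.continuousOn fun t _ => h5' t
  obtain ⟨τ, hτ, h7⟩ := L.exists_tangent_angle (b.arcIdx k)
  rw [← ReebChord.tangent_eq_targetVec (b.arc_start k), h7] at h6
  obtain ⟨m, hm⟩ := (spansLine_cos_sin _).exists_int h6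
  have c1 : ContinuousOn (fun t => θ 1 - (t - 1) * β) (Icc 1 2) := by fun_prop
  have c2 : ContinuousOn (fun t => τ (b.arcPar k (t - 2)) + m * Real.pi) (Icc 2 3) := by
    refine ContinuousOn.add (hτ.comp_continuousOn ((b.arc_continuous k).comp (by fun_prop) ?_))
      continuousOn_const
    intro t ht
    exact ⟨by linarith [ht.1], by linarith [ht.2]⟩
  obtain ⟨g₁, g1, g2, g3⟩ := exists_concat zero_le_one one_le_two hθ.continuousOn c1 (by simp)
  obtain ⟨g, g4, g5, g6⟩ := exists_concat zero_le_two (by norm_num : (2 : ℝ) ≤ 3) g1 c2 (by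
    rw [g3 ⟨one_le_two, le_rfl⟩, sub_self, ← hm]; norm_num)
  have e1 : ∀ t ∈ Icc (0 : ℝ) 1, g t = θ t := fun t ht => by
    rw [g5 ⟨ht.1, by linarith [ht.2]⟩, g2 ht]
  refine ⟨g, g4, ⟨v, h1, (ReebChord.hasCoords_source_iff hs _ _ _).2 h2, fun t ht => ?_⟩,
    ⟨β, hβ, fun t ht => ?_⟩, fun t ht => ⟨_, (hasCoords_curve_iff hs F (b.arc_coeff k) _ _).2 rfl, ?_⟩⟩
  · rw [e1 t ht]; exact h5' t
  · rw [e1 1 ⟨zero_le_one, le_rfl⟩, g5 ⟨by linarith [ht.1], by linarith [ht.2]⟩,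
      g3 ⟨by linarith [ht.1], by linarith [ht.2]⟩]
    beta_reduce
    rw [add_sub_cancel_left]
  · rw [g6 ⟨by linarith [ht.1], by linarith [ht.2]⟩]
    beta_reduce
    rw [add_sub_cancel_left, h7]
    exact (spansLine_cos_sin _).add_int m

theorem isMaslovIndex_iff {m : ℤ} : b.IsMaslovIndex F m ↔ ∃ Θ : ℝ → ℝ,
    ContinuousOn Θ (Icc 0 (3 * n)) ∧ (∀ k : Fin n, b.IsBlock F k fun t => Θ (3 * (k : ℕ) + t)) ∧
    Θ (3 * n) - Θ 0 = m * Real.pi := by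
  refine exists_congr fun Θ => and_congr_right fun _ => and_congr_left fun _ =>
    forall_congr' fun k => ?_
  constructor
  · rintro ⟨h1, ⟨β, hβ, h2⟩, h3⟩
    refine ⟨h1, ⟨β, hβ, fun t ht => ?_⟩, fun t ht => ?_⟩
    · have := h2 t ht
      rwa [add_assoc] at this
    · have := h3 t ht
      rwa [add_assoc] at this
  · rintro ⟨h1, ⟨β, hβ, h2⟩, h3⟩
    refine ⟨h1, ⟨β, hβ, fun t ht => ?_⟩, fun t ht => ?_⟩
    · have := h2 t ht
      beta_reduce at this
      rwa [← add_assoc] at this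
    · have := h3 t ht
      beta_reduce at this
      rwa [← add_assoc] at this

/-- The value of the Maslov index. -/
theorem IsMaslovIndex.eq_sum (hs : N.Small ε) (hf : IsTwistProfile f) (ha : IsAdapted L ε f)
    {w : Fin n → List L.Chord} (hw : ∀ k, L.IsWord (w k) ∧ (b.chord k).HasWord (w k)) {m : ℤ}
    (h : b.IsMaslovIndex F m) : (m : ℝ) = ∑ k : Fin n, (b.arcAngle k / Real.pi - 1 / 2
      + ((b.sign k : ℤ) : ℝ) * (L.wordIndex (w k) : ℝ)) := by
  obtain ⟨Θ, hΘ, hb, hm⟩ := isMaslovIndex_iff.1 h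
  have h1 : ∀ k : Fin n, Θ (3 * ((k + 1 : ℕ) : ℝ)) - Θ (3 * (k : ℕ))
      = Real.pi * (b.arcAngle k / Real.pi - 1 / 2
        + ((b.sign k : ℤ) : ℝ) * (L.wordIndex (w k) : ℝ)) := by
    intro k
    have hk : ((k : ℕ) : ℝ) + 1 ≤ n := by exact_mod_cast k.2
    have := IsBlock.variation hs hf ha (hw k).1 (hw k).2
      (hΘ.comp (by fun_prop) fun t ht =>
        ⟨by have := ht.1; positivity, by linarith [ht.2]⟩) (hb k)
    rw [← this]
    congr 2
    · push_cast; ring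
    · ring
  have h2 := Finset.sum_congr rfl fun k (_ : k ∈ Finset.univ) => h1 k
  rw [← Finset.mul_sum, Fin.sum_univ_eq_sum_range
    (fun k : ℕ => Θ (3 * ((k + 1 : ℕ) : ℝ)) - Θ (3 * (k : ℝ))) n,
    Finset.sum_range_sub (fun k : ℕ => Θ (3 * (k : ℝ))) n] at h2
  rw [Nat.cast_zero, mul_zero, hm, mul_comm] at h2
  exact mul_left_cancel₀ Real.pi_ne_zero h2

/-- With indices cyclic in `Fin n`, the last block ends on the line on which the first begins. The
angles there differ by a multiple of π, and that multiple is the degree. -/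
theorem exists_isMaslovIndex (hs : N.Small ε) (hf : IsTwistProfile f) (ha : IsAdapted L ε f)
    (b : N.BrokenString ε f n) (F : N.Framing ε f) : ∃ m : ℤ, b.IsMaslovIndex F m := by
  choose g hg hb using b.exists_isBlock hs hf ha F
  obtain ⟨n', rfl⟩ : ∃ n', n = n' + 1 := Nat.exists_eq_succ_of_ne_zero (NeZero.ne n)
  set G : ℕ → ℝ → ℝ := fun k => g (Fin.ofNat (n' + 1) k) with hG
  have hsucc : ∀ k : ℕ, Fin.ofNat (n' + 1) k + 1 = Fin.ofNat (n' + 1) (k + 1) := fun k => by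
    ext
    simp [Fin.val_add]
  have hlast : (Fin.last n' : Fin (n' + 1)) + 1 = 0 := Fin.last_add_one n'
  obtain ⟨Θ, h1, h2⟩ := exists_concat_blocks n' (g := G) (fun k _ => hg _) fun k hk => by
    have h3 := (hb (Fin.ofNat (n' + 1) k)).spansLine_end hs
    rw [hsucc] at h3
    have h4 := (hb (Fin.ofNat (n' + 1) (k + 1))).spansLine_source hs
    exact h4.exists_int h3
  have h3 : ∀ k : Fin (n' + 1), b.IsBlock F k fun t => Θ (3 * (k : ℕ) + t) := by
    intro k
    obtain ⟨m, hm⟩ := h2 k (by omega)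
    have hk : Fin.ofNat (n' + 1) (k : ℕ) = k := by ext; simp
    simp only [hG, hk] at hm
    exact (hb k).add_int m hm
  have h4 := (h3 0).spansLine_source hs
  have h5 := (h3 (Fin.last n')).spansLine_end hs
  rw [hlast] at h5
  obtain ⟨m, hm⟩ := h4.exists_int h5
  refine ⟨m, isMaslovIndex_iff.2 ⟨Θ, h1, h3, ?_⟩⟩
  simp only [Fin.val_last, Fin.val_zero, Nat.cast_zero, mul_zero, add_zero] at hm
  rw [sub_eq_iff_eq_add', ← hm]
  congr 1
  push_cast
  ring

end BrokenString

end StandardNeighborhood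

end LegendrianSurgery

/-! ### The theorem -/

open LegendrianSurgery
theorem mainTheorem5 {ι : Type*} [Finite ι] (L : SurgeryLink ι)
    (hgen : L.ChordGeneric) (hgood : L.GoodPosition)
    (ε₀ : ℝ) (hε₀ : 0 < ε₀) (N : StandardNeighborhood L ε₀) :
    ∃ ε₁ : ℝ, 0 < ε₁ ∧ ε₁ ≤ ε₀ ∧
      ∀ ε : ℝ, 0 < ε → ε < ε₁ →
      ∀ f : ℝ → ℝ, IsTwistProfile f → IsAdapted L ε f →
      ∀ (F : N.Framing ε f) (n : ℕ) [NeZero n] (b : N.BrokenString ε f n),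
        (∀ k, ∃! w : List L.Chord, L.IsWord w ∧ (b.chord k).HasWord w) ∧
        ∀ w : Fin n → List L.Chord, (∀ k, L.IsWord (w k) ∧ (b.chord k).HasWord (w k)) →
          ∃ m : ℤ, (∀ m' : ℤ, b.IsMaslovIndex F m' ↔ m' = m) ∧
            (m : ℝ) = ∑ k : Fin n,
              (b.arcAngle k / Real.pi - 1 / 2
                + ((b.sign k : ℤ) : ℝ) * (L.wordIndex (w k) : ℝ)) := by
  -- The conditions in `Small` involve only the link and its tubes, so the bound is fixed before the
  -- profile and the framing are chosen.
  obtain ⟨ε₁, hε₁, h⟩ := mem_nhdsGT_iff_exists_Ioo_subset.1 (N.eventually_small hgen hε₀)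
  refine ⟨min ε₁ ε₀, lt_min hε₁ hε₀, min_le_right _ _, fun ε hε hlt f hf ha F n _ b => ?_⟩
  have hs : N.Small ε := h ⟨hε, hlt.trans_le (min_le_left _ _)⟩
  refine ⟨fun k => (b.chord k).existsUnique_word hs hf, fun w hw => ?_⟩
  obtain ⟨m, hm⟩ := b.exists_isMaslovIndex hs hf ha F
  -- The formula holds for every degree of the loop, so it also shows that there is only one.
  have hsum := hm.eq_sum hs hf ha hw
  refine ⟨m, fun m' => ⟨fun h' => ?_, fun h' => h' ▸ hm⟩, hsum⟩
  exact_mod_cast (h'.eq_sum hs hf ha hw).trans hsum.symm
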